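/- Let $S$ be a non-orientable compact smooth surface (without boundary), let $m\ge 1$, and let $Z\subset S$ be a closed hypersurface with an adapted distance function $\lambda$, i.e. a continuous function $\lambda\colon S\to[0,\infty)$ with $\lambda^{-1}(0)=Z$ such that every point of $Z$ has an open neighbourhood on which $\lambda=|x|$ for a smooth function $x$ with nowhere vanishing differential (an adapted defining function of $Z$). A $b^m$-form of degree $k\ge 1$ on $(S,Z)$ is a smooth section of the $k$-th exterior power of the $b^m$-cotangent bundle, i.e. a smooth $k$-form on $S\setminus Z$ that near each point of $Z$ can be written as $\frac{dx}{x^m}\wedge\alpha+\beta$ with $x$ an adapted defining function and $\alpha,\beta$ smooth forms of degrees $k-1$ and $k$; a $b^m$-form of degree $0$ is a smooth function on $S$. The exterior derivative on $S\setminus Z$ makes the $b^m$-forms a complex, whose cohomology is the $b^m$-cohomology. A $b^m$-symplectic form on $(S,Z)$ is a closed $b^m$-form of degree $2$ that is nondegenerate at every point, as an alternating form on the fibre of the $b^m$-tangent bundle (at a point of $Z$ this means that $dx\wedge\alpha\neq 0$ there). Let $\omega_1,\omega_2$ be two $b^m$-symplectic forms on $(S,Z)$ with $[\omega_1]=[\omega_2]$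 in $b^m$-cohomology, that is, $\omega_1-\omega_2=d\alpha$ for a $b^m$-form $\alpha$ of degree $1$. Then there is a diffeomorphism $\varphi\colon S\to S$ that is a $b^m$-map, i.e. $\varphi^{-1}(Z)=Z$ and near each $p\in Z$ one has $y\circ\varphi=x+h\,x^m$ for suitable adapted defining functions $x$ near $p$ and $y$ near $\varphi(p)$ and a smooth function $h$, such that $\varphi^*\omega_2=\omega_1$. -/

import Mathlib

open Set Topology
open scoped Manifold ContDiff

noncomputable section

namespace BmSurface

/-- The model space `ℝ²`. -/
abbrev Plane : Type := EuclideanSpace ℝ (Fin 2)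

variable {S : Type*} [TopologicalSpace S] [ChartedSpace Plane S]

/-- A surface is orientable if it is covered by charts of its smooth structure all of whose
transition maps have positive Jacobian determinant. -/
def Orientable (S : Type*) [TopologicalSpace S] [ChartedSpace Plane S] : Prop :=
  ∃ A : Set (OpenPartialHomeomorph S Plane),
    A ⊆ IsManifold.maximalAtlas (𝓡 2) ∞ S ∧
    (∀ p : S, ∃ e ∈ A, p ∈ e.source) ∧
    ∀ e ∈ A, ∀ e' ∈ A, ∀ y ∈ (e.symm ≫ₕ e').source,
      0 < (fderiv ℝ (e.symm ≫ₕ e') y).det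

/-! ### Differential forms on a surface -/

/-- A (not necessarily continuous) field of alternating `k`-forms: `η p` is an alternating form on
the tangent space of `S` at `p`, which in Mathlib is by definition a copy of the model space
(identified through the preferred chart at `p`). -/
abbrev FormField (S : Type*) (k : ℕ) : Type _ := S → Plane [⋀^Fin k]→L[ℝ] ℝ

/-- The differential of a real function at `q`, as a covector. -/
def dFun (x : S → ℝ) (q : S) : Plane →L[ℝ] ℝ := mfderiv (𝓡 2) 𝓘(ℝ, ℝ) x q

/-- The pullback of a form under a map `S → S`. -/
def pullback {k : ℕ} (φ : S → S) (η : FormField S k) : FormField S k := fun q =>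
  (η (φ q)).compContinuousLinearMap (mfderiv (𝓡 2) (𝓡 2) φ q : Plane →L[ℝ] Plane)

/-- The expression of `η` in the preferred chart at `p`: the pullback of `η` under the inverse of
the chart (meaningful on the target of the chart). -/
def inChart {k : ℕ} (η : FormField S k) (p : S) : Plane → Plane [⋀^Fin k]→L[ℝ] ℝ := fun y =>
  (η ((extChartAt (𝓡 2) p).symm y)).compContinuousLinearMap
    (mfderiv 𝓘(ℝ, Plane) (𝓡 2) (extChartAt (𝓡 2) p).symm y : Plane →L[ℝ] Plane)

/-- `η` is a smooth differential form on the open set `U`. -/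
def SmoothFormOn {k : ℕ} (η : FormField S k) (U : Set S) : Prop :=
  ∀ p : S, ContDiffOn ℝ ∞ (inChart η p)
    ((extChartAt (𝓡 2) p).target ∩ (extChartAt (𝓡 2) p).symm ⁻¹' U)

/-- The exterior derivative, computed at each point in the preferred chart there. -/
def extD {k : ℕ} (η : FormField S k) : FormField S (k + 1) := fun p =>
  (extDeriv (inChart η p) (extChartAt (𝓡 2) p p)).compContinuousLinearMap
    (mfderiv (𝓡 2) 𝓘(ℝ, Plane) (extChartAt (𝓡 2) p) p : Plane →L[ℝ] Plane)

/-- The wedge product `θ ∧ α` of a covector with an alternating `k`-form,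
`(θ ∧ α)(v₀, …, v_k) = ∑ i, (-1)^i θ(v_i) α(v₀, …, v̂_i, …, v_k)`. -/
def wedge {k : ℕ} (θ : Plane →L[ℝ] ℝ) (α : Plane [⋀^Fin k]→L[ℝ] ℝ) :
    Plane [⋀^Fin (k + 1)]→L[ℝ] ℝ :=
  ContinuousAlternatingMap.alternatizeUncurryFin (θ.smulRight α)

/-! ### `b^m`-surfaces -/

/-- The datum that turns a surface into a `b^m`-surface `(S, Z)`, for every `m`: a closed
hypersurface `Z` together with an adapted distance function `dist` to `Z`, i.e. one which near each
point of `Z` is `|x|` for a smooth local defining function `x` of `Z`. -/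
structure Critical (S : Type*) [TopologicalSpace S] [ChartedSpace Plane S] where
  /-- the critical set -/
  Z : Set S
  /-- the adapted distance to the critical set -/
  dist : S → ℝ
  continuous_dist : Continuous dist
  dist_nonneg : ∀ p, 0 ≤ dist p
  dist_eq_zero_iff : ∀ p, dist p = 0 ↔ p ∈ Z
  exists_local : ∀ p ∈ Z, ∃ (U : Set S) (x : S → ℝ), p ∈ U ∧ IsOpen U ∧
    ContMDiffOn (𝓡 2) 𝓘(ℝ, ℝ) ∞ x U ∧ (∀ q ∈ U, dFun x q ≠ 0) ∧ ∀ q ∈ U, |x q| = dist q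

/-- `x` is, on the open set `U`, an adapted defining function of `Z`: smooth, without critical
points, and `|x|` is the adapted distance. -/
structure Critical.IsDefining (B : Critical S) (U : Set S) (x : S → ℝ) : Prop where
  isOpen : IsOpen U
  smooth : ContMDiffOn (𝓡 2) 𝓘(ℝ, ℝ) ∞ x U
  dFun_ne_zero : ∀ q ∈ U, dFun x q ≠ 0
  abs_eq : ∀ q ∈ U, |x q| = B.dist q

/-- On `U` one has `η = (dx / x^m) ∧ α + β`, where `x` is an adapted defining function of `Z` on
`U` and `α`, `β` are smooth differential forms on `U`. -/
structure IsDecomposition {k : ℕ} (m : ℕ) (B : Critical S) (U : Set S) (x : S → ℝ)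
    (η : FormField S (k + 1)) (α : FormField S k) (β : FormField S (k + 1)) : Prop where
  isDefining : B.IsDefining U x
  smooth_left : SmoothFormOn α U
  smooth_right : SmoothFormOn β U
  eq : ∀ q ∈ U, q ∉ B.Z → η q = (x q ^ m)⁻¹ • wedge (dFun x q) (α q) + β q

/-- `b^m`-forms of degree `k` on `(S, Z)`, i.e. smooth sections of the `k`-th exterior power of the
`b^m`-cotangent bundle, which is generated near `Z` by `dx / x^m` and the ordinary covectors.
Such a section is determined by its restriction to the dense set `S \ Z`, where it is an ordinary
form; the values of `η` at points of `Z` are irrelevant. In degree zero these are the smooth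
functions. -/
def IsBmForm (m : ℕ) (B : Critical S) : {k : ℕ} → FormField S k → Prop
  | 0, η => ∃ β : FormField S 0, SmoothFormOn β univ ∧ ∀ q ∉ B.Z, η q = β q
  | _ + 1, η => SmoothFormOn η B.Zᶜ ∧
      ∀ p ∈ B.Z, ∃ U x α β, p ∈ U ∧ IsDecomposition m B U x η α β

/-- Two forms define the same `b^m`-cohomology class: they differ by the differential of a
`b^m`-form (equality of `b^m`-forms being tested on the dense set `S \ Z`). -/
def SameClass {k : ℕ} (m : ℕ) (B : Critical S) (η₁ η₂ : FormField S (k + 1)) : Prop :=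
  ∃ α : FormField S k, IsBmForm m B α ∧ ∀ q ∉ B.Z, η₁ q - η₂ q = extD α q

/-- A `b^m`-symplectic form on the `b^m`-surface `(S, Z)`: a closed `b^m`-form of degree two which
is nondegenerate at every point. As the fibre of the `b^m`-tangent bundle is a plane, the latter
says that the value of `η` in the second exterior power of the `b^m`-cotangent fibre is nonzero.
At `p ∈ Z`, where `η = (dx / x^m) ∧ α + β`, the summand `β` (a smooth multiple of `x^m` times a
generator) does not contribute to this value, so it is nonzero iff `dx ∧ α` is nonzero at `p`. -/
structure IsBmSymplectic (m : ℕ) (B : Critical S) (η : FormField S 2) : Prop where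
  isBmForm : IsBmForm m B η
  closed : ∀ q ∉ B.Z, extD η q = 0
  nondegenerate_off : ∀ q ∉ B.Z, η q ≠ 0
  nondegenerate_on : ∀ p ∈ B.Z, ∃ U x α β, p ∈ U ∧ IsDecomposition m B U x η α β ∧
    wedge (dFun x p) (α p) ≠ 0

/-- `φ` is a `b^m`-map of `(S, Z)`: it maps `Z` and only `Z` into `Z`, and it pulls back adapted
defining functions to adapted defining functions up to terms of order `m` along `Z` (so that the
pullback of `b^m`-forms under `φ` makes sense along `Z` too). -/
def IsBmMap (m : ℕ) (B : Critical S) (φ : S → S) : Prop :=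
  (∀ p, φ p ∈ B.Z ↔ p ∈ B.Z) ∧
  ∀ p ∈ B.Z, ∃ (U V : Set S) (x y h : S → ℝ), p ∈ U ∧ B.IsDefining U x ∧
    φ p ∈ V ∧ B.IsDefining V y ∧ MapsTo φ U V ∧
    ContMDiffOn (𝓡 2) 𝓘(ℝ, ℝ) ∞ h U ∧ ∀ q ∈ U, y (φ q) = x q + h q * x q ^ m

end BmSurface

end

/-!
The proof is a Moser argument without flows. Write `ω = η₂` and `η₁ - ω = dα`. Near each point there
is an adapted chart `(x, y)` in which `ω = c x^{-m} dx ∧ dy` with `c > 0`, and a partition of unity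
splits `α` into pieces `P x^{-m} dx + Q dy` that are supported in such charts (`exists_atlas`). The
quotient `d(Q dy) / ω = x^m ∂Q/∂x / c` and the quotient `d(P x^{-m} dx) / ω = -∂P/∂y / c` are smooth
functions on the whole surface, so that `η₁ = f ω` with `f` smooth, equal to one plus a finite sum
of such quotients (`Atlas.extD_eq`).

*Small moves.* A small multiple of one such quotient can be added to the density `F` of a form `F ω`
by a diffeomorphism that moves only one coordinate of one chart. For `Q dy` this is the following
one-dimensional fact, with `y` as a parameter (`exists_rearrangement`): if `a > 0` and `Q` is small,
then there is a smooth `h` such that the substitution `x ↦ x + h x^m` carries the singular density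
`a x^{-m} + ∂Q/∂x` to `a x^{-m}`. Indeed, put the new position at `x exp (x^{m-1} g)`; in the
variable `g` the mass of `a x^{-m} dx` between the old and the new position is a smooth function,
across `x = 0` too, which is strictly increasing in `g`, and it has to be equal to `Q`. The
resulting map is by construction a `b^m`-map. For `P x^{-m} dx` the same fact, with exponent one and
the coordinates exchanged, gives a map that preserves `x`
(`BChart.exists_step_x`, `BChart.exists_step_y`).

*Positivity.* Since the moves need positive densities, `f > 0` is required
(`Atlas.one_add_sum_ratio_pos`); then the segment from `1` to `f` is followed in many small moves
(`moves_one_add_sum`). Nondegeneracy shows that `f` has no zeros, on the critical set by a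
comparison of leading coefficients, so that `K = {f < 0}` is open and closed. If `K` meets the
critical set `Z`, then the square of the coefficient `P` of `x^{-m} dx` in `α`, which on `Z` does
not depend on the chart, has a maximum on `K ∩ Z`; there `∂P/∂y = 0`, which means `f = 1`
(`IsBmSymplectic.exists_eq_one`). If `K` does not meet `Z`, then the integral of `(f - 1) |ω|` over
`K` is zero by Stokes' theorem, although `f - 1 < 0` on `K`, so that `K` is empty
(`Atlas.eq_empty_of_ratio_neg`). No orientation is needed, as the quotient `f` and the density
`|ω|` make sense without one.
-/

noncomputable section

namespace BmSurface

/-! ### Parametric integrals and implicit functions -/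

universe u

/-- Differentiation under the integral sign. The target space varies in the induction on the order
of differentiability, because the derivative of the integrand takes values in `E →L[ℝ] F`. -/
theorem contDiff_nat_parametric_integral {E : Type u} [NormedAddCommGroup E] [NormedSpace ℝ E]
    [FiniteDimensional ℝ E] (n : ℕ) : ∀ {F : Type u} [NormedAddCommGroup F] [NormedSpace ℝ F]
    {k : E × ℝ → F}, ContDiff ℝ ∞ k → ContDiff ℝ n (fun p : E => ∫ s in (0 : ℝ)..1, k (p, s)) := by
  induction n with
  | zero =>
    intro F iF iF' k hk
    have : Continuous (fun p : E => ∫ s in (0 : ℝ)..1, k (p, s)) :=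
      intervalIntegral.continuous_parametric_intervalIntegral_of_continuous'
        (f := fun p s => k (p, s)) (by simpa [Function.uncurry_def] using hk.continuous) 0 1
    exact_mod_cast contDiff_zero.2 this
  | succ n ih =>
    intro F _ _ k hk
    push_cast
    rw [contDiff_succ_iff_hasFDerivAt]
    have hk' : ContDiff ℝ ∞ (fun q : E × ℝ => (fderiv ℝ k q).comp
        (ContinuousLinearMap.inl ℝ E ℝ)) :=
      (hk.fderiv_right (m := ∞) (by simp)).clm_comp contDiff_const
    refine ⟨fun p => ∫ s in (0 : ℝ)..1, (fderiv ℝ k (p, s)).comp (ContinuousLinearMap.inl ℝ E ℝ),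
      ih hk', fun p => ?_⟩
    obtain ⟨C, hC⟩ := ((isCompact_closedBall p 1).prod (isCompact_Icc (a := (0 : ℝ)) (b := 1))
      ).exists_bound_of_continuousOn hk'.continuous.continuousOn
    refine (intervalIntegral.hasFDerivAt_integral_of_dominated_of_fderiv_le
      (𝕜 := ℝ) (F := fun p s => k (p, s)) (μ := MeasureTheory.volume) (a := 0) (b := 1)
      (F' := fun p s => (fderiv ℝ k (p, s)).comp (ContinuousLinearMap.inl ℝ E ℝ))
      (bound := fun _ => C) (Metric.closedBall_mem_nhds p one_pos)
      ?_ ?_ ?_ ?_ ?_ ?_)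
    · refine .of_forall fun x => Continuous.aestronglyMeasurable ?_
      exact hk.continuous.comp (by fun_prop)
    · exact (hk.continuous.comp
        (by fun_prop : Continuous fun s : ℝ => (p, s))).intervalIntegrable _ _
    · exact (hk'.continuous.comp
        (by fun_prop : Continuous fun s : ℝ => (p, s))).aestronglyMeasurable
    · refine .of_forall fun t ht x hx => hC (x, t) ⟨hx, ?_⟩
      rw [uIoc_of_le zero_le_one] at ht
      exact ⟨ht.1.le, ht.2⟩
    · exact intervalIntegrable_const
    · refine .of_forall fun t _ x _ => ?_
      exact ((hk.differentiable (by simp)) (x, t)).hasFDerivAt.comp x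
        (hasFDerivAt_prodMk_left x t)

theorem contDiff_parametric_integral {E F : Type u} [NormedAddCommGroup E] [NormedSpace ℝ E]
    [FiniteDimensional ℝ E] [NormedAddCommGroup F] [NormedSpace ℝ F]
    {k : E × ℝ → F} (hk : ContDiff ℝ ∞ k) :
    ContDiff ℝ ∞ (fun p : E => ∫ s in (0 : ℝ)..1, k (p, s)) :=
  contDiff_infty.2 fun n => contDiff_nat_parametric_integral n hk

/-- The primitive of a smooth function in its last variable is jointly smooth. -/
theorem contDiff_primitive {E : Type} [NormedAddCommGroup E] [NormedSpace ℝ E]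
    [FiniteDimensional ℝ E] {k : E × ℝ → ℝ} (hk : ContDiff ℝ ∞ k) :
    ContDiff ℝ ∞ (fun p : E × ℝ => ∫ s in (0 : ℝ)..p.2, k (p.1, s)) := by
  have h1 : ContDiff ℝ ∞ (fun p : E × ℝ => p.2 * ∫ s in (0 : ℝ)..1, k (p.1, p.2 * s)) := by
    refine contDiff_snd.mul (contDiff_parametric_integral
      (k := fun q : (E × ℝ) × ℝ => k (q.1.1, q.1.2 * q.2)) (hk.comp ?_))
    fun_prop
  convert h1 using 2 with p
  have := intervalIntegral.smul_integral_comp_mul_left (a := 0) (b := 1)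
    (fun s => k (p.1, s)) p.2
  simpa using this.symm

theorem hasDerivAt_primitive {E : Type*} [NormedAddCommGroup E] [NormedSpace ℝ E]
    {k : E × ℝ → ℝ} (hk : Continuous k) (z : E) (g : ℝ) :
    HasDerivAt (fun g => ∫ s in (0 : ℝ)..g, k (z, s)) (k (z, g)) g := by
  have : Continuous fun s => k (z, s) := hk.comp (by fun_prop)
  exact intervalIntegral.integral_hasDerivAt_right (this.intervalIntegrable _ _)
    this.aestronglyMeasurable.stronglyMeasurableAtFilter this.continuousAt

/-- Global implicit function theorem for an equation `F (z, g) = 0` that is strictly increasing in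
the real unknown `g`. -/
theorem contDiff_of_implicit {E : Type*} [NormedAddCommGroup E] [NormedSpace ℝ E]
    [CompleteSpace E] {F : E × ℝ → ℝ} (hF : ContDiff ℝ ∞ F) {F' : E × ℝ → ℝ}
    (hF' : ∀ z g, HasDerivAt (fun g => F (z, g)) (F' (z, g)) g) (hpos : ∀ q, 0 < F' q)
    {g : E → ℝ} (hg : ∀ z, F (z, g z) = 0) : ContDiff ℝ ∞ g := by
  rw [contDiff_iff_contDiffAt]
  intro z
  have hd : fderiv ℝ F (z, g z) ∘SL ContinuousLinearMap.inr ℝ E ℝ =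
      ContinuousLinearMap.toSpanSingleton ℝ (F' (z, g z)) := by
    have := ((hF.differentiable (by simp)) (z, g z)).hasFDerivAt.comp (g z)
      (hasFDerivAt_prodMk_right z (g z))
    exact this.unique (hF' z (g z)).hasFDerivAt
  have hinv : (fderiv ℝ F (z, g z) ∘SL ContinuousLinearMap.inr ℝ E ℝ).IsInvertible := by
    rw [hd]
    refine ⟨ContinuousLinearEquiv.unitsEquivAut ℝ (Units.mk0 _ (hpos (z, g z)).ne'), ?_⟩
    ext
    simp
  have hc := hF.contDiffAt (x := (z, g z))
  have h1 := hc.contDiffAt_implicitFunction (by simp) hinv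
  refine h1.congr_of_eventuallyEq ?_
  have h2 := hc.eventually_apply_implicitFunction (by simp) hinv
  filter_upwards [h2] with w hw
  have hmono : StrictMono fun g => F (w, g) :=
    strictMono_of_hasDerivAt_pos (f' := fun g => F' (w, g)) (hF' w) (fun g => hpos _)
  apply hmono.injective
  simp only
  rw [hw, hg, hg]

/-! ### Rearrangement of densities on a line, with parameters -/

/-- The entire function `(exp w - 1) / w`, as an integral that makes sense at `w = 0`. -/
def expQuot (w : ℝ) : ℝ := ∫ s in (0 : ℝ)..1, Real.exp (w * s)

theorem contDiff_expQuot : ContDiff ℝ ∞ expQuot :=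
  contDiff_parametric_integral (k := fun q : ℝ × ℝ => Real.exp (q.1 * q.2)) (by fun_prop)

theorem mul_expQuot (w : ℝ) : w * expQuot w = Real.exp w - 1 := by
  have := intervalIntegral.smul_integral_comp_mul_left (a := 0) (b := 1) Real.exp w
  simp only [mul_zero, mul_one, smul_eq_mul, integral_exp, Real.exp_zero] at this
  exact this

/-- The derivative of a smooth function on `ℝ × ℝ` in its first variable. -/
theorem hasDerivAt_fst_slice {f : ℝ × ℝ → ℝ} (hf : ContDiff ℝ ∞ f) (t s : ℝ) :
    HasDerivAt (fun t => f (t, s)) (fderiv ℝ f (t, s) (1, 0)) t := by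
  have := ((hf.differentiable (by simp)) (t, s)).hasFDerivAt.comp_hasDerivAt t
    ((hasDerivAt_id t).prodMk (hasDerivAt_const t s))
  exact this

theorem continuous_fderiv_apply {f : ℝ × ℝ → ℝ} (hf : ContDiff ℝ ∞ f) (v : ℝ × ℝ) :
    Continuous fun z => fderiv ℝ f z v :=
  (hf.continuous_fderiv (by simp)).clm_apply continuous_const

/-- The density of the singular measure `a(t, s) t^{-(k+1)} dt` in the coordinate `τ` in which
`t exp (t^k τ)` is the position; it is smooth across `t = 0`. -/
def flowDensity (k : ℕ) (a : ℝ × ℝ → ℝ) (q : (ℝ × ℝ) × ℝ) : ℝ :=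
  a (q.1.1 * Real.exp (q.1.1 ^ k * q.2), q.1.2) * Real.exp (-(k * (q.1.1 ^ k * q.2)))

theorem contDiff_flowDensity (k : ℕ) {a : ℝ × ℝ → ℝ} (ha : ContDiff ℝ ∞ a) :
    ContDiff ℝ ∞ (flowDensity k a) := by
  unfold flowDensity
  refine (ha.comp ?_).mul ?_ <;> fun_prop

theorem le_flowDensity {k : ℕ} {a : ℝ × ℝ → ℝ} {κ R : ℝ} (hκ : 0 < κ) (hak : ∀ z, κ ≤ a z)
    {q : (ℝ × ℝ) × ℝ} (h1 : |q.1.1| ≤ R) (h2 : |q.2| ≤ 1) :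
    κ * Real.exp (-(k * R ^ k)) ≤ flowDensity k a q := by
  unfold flowDensity
  refine mul_le_mul (hak _) ?_ (Real.exp_pos _).le (hκ.le.trans (hak _))
  rw [Real.exp_le_exp, neg_le_neg_iff]
  refine mul_le_mul_of_nonneg_left ?_ (Nat.cast_nonneg k)
  refine (le_abs_self _).trans ?_
  rw [abs_mul, abs_pow]
  calc |q.1.1| ^ k * |q.2| ≤ R ^ k * 1 :=
        mul_le_mul (pow_le_pow_left₀ (abs_nonneg _) h1 k) h2 (abs_nonneg _)
          (pow_nonneg ((abs_nonneg _).trans h1) k)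
    _ = R ^ k := mul_one _

/-- The mass `∫ a(r, s) r^{-(k+1)} dr` between `t` and `t exp (t^k g)`, see
`flowMass_eq_sub`. -/
def flowMass (k : ℕ) (a : ℝ × ℝ → ℝ) (q : (ℝ × ℝ) × ℝ) : ℝ :=
  ∫ τ in (0 : ℝ)..q.2, flowDensity k a (q.1, τ)

/-- Since the density is bounded below for `|τ| ≤ 1`, its mass takes on every small value. -/
theorem exists_flowMass_eq {k : ℕ} {a : ℝ × ℝ → ℝ} (ha : ContDiff ℝ ∞ a) {κ R : ℝ} (hκ : 0 < κ)
    (hak : ∀ z, κ ≤ a z) {z : ℝ × ℝ} (hz : |z.1| ≤ R) {w : ℝ}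
    (hw : |w| < κ * Real.exp (-(k * R ^ k))) : ∃ g, flowMass k a (z, g) = w := by
  have hc : Continuous fun τ => flowDensity k a (z, τ) :=
    (contDiff_flowDensity k ha).continuous.comp (by fun_prop)
  set κ' := κ * Real.exp (-(k * R ^ k)) with hκ'
  have h1 : κ' ≤ flowMass k a (z, 1) := by
    have := intervalIntegral.integral_mono_on (a := 0) (b := 1) zero_le_one
      (intervalIntegrable_const (c := κ') (μ := MeasureTheory.volume))
      (hc.intervalIntegrable 0 1)
      fun τ hτ => le_flowDensity (k := k) hκ hak (q := (z, τ)) hz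
        (abs_le.2 ⟨by linarith [hτ.1], hτ.2⟩)
    simpa [flowMass] using this
  have h2 : flowMass k a (z, -1) ≤ -κ' := by
    have := intervalIntegral.integral_mono_on (a := -1) (b := 0) (by norm_num)
      (intervalIntegrable_const (c := κ') (μ := MeasureTheory.volume))
      (hc.intervalIntegrable (-1) 0)
      fun τ hτ => le_flowDensity (k := k) hκ hak (q := (z, τ)) hz
        (abs_le.2 ⟨hτ.1, by linarith [hτ.2]⟩)
    rw [flowMass, intervalIntegral.integral_symm]
    simpa using this
  have hcont : Continuous fun g => flowMass k a (z, g) := by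
    unfold flowMass
    exact intervalIntegral.continuous_primitive (fun _ _ => hc.intervalIntegrable _ _) 0
  have := intermediate_value_Icc (show (-1 : ℝ) ≤ 1 by norm_num) hcont.continuousOn
  obtain ⟨hl, hr⟩ := abs_lt.1 hw
  obtain ⟨g, -, hg⟩ := this (show w ∈ Icc _ _ from ⟨by linarith, by linarith⟩)
  exact ⟨g, hg⟩

theorem hasDerivAt_flowMass (k : ℕ) {a : ℝ × ℝ → ℝ} (ha : ContDiff ℝ ∞ a) (z : ℝ × ℝ) (g : ℝ) :
    HasDerivAt (fun g => flowMass k a (z, g)) (flowDensity k a (z, g)) g :=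
  hasDerivAt_primitive (contDiff_flowDensity k ha).continuous z g

/-- A primitive of the singular density on the half line that contains `t₀`. -/
theorem hasDerivAt_singular_primitive (n : ℕ) {a : ℝ × ℝ → ℝ} (ha : Continuous a)
    (s : ℝ) {t₀ t : ℝ} (ht : 0 < t * t₀) :
    HasDerivAt (fun t => ∫ r in t₀..t, a (r, s) / r ^ n) (a (t, s) / t ^ n) t := by
  have hco : ContinuousOn (fun r => a (r, s) / r ^ n) {0}ᶜ := by
    refine ContinuousOn.div ?_ (by fun_prop) fun r hr => pow_ne_zero _ hr
    exact (ha.comp (by fun_prop : Continuous fun r : ℝ => (r, s))).continuousOn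
  have ht0 : t ≠ 0 := by rintro rfl; simp at ht
  have hsub : uIcc t₀ t ⊆ {0}ᶜ := by
    rintro r hr rfl
    rcases mem_uIcc.1 hr with h | h
    · rcases h.1.lt_or_eq with h' | h'
      · linarith [mul_nonpos_of_nonneg_of_nonpos h.2 h.1]
      · simp [h'] at ht
    · linarith [mul_nonpos_of_nonpos_of_nonneg h.1 h.2]
  refine intervalIntegral.integral_hasDerivAt_right (hco.mono hsub).intervalIntegrable
    (hco.stronglyMeasurableAtFilter isOpen_compl_singleton t ht0)
    (hco.continuousAt (isOpen_compl_singleton.mem_nhds ht0))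

/-- Off the singular line, `flowMass` is an increment of a primitive of the singular density: the
substitution `r = t exp (t^k τ)`. -/
theorem flowMass_eq_sub (k : ℕ) {a : ℝ × ℝ → ℝ} (ha : ContDiff ℝ ∞ a) (s : ℝ) {t₀ t : ℝ}
    (ht : 0 < t * t₀) (g : ℝ) :
    flowMass k a ((t, s), g) = (∫ r in t₀..(t * Real.exp (t ^ k * g)), a (r, s) / r ^ (k + 1)) -
      ∫ r in t₀..t, a (r, s) / r ^ (k + 1) := by
  have ht0 : t ≠ 0 := by rintro rfl; simp at ht
  have hd : ∀ g, HasDerivAt (fun g => flowMass k a ((t, s), g) -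
      ∫ r in t₀..(t * Real.exp (t ^ k * g)), a (r, s) / r ^ (k + 1)) 0 g := by
    intro g
    have hpos : 0 < t * Real.exp (t ^ k * g) * t₀ := by
      have := mul_pos ht (Real.exp_pos (t ^ k * g)); linarith
    have h1 := (hasDerivAt_singular_primitive (k + 1) ha.continuous s hpos).comp g
      ((((hasDerivAt_id g).const_mul (t ^ k)).exp).const_mul t)
    have h2 := (hasDerivAt_flowMass k ha (t, s) g).sub h1
    refine h2.congr_deriv ?_
    simp only [flowDensity, id]
    rw [Real.exp_neg, Real.exp_nat_mul]
    have he := Real.exp_ne_zero (t ^ k * g)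
    generalize Real.exp (t ^ k * g) = e at he
    rw [mul_pow]
    field_simp
    ring
  have := is_const_of_deriv_eq_zero (fun g => (hd g).differentiableAt) (fun g => (hd g).deriv) g 0
  simp only [flowMass, mul_zero, Real.exp_zero, mul_one, intervalIntegral.integral_same] at this ⊢
  linarith

/-- Rearrangement of the density `a t^{-(k+1)}` on lines: if `Q` is small, then moving each point
`t` to `t + h t^{k+1}` carries the density `a t^{-(k+1)} + ∂_t Q` to `a t^{-(k+1)}`, where `h` is
smooth and vanishes where `Q` does. -/
theorem exists_rearrangement (k : ℕ) {a Q : ℝ × ℝ → ℝ} (ha : ContDiff ℝ ∞ a) (hQ : ContDiff ℝ ∞ Q)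
    {κ R : ℝ} (hκ : 0 < κ) (hak : ∀ z, κ ≤ a z) (hQR : ∀ z, R < |z.1| → Q z = 0)
    (hQs : ∀ z, |Q z| < κ * Real.exp (-(k * R ^ k)))
    (hpos : ∀ z, 0 < a z + z.1 ^ (k + 1) * fderiv ℝ Q z (1, 0)) :
    ∃ h : ℝ × ℝ → ℝ, ContDiff ℝ ∞ h ∧ (∀ z, Q z = 0 → h z = 0) ∧ (∀ z, 0 < 1 + z.1 ^ k * h z) ∧
      ∀ z, 0 < fderiv ℝ (fun z : ℝ × ℝ => z.1 + h z * z.1 ^ (k + 1)) z (1, 0) ∧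
        a (z.1 + h z * z.1 ^ (k + 1), z.2) *
          fderiv ℝ (fun z : ℝ × ℝ => z.1 + h z * z.1 ^ (k + 1)) z (1, 0) =
        (a z + z.1 ^ (k + 1) * fderiv ℝ Q z (1, 0)) * (1 + z.1 ^ k * h z) ^ (k + 1) := by
  -- The point `t` moves to `t exp (t^k g)`, where the mass between the two points has to be `Q`.
  have hex : ∀ z, ∃ g, flowMass k a (z, g) = Q z := by
    intro z
    by_cases hz : |z.1| ≤ R
    · exact exists_flowMass_eq ha hκ hak hz (hQs z)
    · exact ⟨0, by simp [flowMass, hQR z (not_le.1 hz)]⟩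
  choose g hg using hex
  have hdpos : ∀ q, 0 < flowDensity k a q := fun q =>
    mul_pos (hκ.trans_le (hak _)) (Real.exp_pos _)
  have hgs : ContDiff ℝ ∞ g := by
    refine contDiff_of_implicit (F := fun q => flowMass k a q - Q q.1)
      (F' := flowDensity k a) ?_ ?_ hdpos ?_
    · exact (contDiff_primitive (contDiff_flowDensity k ha)).sub (hQ.comp contDiff_fst)
    · exact fun z g => (hasDerivAt_flowMass k ha z g).sub_const (Q z)
    · exact fun z => by simp [hg]
  have hg0 : ∀ z, Q z = 0 → g z = 0 := by
    intro z hz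
    have hmono : StrictMono fun g => flowMass k a (z, g) :=
      strictMono_of_hasDerivAt_pos (hasDerivAt_flowMass k ha z) (fun g => hdpos _)
    apply hmono.injective
    simp only [hg, hz]
    simp [flowMass]
  set h : ℝ × ℝ → ℝ := fun z => g z * expQuot (z.1 ^ k * g z) with hh
  have hhs : ContDiff ℝ ∞ h := hgs.mul (contDiff_expQuot.comp (by fun_prop))
  have hexp : ∀ z, 1 + z.1 ^ k * h z = Real.exp (z.1 ^ k * g z) := by
    intro z
    have := mul_expQuot (z.1 ^ k * g z)
    simp only [hh]
    linarith
  set u : ℝ × ℝ → ℝ := fun z => z.1 + h z * z.1 ^ (k + 1) with hu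
  have hus : ContDiff ℝ ∞ u := by fun_prop
  have hue : ∀ z, u z = z.1 * Real.exp (z.1 ^ k * g z) := by
    intro z
    rw [← hexp]
    simp only [hu]
    ring
  have hpos' : ∀ z, 0 < 1 + z.1 ^ k * h z := fun z => by rw [hexp]; exact Real.exp_pos _
  have key : ∀ z, a (u z, z.2) * fderiv ℝ u z (1, 0) =
      (a z + z.1 ^ (k + 1) * fderiv ℝ Q z (1, 0)) * (1 + z.1 ^ k * h z) ^ (k + 1) := by
    have hcont1 : Continuous fun z : ℝ × ℝ => a (u z, z.2) * fderiv ℝ u z (1, 0) := by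
      refine Continuous.mul ?_ (continuous_fderiv_apply hus _)
      exact ha.continuous.comp (hus.continuous.prodMk continuous_snd)
    have hcont2 : Continuous fun z : ℝ × ℝ =>
        (a z + z.1 ^ (k + 1) * fderiv ℝ Q z (1, 0)) * (1 + z.1 ^ k * h z) ^ (k + 1) := by
      have := continuous_fderiv_apply hQ (1, 0)
      have := ha.continuous
      have := hhs.continuous
      fun_prop
    have hdense : Dense {z : ℝ × ℝ | z.1 ≠ 0} :=
      (dense_compl_singleton (0 : ℝ)).preimage isOpenMap_fst
    -- Off `t = 0` this is the derivative of `flowMass_eq_sub`; the rest follows by continuity.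
    refine fun z => congrFun (Continuous.ext_on hdense hcont1 hcont2 ?_) z
    rintro ⟨t₀, s⟩ (ht₀ : t₀ ≠ 0)
    have htt : 0 < t₀ * t₀ := mul_self_pos.2 ht₀
    have hpos : 0 < u (t₀, s) * t₀ := by
      rw [hue]
      have := mul_pos htt (Real.exp_pos (t₀ ^ k * g (t₀, s)))
      simp only
      linarith
    have h1 := (hasDerivAt_singular_primitive (k + 1) ha.continuous s hpos).comp t₀
      (hasDerivAt_fst_slice hus t₀ s)
    have h2 := h1.sub (hasDerivAt_singular_primitive (k + 1) ha.continuous s htt)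
    have h3 : (fun t => Q (t, s)) =ᶠ[𝓝 t₀] (((fun t => ∫ r in t₀..t, a (r, s) / r ^ (k + 1)) ∘
        fun t => u (t, s)) - fun t => ∫ r in t₀..t, a (r, s) / r ^ (k + 1)) := by
      have : ∀ᶠ t in 𝓝 t₀, 0 < t * t₀ :=
        (continuous_id.mul continuous_const).continuousAt.eventually_const_lt htt
      filter_upwards [this] with t ht
      rw [← hg, flowMass_eq_sub k ha s ht]
      simp [hue]
    have h4 := (hasDerivAt_fst_slice hQ t₀ s).unique (h2.congr_of_eventuallyEq h3)
    have h5 : u (t₀, s) = t₀ * (1 + t₀ ^ k * h (t₀, s)) := by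
      rw [hue, ← hexp]
    have h6 := (hpos' (t₀, s)).ne'
    simp only at h4 h6 ⊢
    rw [h4]
    generalize a (u (t₀, s), s) = A
    rw [h5]
    generalize 1 + t₀ ^ k * h (t₀, s) = w at h6
    rw [mul_pow]
    field_simp
    ring
  refine ⟨h, hhs, fun z hz => by simp [hh, hg0 z hz], hpos', fun z => ⟨?_, key z⟩⟩
  have : 0 < a (u z, z.2) * fderiv ℝ u z (1, 0) := by
    rw [key]
    exact mul_pos (hpos z) (pow_pos (hpos' z) _)
  exact pos_of_mul_pos_right this (hκ.le.trans (hak _))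

/-! ### Diffeomorphisms of the plane that move one coordinate -/

/-- A smooth map `(t, s) ↦ (u (t, s), s)` that is increasing in `t` and the identity off a compact
set is a diffeomorphism. -/
theorem exists_equiv_of_increasing_fst {u : ℝ × ℝ → ℝ} (hu : ContDiff ℝ ∞ u)
    (hpos : ∀ z, 0 < fderiv ℝ u z (1, 0)) {K : Set (ℝ × ℝ)} (hK : IsCompact K)
    (huK : ∀ z ∉ K, u z = z.1) :
    ∃ Φ : ℝ × ℝ ≃ ℝ × ℝ, ContDiff ℝ ∞ Φ ∧ ContDiff ℝ ∞ Φ.symm ∧ ∀ z, Φ z = (u z, z.2) := by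
  obtain ⟨R, hR⟩ := hK.isBounded.exists_norm_le
  have hout : ∀ t s, R < |t| → u (t, s) = t := fun t s ht => huK (t, s) fun hmem => by
    have h1 := hR _ hmem
    have h2 : |t| ≤ ‖(t, s)‖ := norm_fst_le (t, s)
    linarith
  have hsurj : ∀ z : ℝ × ℝ, ∃ t, u (t, z.2) = z.1 := by
    rintro ⟨w, s⟩
    have hR0 := le_max_left R |w|
    have hw0 := le_max_right R |w|
    set M := max R |w| + 1
    have hM : R < |M| := by
      rw [abs_of_nonneg (by linarith [abs_nonneg w])]
      linarith
    have hc : Continuous fun t => u (t, s) := hu.continuous.comp (by fun_prop)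
    have := intermediate_value_Icc (show -M ≤ M by linarith [abs_nonneg w]) hc.continuousOn
    rw [hout _ _ hM, hout _ _ (by rwa [abs_neg])] at this
    obtain ⟨t, -, ht⟩ := this (show w ∈ Icc (-M) M from
      abs_le.1 (by linarith))
    exact ⟨t, ht⟩
  choose v hv using hsurj
  have hmono : ∀ s, StrictMono fun t => u (t, s) := fun s =>
    strictMono_of_hasDerivAt_pos (fun t => hasDerivAt_fst_slice hu t s) fun t => hpos _
  have hvs : ContDiff ℝ ∞ v := by
    refine contDiff_of_implicit (F := fun q : (ℝ × ℝ) × ℝ => u (q.2, q.1.2) - q.1.1)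
      (F' := fun q => fderiv ℝ u (q.2, q.1.2) (1, 0)) ?_ ?_ (fun q => hpos _) ?_
    · exact (hu.comp (by fun_prop)).sub (by fun_prop)
    · exact fun z g => (hasDerivAt_fst_slice hu g z.2).sub_const z.1
    · exact fun z => by simp [hv]
  refine ⟨⟨fun z => (u z, z.2), fun z => (v z, z.2), fun z => ?_, fun z => ?_⟩, ?_, ?_, ?_⟩
  · exact Prod.ext ((hmono z.2).injective (by simp only [hv])) rfl
  · exact Prod.ext (hv z) rfl
  · exact hu.prodMk contDiff_snd
  · exact hvs.prodMk contDiff_snd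
  · exact fun z => rfl

theorem fderiv_comp_swap {f : ℝ × ℝ → ℝ} (hf : ContDiff ℝ ∞ f) (z v : ℝ × ℝ) :
    fderiv ℝ (fun z => f z.swap) z v = fderiv ℝ f z.swap v.swap := by
  have := ((hf.differentiable (by simp)) z.swap).hasFDerivAt.comp z
    (ContinuousLinearEquiv.prodComm ℝ ℝ ℝ).toContinuousLinearMap.hasFDerivAt
  exact congrArg (fun L => L v) this.fderiv

theorem exists_equiv_of_increasing_snd {u : ℝ × ℝ → ℝ} (hu : ContDiff ℝ ∞ u)
    (hpos : ∀ z, 0 < fderiv ℝ u z (0, 1)) {K : Set (ℝ × ℝ)} (hK : IsCompact K)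
    (huK : ∀ z ∉ K, u z = z.2) :
    ∃ Φ : ℝ × ℝ ≃ ℝ × ℝ, ContDiff ℝ ∞ Φ ∧ ContDiff ℝ ∞ Φ.symm ∧ ∀ z, Φ z = (z.1, u z) := by
  have hsw : ContDiff ℝ ∞ (Prod.swap : ℝ × ℝ → ℝ × ℝ) := contDiff_snd.prodMk contDiff_fst
  obtain ⟨Φ, h1, h2, h3⟩ := exists_equiv_of_increasing_fst (u := fun z => u z.swap)
    (hu.comp hsw) (fun z => by rw [fderiv_comp_swap hu]; exact hpos _)
    (hK.image continuous_swap) (fun z hz => huK z.swap fun h => hz ⟨_, h, by simp⟩)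
  refine ⟨(Equiv.prodComm ℝ ℝ).trans (Φ.trans (Equiv.prodComm ℝ ℝ)), ?_, ?_, ?_⟩
  · exact hsw.comp (h1.comp hsw)
  · exact hsw.comp (h2.comp hsw)
  · intro z
    simp [h3]

/-! ### Alternating forms on the plane -/

/-- A covector as an alternating form of degree one. -/
def cov (b : Plane →L[ℝ] ℝ) : Plane [⋀^Fin 1]→L[ℝ] ℝ :=
  ContinuousAlternatingMap.ofSubsingleton ℝ Plane ℝ (0 : Fin 1) b

@[simp] theorem cov_apply (b : Plane →L[ℝ] ℝ) (v : Fin 1 → Plane) : cov b v = b (v 0) := rfl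

/-- The wedge product of two covectors. -/
def wedge₁ (a b : Plane →L[ℝ] ℝ) : Plane [⋀^Fin 2]→L[ℝ] ℝ := wedge a (cov b)

theorem wedge_one_apply (a : Plane →L[ℝ] ℝ) (α : Plane [⋀^Fin 1]→L[ℝ] ℝ) (v : Fin 2 → Plane) :
    wedge a α v = a (v 0) * α ![v 1] - a (v 1) * α ![v 0] := by
  unfold wedge
  rw [ContinuousAlternatingMap.alternatizeUncurryFin_apply, Fin.sum_univ_two]
  have h0 : Fin.removeNth 0 v = ![v 1] := by ext i; fin_cases i; rfl
  have h1 : Fin.removeNth 1 v = ![v 0] := by ext i; fin_cases i; rfl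
  simp [h0, h1, sub_eq_add_neg]

theorem wedge_zero_apply (a : Plane →L[ℝ] ℝ) (α : Plane [⋀^Fin 0]→L[ℝ] ℝ) (v : Fin 1 → Plane) :
    wedge a α v = a (v 0) * α ![] := by
  unfold wedge
  rw [ContinuousAlternatingMap.alternatizeUncurryFin_apply, Fin.sum_univ_one]
  have h0 : Fin.removeNth 0 v = ![] := Subsingleton.elim _ _
  simp [h0]

@[simp] theorem wedge₁_apply (a b : Plane →L[ℝ] ℝ) (v : Fin 2 → Plane) :
    wedge₁ a b v = a (v 0) * b (v 1) - a (v 1) * b (v 0) := by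
  simp [wedge₁, wedge_one_apply]

/-- `X, Y` and `a, b` are dual bases of the plane. -/
structure DualBases (a b : Plane →L[ℝ] ℝ) (X Y : Plane) : Prop where
  aX : a X = 1
  aY : a Y = 0
  bX : b X = 0
  bY : b Y = 1
  span : ∀ v, v = a v • X + b v • Y

theorem DualBases.eq_cov {a b : Plane →L[ℝ] ℝ} {X Y : Plane} (h : DualBases a b X Y)
    (α : Plane [⋀^Fin 1]→L[ℝ] ℝ) : α = α ![X] • cov a + α ![Y] • cov b := by
  ext v
  have h1 : v = ![a (v 0) • X + b (v 0) • Y] := by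
    ext i
    fin_cases i
    simp [← h.span (v 0)]
  have h2 : ∀ w, α ![w] =
      (ContinuousAlternatingMap.ofSubsingleton ℝ Plane ℝ (0 : Fin 1)).symm α w := by
    intro w
    simp only [ContinuousAlternatingMap.ofSubsingleton_symm_apply_apply]
    congr 1
    ext i
    fin_cases i
    rfl
  conv_lhs => rw [h1]
  rw [h2, map_add, map_smul, map_smul, ← h2, ← h2]
  simp [mul_comm]

theorem DualBases.eq_wedge₁ {a b : Plane →L[ℝ] ℝ} {X Y : Plane} (h : DualBases a b X Y)
    (η : Plane [⋀^Fin 2]→L[ℝ] ℝ) : η = η ![X, Y] • wedge₁ a b := by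
  ext v
  have key : ∀ w₀ w₁, η ![w₀, w₁] = η ![X, Y] * (a w₀ * b w₁ - a w₁ * b w₀) := by
    intro w₀ w₁
    have hXX : η ![X, X] = 0 := η.map_eq_zero_of_eq _ (i := 0) (j := 1) rfl (by decide)
    have hYY : η ![Y, Y] = 0 := η.map_eq_zero_of_eq _ (i := 0) (j := 1) rfl (by decide)
    have hs : ∀ v w, η ![v, w] = a v * η ![X, w] + b v * η ![Y, w] := by
      intro v w
      conv_lhs => rw [h.span v]
      rw [← smul_eq_mul, ← smul_eq_mul, ← η.vecCons_smul, ← η.vecCons_smul, ← η.vecCons_add]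
    have hs' : ∀ v w, η ![v, w] = - η ![w, v] := by
      intro v w
      have h2 : ![w, v] ∘ (Equiv.swap (0 : Fin 2) 1) = ![v, w] := by
        ext i
        fin_cases i <;> rfl
      have := η.toAlternatingMap.map_swap ![w, v] (i := 0) (j := 1) (by decide)
      rw [h2] at this
      exact this
    rw [hs, hs' X, hs' Y, hs w₁ X, hs w₁ Y, hXX, hYY, hs' Y X]
    ring
  have hv : v = ![v 0, v 1] := by ext i; fin_cases i <;> rfl
  rw [hv, key]
  simp

theorem DualBases.wedge₁_apply_eq_one {a b : Plane →L[ℝ] ℝ} {X Y : Plane}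
    (h : DualBases a b X Y) : wedge₁ a b ![X, Y] = 1 := by
  simp [h.aX, h.aY, h.bX, h.bY]

theorem DualBases.wedge₁_ne_zero {a b : Plane →L[ℝ] ℝ} {X Y : Plane}
    (h : DualBases a b X Y) : wedge₁ a b ≠ 0 := by
  intro h0
  have := h.wedge₁_apply_eq_one
  simp [h0] at this

/-! ### Smooth charts with values in `ℝ × ℝ` -/

section Charts

theorem clm_prod_apply {F : Type*} [NormedAddCommGroup F] [NormedSpace ℝ F] (L : ℝ × ℝ →L[ℝ] F)
    (w : ℝ × ℝ) : L w = w.1 • L (1, 0) + w.2 • L (0, 1) := by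
  have hw : w = w.1 • ((1 : ℝ), (0 : ℝ)) + w.2 • ((0 : ℝ), (1 : ℝ)) := by ext <;> simp
  conv_lhs => rw [hw, map_add, map_smul, map_smul]

variable {S : Type*} [TopologicalSpace S] [ChartedSpace Plane S]

/-- A chart of the surface with values in `ℝ × ℝ` that is smooth in both directions. -/
structure SmoothChart (e : OpenPartialHomeomorph S (ℝ × ℝ)) : Prop where
  smooth : ContMDiffOn (𝓡 2) 𝓘(ℝ, ℝ × ℝ) ∞ e e.source
  smooth_symm : ContMDiffOn 𝓘(ℝ, ℝ × ℝ) (𝓡 2) ∞ e.symm e.target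

/-- The differential of a chart. -/
def chartDeriv (e : OpenPartialHomeomorph S (ℝ × ℝ)) (q : S) : Plane →L[ℝ] ℝ × ℝ :=
  mfderiv (𝓡 2) 𝓘(ℝ, ℝ × ℝ) e q

/-- The differential of the inverse of a chart; the images of `(1, 0)` and `(0, 1)` are the
coordinate vector fields. -/
def coordVec (e : OpenPartialHomeomorph S (ℝ × ℝ)) (q : S) : ℝ × ℝ →L[ℝ] Plane :=
  mfderiv 𝓘(ℝ, ℝ × ℝ) (𝓡 2) e.symm (e q)

/-- The covectors `dx` of the first coordinate of a chart. -/
def dx (e : OpenPartialHomeomorph S (ℝ × ℝ)) : S → Plane →L[ℝ] ℝ := dFun fun q => (e q).1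

/-- The covectors `dy` of the second coordinate of a chart. -/
def dy (e : OpenPartialHomeomorph S (ℝ × ℝ)) : S → Plane →L[ℝ] ℝ := dFun fun q => (e q).2

/-- The area form `dx ∧ dy` of a chart. -/
def area (e : OpenPartialHomeomorph S (ℝ × ℝ)) : FormField S 2 := fun q => wedge₁ (dx e q) (dy e q)

variable {e : OpenPartialHomeomorph S (ℝ × ℝ)}

theorem SmoothChart.mdifferentiableAt (he : SmoothChart e) {q : S} (hq : q ∈ e.source) :
    MDifferentiableAt (𝓡 2) 𝓘(ℝ, ℝ × ℝ) e q :=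
  (he.smooth.contMDiffAt (e.open_source.mem_nhds hq)).mdifferentiableAt (by simp)

theorem SmoothChart.mdifferentiableAt_symm (he : SmoothChart e) {z : ℝ × ℝ} (hz : z ∈ e.target) :
    MDifferentiableAt 𝓘(ℝ, ℝ × ℝ) (𝓡 2) e.symm z :=
  (he.smooth_symm.contMDiffAt (e.open_target.mem_nhds hz)).mdifferentiableAt (by simp)

theorem SmoothChart.chartDeriv_coordVec (he : SmoothChart e) {q : S} (hq : q ∈ e.source)
    (v : ℝ × ℝ) : chartDeriv e q (coordVec e q v) = v := by
  have hz := e.map_source hq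
  have h1 : MDifferentiableAt (𝓡 2) 𝓘(ℝ, ℝ × ℝ) e (e.symm (e q)) := by
    rw [e.left_inv hq]; exact he.mdifferentiableAt hq
  have h2 := mfderiv_comp (e q) h1 (he.mdifferentiableAt_symm hz)
  have h3 : (e ∘ e.symm) =ᶠ[𝓝 (e q)] id := by
    filter_upwards [e.open_target.mem_nhds hz] with w hw using e.right_inv hw
  rw [h3.mfderiv_eq, mfderiv_id, e.left_inv hq] at h2
  exact (congrArg (fun L : (ℝ × ℝ) →L[ℝ] (ℝ × ℝ) => L v) h2).symm

theorem SmoothChart.coordVec_chartDeriv (he : SmoothChart e) {q : S} (hq : q ∈ e.source)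
    (v : Plane) : coordVec e q (chartDeriv e q v) = v := by
  have hz := e.map_source hq
  have h2 := mfderiv_comp q (he.mdifferentiableAt_symm hz) (he.mdifferentiableAt hq)
  have h3 : (e.symm ∘ e) =ᶠ[𝓝 q] id := by
    filter_upwards [e.open_source.mem_nhds hq] with w hw using e.left_inv hw
  rw [h3.mfderiv_eq, mfderiv_id] at h2
  exact (congrArg (fun L : Plane →L[ℝ] Plane => L v) h2).symm

/-- The differential of a function that is given in a chart. -/
theorem SmoothChart.dFun_comp_apply (he : SmoothChart e) {q : S} (hq : q ∈ e.source)
    {F : ℝ × ℝ → ℝ} (hF : DifferentiableAt ℝ F (e q)) (v : Plane) :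
    dFun (fun q => F (e q)) q v =
      fderiv ℝ F (e q) (chartDeriv e q v) := by
  have h := mfderiv_comp q hF.mdifferentiableAt (he.mdifferentiableAt hq)
  rw [mfderiv_eq_fderiv] at h
  exact congrArg (fun L : Plane →L[ℝ] ℝ => L v) h

theorem SmoothChart.dx_apply (he : SmoothChart e) {q : S} (hq : q ∈ e.source) (v : Plane) :
    dx e q v = (chartDeriv e q v).1 := by
  have := he.dFun_comp_apply hq (F := Prod.fst) differentiableAt_fst v
  rw [fderiv_fst] at this
  exact this

theorem SmoothChart.dy_apply (he : SmoothChart e) {q : S} (hq : q ∈ e.source) (v : Plane) :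
    dy e q v = (chartDeriv e q v).2 := by
  have := he.dFun_comp_apply hq (F := Prod.snd) differentiableAt_snd v
  rw [fderiv_snd] at this
  exact this

theorem SmoothChart.dualBases (he : SmoothChart e) {q : S} (hq : q ∈ e.source) :
    DualBases (dx e q) (dy e q) (coordVec e q (1, 0)) (coordVec e q (0, 1)) where
  aX := by rw [he.dx_apply hq, he.chartDeriv_coordVec hq]
  aY := by rw [he.dx_apply hq, he.chartDeriv_coordVec hq]
  bX := by rw [he.dy_apply hq, he.chartDeriv_coordVec hq]
  bY := by rw [he.dy_apply hq, he.chartDeriv_coordVec hq]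
  span v := by
    rw [he.dx_apply hq, he.dy_apply hq]
    conv_lhs => rw [← he.coordVec_chartDeriv hq v]
    exact clm_prod_apply _ _

/-- The chain rule in coordinates. -/
theorem SmoothChart.dFun_comp (he : SmoothChart e) {q : S} (hq : q ∈ e.source)
    {F : ℝ × ℝ → ℝ} (hF : DifferentiableAt ℝ F (e q)) :
    dFun (fun q => F (e q)) q =
      fderiv ℝ F (e q) (1, 0) • dx e q + fderiv ℝ F (e q) (0, 1) • dy e q := by
  ext1 v
  rw [he.dFun_comp_apply hq hF]
  simp only [add_apply, smul_apply, he.dx_apply hq,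
    he.dy_apply hq]
  rw [clm_prod_apply]
  simp [mul_comm]

theorem dFun_congr {f g : S → ℝ} {q : S} (h : f =ᶠ[𝓝 q] g) : dFun f q = dFun g q := by
  unfold dFun
  exact h.mfderiv_eq

theorem SmoothChart.area_ne_zero (he : SmoothChart e) {q : S} (hq : q ∈ e.source) :
    area e q ≠ 0 := (he.dualBases hq).wedge₁_ne_zero

/-- A function on the surface is smooth on an open subset of a chart iff it is smooth in
coordinates. -/
theorem SmoothChart.contMDiffAt_comp_iff (he : SmoothChart e) {q : S} (hq : q ∈ e.source)
    {f : S → ℝ} : ContDiffAt ℝ ∞ (f ∘ e.symm) (e q) ↔ ContMDiffAt (𝓡 2) 𝓘(ℝ, ℝ) ∞ f q := by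
  constructor
  · intro h
    have h1 : ContMDiffAt (𝓡 2) 𝓘(ℝ, ℝ) ∞ ((f ∘ e.symm) ∘ e) q :=
      h.contMDiffAt.comp q (he.smooth.contMDiffAt (e.open_source.mem_nhds hq))
    refine h1.congr_of_eventuallyEq ?_
    filter_upwards [e.open_source.mem_nhds hq] with w hw
    simp [e.left_inv hw]
  · intro h
    have hz := e.map_source hq
    rw [← contMDiffAt_iff_contDiffAt]
    refine ContMDiffAt.comp (e q) ?_ (he.smooth_symm.contMDiffAt (e.open_target.mem_nhds hz))
    rwa [e.left_inv hq]

theorem SmoothChart.contDiffAt_comp_symm (he : SmoothChart e)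
    {F : S → ℝ} (hF : ∀ q ∈ e.source, ContMDiffAt (𝓡 2) 𝓘(ℝ, ℝ) ∞ F q) :
    ∀ z ∈ e.target, ContDiffAt ℝ ∞ (F ∘ e.symm) z := by
  intro z hz
  have := (he.contMDiffAt_comp_iff (e.map_target hz)).2 (hF _ (e.map_target hz))
  rwa [e.right_inv hz] at this

theorem contDiffAt_alternating_apply {E : Type*} [NormedAddCommGroup E] [NormedSpace ℝ E] {k : ℕ}
    {θ : E → Plane [⋀^Fin k]→L[ℝ] ℝ} {w : E → Fin k → Plane} {z : E} (hθ : ContDiffAt ℝ ∞ θ z)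
    (hw : ContDiffAt ℝ ∞ w z) : ContDiffAt ℝ ∞ (fun z => θ z (w z)) z := by
  have h := (ContinuousLinearMap.analyticAt_uncurry_of_multilinear
    (ContinuousAlternatingMap.toContinuousMultilinearMapCLM ℝ :
      (Plane [⋀^Fin k]→L[ℝ] ℝ) →L[ℝ] _) (x := (θ z, w z))).contDiffAt (n := ∞)
  exact h.comp z (hθ.prodMk hw)

/-- The coefficients of a smooth form with respect to the coordinate vector fields of a smooth
chart are smooth. -/
theorem SmoothChart.contMDiffAt_apply_coordVec [IsManifold (𝓡 2) ∞ S] (he : SmoothChart e) {k : ℕ}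
    {η : FormField S k} {U : Set S} (hU : IsOpen U) (hη : SmoothFormOn η U) {q : S}
    (hq : q ∈ e.source) (hqU : q ∈ U) (v : Fin k → ℝ × ℝ) :
    ContMDiffAt (𝓡 2) 𝓘(ℝ, ℝ) ∞ (fun q => η q fun i => coordVec e q (v i)) q := by
  rw [← he.contMDiffAt_comp_iff hq]
  set ψ := extChartAt (𝓡 2) q with hψ
  have hz := e.map_source hq
  have hqψ : q ∈ ψ.source := mem_extChartAt_source q
  have hψq : ContMDiffOn (𝓡 2) 𝓘(ℝ, Plane) ∞ ψ ψ.source := by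
    rw [hψ, extChartAt_source]
    exact contMDiffOn_extChartAt
  have hψs : IsOpen ψ.source := isOpen_extChartAt_source q
  have hψt : IsOpen ψ.target := isOpen_extChartAt_target q
  have hψsymm : ContMDiffOn 𝓘(ℝ, Plane) (𝓡 2) ∞ ψ.symm ψ.target := contMDiffOn_extChartAt_symm q
  -- the coordinate change
  set κ : ℝ × ℝ → Plane := fun z => ψ (e.symm z) with hκ
  have hW : e.target ∩ e.symm ⁻¹' ψ.source ∈ 𝓝 (e q) := by
    refine (e.symm.isOpen_inter_preimage hψs).mem_nhds ⟨hz, ?_⟩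
    simpa [e.left_inv hq] using hqψ
  have hκat : ∀ z ∈ e.target ∩ e.symm ⁻¹' ψ.source, ContDiffAt ℝ ∞ κ z := by
    intro z hz
    rw [← contMDiffAt_iff_contDiffAt]
    exact (hψq.contMDiffAt (hψs.mem_nhds hz.2)).comp z
      (he.smooth_symm.contMDiffAt (e.open_target.mem_nhds hz.1))
  have hκq : κ (e q) = ψ q := by simp [hκ, e.left_inv hq]
  have hform : ContDiffAt ℝ ∞ (inChart η q) (κ (e q)) := by
    rw [hκq]
    refine (hη q).contDiffAt ?_
    refine ((continuousOn_extChartAt_symm q).isOpen_inter_preimage hψt hU).mem_nhds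
      ⟨ψ.map_source hqψ, ?_⟩
    rwa [mem_preimage, ← hψ, ψ.left_inv hqψ]
  have hcoef : ContDiffAt ℝ ∞ (fun z => inChart η q (κ z) fun i => fderiv ℝ κ z (v i)) (e q) := by
    refine contDiffAt_alternating_apply (hform.comp (e q) (hκat _ (mem_of_mem_nhds hW))) ?_
    rw [contDiffAt_pi]
    intro i
    exact (((hκat _ (mem_of_mem_nhds hW)).fderiv_right (m := ∞) (by simp))).clm_apply
      contDiffAt_const
  refine hcoef.congr_of_eventuallyEq ?_
  filter_upwards [hW] with z hz
  have hψz : ψ.symm (κ z) = e.symm z := ψ.left_inv hz.2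
  have hκz : κ z ∈ ψ.target := ψ.map_source hz.2
  have hsym : (ψ.symm ∘ κ) =ᶠ[𝓝 z] e.symm := by
    filter_upwards [(e.symm.isOpen_inter_preimage hψs).mem_nhds hz] with w hw
    exact ψ.left_inv hw.2
  have h1 := mfderiv_comp z
    ((hψsymm.contMDiffAt (hψt.mem_nhds hκz)).mdifferentiableAt (by simp))
    ((hκat z hz).differentiableAt (by simp)).mdifferentiableAt
  rw [hsym.mfderiv_eq, mfderiv_eq_fderiv] at h1
  simp only [Function.comp, inChart]
  rw [← hψ, hψz]
  refine congrArg (η (e.symm z)) (funext fun i => ?_)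
  simp only [coordVec]
  rw [e.right_inv hz.1]
  exact congrArg (fun L : ℝ × ℝ →L[ℝ] Plane => L (v i)) h1

end Charts

/-! ### Exterior derivatives of one-forms -/

section ExtD

/-- `cov` as a continuous linear map. -/
def covL : (Plane →L[ℝ] ℝ) →L[ℝ] (Plane [⋀^Fin 1]→L[ℝ] ℝ) :=
  (ContinuousAlternatingMap.ofSubsingletonLIE (0 : Fin 1) :
    (Plane →L[ℝ] ℝ) ≃ₗᵢ[ℝ] (Plane [⋀^Fin 1]→L[ℝ] ℝ)).toContinuousLinearEquiv.toContinuousLinearMap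

theorem covL_apply (b : Plane →L[ℝ] ℝ) : covL b = cov b := rfl

theorem wedge₁_comp (a b : Plane →L[ℝ] ℝ) (L : Plane →L[ℝ] Plane) (v : Fin 2 → Plane) :
    wedge₁ a b (fun j => L (v j)) = wedge₁ (a.comp L) (b.comp L) v := by
  simp

theorem sum_compContinuousLinearMap_apply {ι : Type*} (s : Finset ι) {k : ℕ}
    (f : ι → Plane [⋀^Fin k]→L[ℝ] ℝ) (L : Plane →L[ℝ] Plane) (v : Fin k → Plane) :
    (∑ i ∈ s, f i).compContinuousLinearMap L v = ∑ i ∈ s, f i (fun j => L (v j)) := by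
  simp only [ContinuousAlternatingMap.compContinuousLinearMap_apply,
    ContinuousAlternatingMap.sum_apply, Function.comp_def]

/-- The formula `d (∑ a_i db_i) = ∑ da_i ∧ db_i` on the plane, where `ddb_i = 0` by the symmetry of
second derivatives. -/
theorem extDeriv_sum_smul_cov {ι : Type*} (s : Finset ι) {a b : ι → Plane → ℝ} {z : Plane}
    (ha : ∀ i ∈ s, DifferentiableAt ℝ (a i) z) (hb : ∀ i ∈ s, ContDiffAt ℝ ∞ (b i) z) :
    extDeriv (fun z => ∑ i ∈ s, a i z • cov (fderiv ℝ (b i) z)) z =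
      ∑ i ∈ s, wedge₁ (fderiv ℝ (a i) z) (fderiv ℝ (b i) z) := by
  have h2 : ((2 : ℕ∞) : WithTop ℕ∞) ≤ ∞ := WithTop.coe_le_coe.2 le_top
  have h11 : (1 + 1 : WithTop ℕ∞) ≤ ∞ := by
    rw [one_add_one_eq_two]
    exact h2
  have hd : HasFDerivAt (fun z => ∑ i ∈ s, a i z • covL (fderiv ℝ (b i) z))
      (∑ i ∈ s, (a i z • (covL ∘L fderiv ℝ (fderiv ℝ (b i)) z) +
        (fderiv ℝ (a i) z).smulRight (covL (fderiv ℝ (b i) z)))) z := by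
    refine HasFDerivAt.fun_sum fun i hi => ?_
    refine (ha i hi).hasFDerivAt.fun_smul (covL.hasFDerivAt.comp z ?_)
    exact (((hb i hi).fderiv_right (m := 1) h11).differentiableAt
      (by simp)).hasFDerivAt
  simp only [covL_apply] at hd
  ext v
  have hsym : ∀ i ∈ s, fderiv ℝ (fderiv ℝ (b i)) z (v 0) (v 1) =
      fderiv ℝ (fderiv ℝ (b i)) z (v 1) (v 0) := fun i hi =>
    ((hb i hi).isSymmSndFDerivAt (by rw [minSmoothness_of_isRCLikeNormedField]; exact h2)).eq _ _
  rw [extDeriv, hd.fderiv, ContinuousAlternatingMap.alternatizeUncurryFin_apply, Fin.sum_univ_two]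
  have h0 : Fin.removeNth 0 v = ![v 1] := by ext i; fin_cases i; rfl
  have h1 : Fin.removeNth 1 v = ![v 0] := by ext i; fin_cases i; rfl
  simp only [h0, h1, ContinuousAlternatingMap.sum_apply, sum_apply]
  simp only [Fin.val_zero, pow_zero, one_smul, Fin.val_one, pow_one, neg_smul, ← sub_eq_add_neg]
  rw [← Finset.sum_sub_distrib]
  refine Finset.sum_congr rfl fun i hi => ?_
  have := hsym i hi
  simp only [add_apply, smul_apply, ContinuousLinearMap.comp_apply,
    ContinuousLinearMap.smulRight_apply, ContinuousAlternatingMap.add_apply,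
    ContinuousAlternatingMap.smul_apply, covL_apply, cov_apply, wedge₁_apply,
    Matrix.cons_val_zero, smul_eq_mul]
  rw [this]
  ring

variable {S : Type*} [TopologicalSpace S] [ChartedSpace Plane S] [IsManifold (𝓡 2) ∞ S]

/-- The exterior derivative of a one-form that is given locally as `∑ a_i db_i`. -/
theorem extD_eq_sum {ι : Type*} (s : Finset ι) {η : FormField S 1} {a b : ι → S → ℝ} {q : S}
    (ha : ∀ i ∈ s, MDifferentiableAt (𝓡 2) 𝓘(ℝ, ℝ) (a i) q)
    (hb : ∀ i ∈ s, ∀ᶠ q' in 𝓝 q, ContMDiffAt (𝓡 2) 𝓘(ℝ, ℝ) ∞ (b i) q')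
    (hη : ∀ᶠ q' in 𝓝 q, η q' = ∑ i ∈ s, a i q' • cov (dFun (b i) q')) :
    extD η q = ∑ i ∈ s, wedge₁ (dFun (a i) q) (dFun (b i) q) := by
  set ψ := extChartAt (𝓡 2) q with hψ
  have hqψ : q ∈ ψ.source := mem_extChartAt_source q
  have hψt : IsOpen ψ.target := isOpen_extChartAt_target q
  have hψsymm : ContMDiffOn 𝓘(ℝ, Plane) (𝓡 2) ∞ ψ.symm ψ.target := contMDiffOn_extChartAt_symm q
  have hψat : ∀ z ∈ ψ.target, ContMDiffAt 𝓘(ℝ, Plane) (𝓡 2) ∞ ψ.symm z := fun z hz =>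
    hψsymm.contMDiffAt (hψt.mem_nhds hz)
  have hz0 : ψ q ∈ ψ.target := ψ.map_source hqψ
  have hq0 : ψ.symm (ψ q) = q := ψ.left_inv hqψ
  have hψd : MDifferentiableAt (𝓡 2) 𝓘(ℝ, Plane) ψ q :=
    mdifferentiableAt_extChartAt (mem_chart_source _ q)
  have hcont : ContinuousAt ψ.symm (ψ q) := (hψat _ hz0).continuousAt
  have hev : ∀ {p : S → Prop}, (∀ᶠ q' in 𝓝 q, p q') → ∀ᶠ z in 𝓝 (ψ q), p (ψ.symm z) := by
    intro p hp
    refine hcont.eventually ?_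
    rwa [hq0]
  have hchain : ∀ (f : S → ℝ) (z), z ∈ ψ.target → MDifferentiableAt (𝓡 2) 𝓘(ℝ, ℝ) f (ψ.symm z) →
      fderiv ℝ (f ∘ ψ.symm) z = (dFun f (ψ.symm z)).comp
        (mfderiv 𝓘(ℝ, Plane) (𝓡 2) ψ.symm z : Plane →L[ℝ] Plane) := by
    intro f z hz hf
    have := mfderiv_comp z hf ((hψat z hz).mdifferentiableAt (by simp))
    rw [mfderiv_eq_fderiv] at this
    exact this
  have hback : ∀ (f : S → ℝ), MDifferentiableAt (𝓡 2) 𝓘(ℝ, ℝ) f q →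
      (fderiv ℝ (f ∘ ψ.symm) (ψ q)).comp (mfderiv (𝓡 2) 𝓘(ℝ, Plane) ψ q : Plane →L[ℝ] Plane) =
        dFun f q := by
    intro f hf
    have hfs : MDifferentiableAt 𝓘(ℝ, Plane) 𝓘(ℝ, ℝ) (f ∘ ψ.symm) (ψ q) := by
      refine MDifferentiableAt.comp (ψ q) ?_ ((hψat _ hz0).mdifferentiableAt (by simp))
      rwa [hq0]
    have h1 := mfderiv_comp q hfs hψd
    rw [mfderiv_eq_fderiv] at h1
    have h2 : ((f ∘ ψ.symm) ∘ ψ) =ᶠ[𝓝 q] f := by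
      filter_upwards [(isOpen_extChartAt_source (I := 𝓡 2) q).mem_nhds hqψ] with w hw
      simp only [Function.comp]
      rw [ψ.left_inv hw]
    rw [h2.mfderiv_eq] at h1
    exact h1.symm
  have hbs : ∀ i ∈ s, ∀ᶠ z in 𝓝 (ψ q), ContMDiffAt (𝓡 2) 𝓘(ℝ, ℝ) ∞ (b i) (ψ.symm z) :=
    fun i hi => hev (hb i hi)
  have hform : inChart η q =ᶠ[𝓝 (ψ q)]
      fun z => ∑ i ∈ s, (a i ∘ ψ.symm) z • cov (fderiv ℝ (b i ∘ ψ.symm) z) := by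
    filter_upwards [hev hη, (Filter.eventually_all_finset s).2 hbs, hψt.mem_nhds hz0]
      with z h1 h2 h3
    simp only [inChart]
    rw [← hψ, h1]
    ext v
    rw [ContinuousAlternatingMap.sum_apply]
    refine (sum_compContinuousLinearMap_apply s _ _ v).trans (Finset.sum_congr rfl fun i hi => ?_)
    rw [hchain _ _ h3 ((h2 i hi).mdifferentiableAt (by simp))]
    rfl
  rw [extD, ← hψ, hform.extDeriv_eq, extDeriv_sum_smul_cov]
  · ext v
    rw [ContinuousAlternatingMap.sum_apply]
    refine (sum_compContinuousLinearMap_apply s _ _ v).trans (Finset.sum_congr rfl fun i hi => ?_)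
    rw [← hback _ (ha i hi), ← hback _ ((hb i hi).self_of_nhds.mdifferentiableAt (by simp))]
    exact wedge₁_comp _ _ _ v
  · intro i hi
    rw [← mdifferentiableAt_iff_differentiableAt]
    refine MDifferentiableAt.comp (ψ q) ?_ ((hψat _ hz0).mdifferentiableAt (by simp))
    rw [hq0]
    exact ha i hi
  · intro i hi
    rw [← contMDiffAt_iff_contDiffAt]
    refine ContMDiffAt.comp (ψ q) ?_ (hψat _ hz0)
    exact (hbs i hi).self_of_nhds

end ExtD

/-! ### Diffeomorphisms supported in a chart -/

section Conj

variable {S : Type*} [TopologicalSpace S] {e : OpenPartialHomeomorph S (ℝ × ℝ)}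

open Classical in
/-- The map of the surface that is `Φ` in the chart `e` and the identity elsewhere. -/
def chartConj (e : OpenPartialHomeomorph S (ℝ × ℝ)) (Φ : ℝ × ℝ → ℝ × ℝ) (q : S) : S :=
  if q ∈ e.source then e.symm (Φ (e q)) else q

theorem chartConj_of_mem {Φ : ℝ × ℝ → ℝ × ℝ} {q : S} (hq : q ∈ e.source) :
    chartConj e Φ q = e.symm (Φ (e q)) := if_pos hq

theorem chartConj_of_notMem_image {Φ : ℝ × ℝ → ℝ × ℝ} {K : Set (ℝ × ℝ)} (hΦ : ∀ z ∉ K, Φ z = z)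
    {q : S} (hq : q ∉ e.symm '' K) : chartConj e Φ q = q := by
  by_cases h : q ∈ e.source
  · rw [chartConj_of_mem h, hΦ, e.left_inv h]
    exact fun hK => hq ⟨_, hK, e.left_inv h⟩
  · exact if_neg h

theorem mapsTo_target {Φ : ℝ × ℝ ≃ ℝ × ℝ} {K : Set (ℝ × ℝ)} (hKe : K ⊆ e.target)
    (hΦ : ∀ z ∉ K, Φ z = z) {z : ℝ × ℝ} (hz : z ∈ e.target) : Φ z ∈ e.target := by
  by_cases h : Φ z ∈ K
  · exact hKe h
  · have := Φ.injective (hΦ _ h)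
    rwa [this]

theorem isClosed_symm_image [T2Space S] {K : Set (ℝ × ℝ)} (hK : IsCompact K) (hKe : K ⊆ e.target) :
    IsClosed (e.symm '' K) :=
  (hK.image_of_continuousOn (e.continuousOn_symm.mono hKe)).isClosed

variable [ChartedSpace Plane S]

theorem contMDiff_chartConj [T2Space S] (he : SmoothChart e) {Φ : ℝ × ℝ ≃ ℝ × ℝ}
    (hs : ContDiff ℝ ∞ Φ) {K : Set (ℝ × ℝ)} (hK : IsCompact K) (hKe : K ⊆ e.target)
    (hΦ : ∀ z ∉ K, Φ z = z) : ContMDiff (𝓡 2) (𝓡 2) ∞ (chartConj e Φ) := by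
  intro q
  by_cases hq : q ∈ e.source
  · have h1 : ContMDiffAt (𝓡 2) (𝓡 2) ∞ (fun q => e.symm (Φ (e q))) q := by
      refine ContMDiffAt.comp q (g := e.symm) ?_ (ContMDiffAt.comp q hs.contMDiff.contMDiffAt
        (he.smooth.contMDiffAt (e.open_source.mem_nhds hq)))
      exact he.smooth_symm.contMDiffAt (e.open_target.mem_nhds
        (mapsTo_target hKe hΦ (e.map_source hq)))
    refine h1.congr_of_eventuallyEq ?_
    filter_upwards [e.open_source.mem_nhds hq] with w hw using chartConj_of_mem hw
  · have hq' : q ∉ e.symm '' K := by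
      rintro ⟨z, hz, rfl⟩
      exact hq (e.map_target (hKe hz))
    refine contMDiffAt_id.congr_of_eventuallyEq ?_
    filter_upwards [(isClosed_symm_image hK hKe).isOpen_compl.mem_nhds hq'] with w hw
    exact chartConj_of_notMem_image hΦ hw

/-- Compactly supported diffeomorphisms of `ℝ × ℝ` extend from a chart to the surface. -/
theorem SmoothChart.exists_diffeomorph [T2Space S] (he : SmoothChart e) {Φ : ℝ × ℝ ≃ ℝ × ℝ}
    (hs : ContDiff ℝ ∞ Φ) (hs' : ContDiff ℝ ∞ Φ.symm) {K : Set (ℝ × ℝ)} (hK : IsCompact K)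
    (hKe : K ⊆ e.target) (hΦ : ∀ z ∉ K, Φ z = z) :
    ∃ φ : S ≃ₘ^∞⟮𝓡 2, 𝓡 2⟯ S, (∀ q ∈ e.source, φ q ∈ e.source ∧ e (φ q) = Φ (e q)) ∧
      ∀ q ∉ e.symm '' K, φ q = q := by
  have hΦ' : ∀ z ∉ K, Φ.symm z = z := fun z hz => by
    rw [Equiv.symm_apply_eq, hΦ z hz]
  have hinv : ∀ Φ : ℝ × ℝ ≃ ℝ × ℝ, (∀ z ∉ K, Φ z = z) → ∀ q,
      chartConj e Φ.symm (chartConj e Φ q) = q := by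
    intro Φ hΦ q
    by_cases hq : q ∈ e.source
    · have hT := mapsTo_target hKe hΦ (e.map_source hq)
      rw [chartConj_of_mem hq, chartConj_of_mem (e.map_target hT), e.right_inv hT,
        Equiv.symm_apply_apply, e.left_inv hq]
    · have h1 : ∀ Φ : ℝ × ℝ → ℝ × ℝ, chartConj e Φ q = q := fun _ => if_neg hq
      rw [h1, h1]
  refine ⟨⟨⟨chartConj e Φ, chartConj e Φ.symm, hinv Φ hΦ, ?_⟩, ?_, ?_⟩, ?_, ?_⟩
  · have := hinv Φ.symm hΦ'
    rwa [Equiv.symm_symm] at this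
  · exact contMDiff_chartConj he hs hK hKe hΦ
  · exact contMDiff_chartConj he hs' hK hKe hΦ'
  · intro q hq
    have hT := mapsTo_target hKe hΦ (e.map_source hq)
    have : chartConj e Φ q = e.symm (Φ (e q)) := chartConj_of_mem hq
    refine ⟨?_, ?_⟩
    · change chartConj e Φ q ∈ _
      rw [this]
      exact e.map_target hT
    · change e (chartConj e Φ q) = _
      rw [this, e.right_inv hT]
  · exact fun q hq => chartConj_of_notMem_image hΦ hq

/-- The chain rule: pulling back commutes with the differential of functions. -/
theorem dFun_pullback {φ : S → S} {f : S → ℝ} {q : S} (hφ : MDifferentiableAt (𝓡 2) (𝓡 2) φ q)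
    (hf : MDifferentiableAt (𝓡 2) 𝓘(ℝ, ℝ) f (φ q)) :
    (dFun f (φ q)).comp (mfderiv (𝓡 2) (𝓡 2) φ q : Plane →L[ℝ] Plane) = dFun (f ∘ φ) q :=
  (mfderiv_comp q hf hφ).symm

theorem SmoothChart.mdifferentiableAt_fst (he : SmoothChart e) {q : S} (hq : q ∈ e.source) :
    MDifferentiableAt (𝓡 2) 𝓘(ℝ, ℝ) (fun q => (e q).1) q :=
  MDifferentiableAt.comp q (g := Prod.fst) differentiableAt_fst.mdifferentiableAt
    (he.mdifferentiableAt hq)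

theorem SmoothChart.mdifferentiableAt_snd (he : SmoothChart e) {q : S} (hq : q ∈ e.source) :
    MDifferentiableAt (𝓡 2) 𝓘(ℝ, ℝ) (fun q => (e q).2) q :=
  MDifferentiableAt.comp q (g := Prod.snd) differentiableAt_snd.mdifferentiableAt
    (he.mdifferentiableAt hq)

/-- The pullback of a multiple of the area form under a map given by `Φ` in the chart. -/
theorem SmoothChart.pullback_area (he : SmoothChart e) {Φ : ℝ × ℝ → ℝ × ℝ}
    (hs : ContDiff ℝ ∞ Φ) {φ : S → S} {q : S} (hφ : MDifferentiableAt (𝓡 2) (𝓡 2) φ q)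
    (hφe : ∀ q ∈ e.source, φ q ∈ e.source ∧ e (φ q) = Φ (e q)) (hq : q ∈ e.source)
    {η : FormField S 2} {r : ℝ} (hη : η (φ q) = r • area e (φ q)) :
    pullback φ η q = (r * (fderiv ℝ (fun z => (Φ z).1) (e q) (1, 0) *
      fderiv ℝ (fun z => (Φ z).2) (e q) (0, 1) - fderiv ℝ (fun z => (Φ z).1) (e q) (0, 1) *
      fderiv ℝ (fun z => (Φ z).2) (e q) (1, 0))) • area e q := by
  obtain ⟨hm, -⟩ := hφe q hq
  obtain ⟨L, hL⟩ : ∃ L : Plane →L[ℝ] Plane, L = mfderiv (𝓡 2) (𝓡 2) φ q := ⟨_, rfl⟩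
  have hx : (dx e (φ q)).comp L =
      dFun (fun q => (Φ (e q)).1) q := by
    rw [hL]
    refine (dFun_pullback hφ (he.mdifferentiableAt_fst hm)).trans (dFun_congr ?_)
    filter_upwards [e.open_source.mem_nhds hq] with w hw
    simp [(hφe w hw).2]
  have hy : (dy e (φ q)).comp L =
      dFun (fun q => (Φ (e q)).2) q := by
    rw [hL]
    refine (dFun_pullback hφ (he.mdifferentiableAt_snd hm)).trans (dFun_congr ?_)
    filter_upwards [e.open_source.mem_nhds hq] with w hw
    simp [(hφe w hw).2]
  have hd := hs.differentiable (by simp)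
  rw [he.dFun_comp hq (F := fun z => (Φ z).1) (hd _).fst] at hx
  rw [he.dFun_comp hq (F := fun z => (Φ z).2) (hd _).snd] at hy
  have hp : pullback φ η q = (η (φ q)).compContinuousLinearMap L := by rw [hL]; rfl
  ext v
  rw [hp, hη]
  refine (congrArg (r * ·) (wedge₁_comp (dx e (φ q)) (dy e (φ q)) L v)).trans ?_
  rw [hx, hy]
  simp only [wedge₁_apply, area, add_apply, smul_apply, ContinuousAlternatingMap.smul_apply,
    smul_eq_mul]
  ring

theorem pullback_comp {k : ℕ} {φ ψ : S → S} {q : S} (hφ : MDifferentiableAt (𝓡 2) (𝓡 2) φ q)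
    (hψ : MDifferentiableAt (𝓡 2) (𝓡 2) ψ (φ q)) (η : FormField S k) :
    pullback (ψ ∘ φ) η q = pullback φ (pullback ψ η) q := by
  unfold pullback
  rw [mfderiv_comp q hψ hφ]
  rfl

theorem pullback_congr {k : ℕ} {φ : S → S} {q : S} {η θ : FormField S k}
    (h : η (φ q) = θ (φ q)) : pullback φ η q = pullback φ θ q := by
  unfold pullback
  rw [h]

theorem pullback_of_eventuallyEq_id {k : ℕ} {φ : S → S} {q : S} (η : FormField S k)
    (h : φ =ᶠ[𝓝 q] id) : pullback φ η q = η q := by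
  unfold pullback
  rw [h.mfderiv_eq, mfderiv_id, h.self_of_nhds]
  rfl

end Conj

/-! ### Charts adapted to the critical set -/

theorem exists_cutoff {T K : Set (ℝ × ℝ)} (hT : IsOpen T) (hK : IsCompact K) (hKT : K ⊆ T) :
    ∃ χ : ℝ × ℝ → ℝ, ContDiff ℝ ∞ χ ∧ (∀ z ∈ K, χ z = 1) ∧ (∀ z, χ z ∈ Icc (0 : ℝ) 1) ∧
      ∃ L, IsCompact L ∧ L ⊆ T ∧ ∀ z ∉ L, χ z = 0 := by
  obtain ⟨L, hL, hKL, hLT⟩ := exists_compact_between hK hT hKT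
  obtain ⟨f, h0, h1, h2⟩ := exists_contMDiffMap_zero_one_of_isClosed 𝓘(ℝ, ℝ × ℝ) (n := ⊤)
    (isClosed_compl_iff.2 (isOpen_interior (s := L))) hK.isClosed
    (disjoint_left.2 fun z hz hz' => hz (hKL hz'))
  refine ⟨f, f.contMDiff.contDiff, fun z hz => by simpa using h1 hz, h2, L, hL, hLT, fun z hz => ?_⟩
  simpa using h0 fun h : z ∈ interior L => hz (interior_subset h)

/-- A positive function on an open set, bounded below by a multiple of a fixed one, can be changed
off a given compact set to one which is defined everywhere and bounded below. -/
theorem exists_extension {T K : Set (ℝ × ℝ)} (hT : IsOpen T) (hK : IsCompact K) (hKT : K ⊆ T)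
    {c : ℝ × ℝ → ℝ} (hc : ContinuousOn c T) (hc0 : ∀ z ∈ T, 0 < c z) :
    ∃ κ > 0, ∀ a : ℝ × ℝ → ℝ, (∀ z ∈ T, ContDiffAt ℝ ∞ a z) → (∀ z ∈ T, c z ≤ a z) →
      ∃ b : ℝ × ℝ → ℝ, ContDiff ℝ ∞ b ∧ (∀ z, κ ≤ b z) ∧ ∀ z ∈ K, b z = a z := by
  obtain ⟨χ, hχ, hχK, hχ01, L, hL, hLT, hχL⟩ := exists_cutoff hT hK hKT
  obtain ⟨κ, hκ, hκc⟩ : ∃ κ > 0, ∀ z ∈ L, κ ≤ c z := by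
    rcases L.eq_empty_or_nonempty with rfl | hne
    · exact ⟨1, one_pos, by simp⟩
    · obtain ⟨z, hz, hmin⟩ := hL.exists_isMinOn hne (hc.mono hLT)
      exact ⟨c z, hc0 z (hLT hz), fun w hw => hmin hw⟩
  refine ⟨min κ 1, lt_min hκ one_pos, fun a ha hca => ⟨fun z => χ z * a z + (1 - χ z), ?_, ?_, ?_⟩⟩
  · rw [contDiff_iff_contDiffAt]
    intro z
    by_cases hz : z ∈ T
    · exact (hχ.contDiffAt.mul (ha z hz)).add (contDiffAt_const.sub hχ.contDiffAt)
    · refine (contDiffAt_const (c := (1 : ℝ))).congr_of_eventuallyEq ?_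
      filter_upwards [hL.isClosed.isOpen_compl.mem_nhds fun h => hz (hLT h)] with w hw
      simp [hχL w hw]
  · intro z
    by_cases hz : z ∈ L
    · have h1 : min κ 1 ≤ a z := (min_le_left _ _).trans ((hκc z hz).trans (hca z (hLT hz)))
      have h2 := min_le_right κ 1
      have h3 := hχ01 z
      nlinarith [mul_le_mul_of_nonneg_left h1 h3.1,
        mul_le_mul_of_nonneg_left h2 (sub_nonneg.2 h3.2)]
    · simp [hχL z hz]
  · intro z hz
    simp [hχK z hz]

section BChart

variable {S : Type*} [TopologicalSpace S] [ChartedSpace Plane S]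
  {e : OpenPartialHomeomorph S (ℝ × ℝ)} {m : ℕ} {B : Critical S}

/-- A smooth chart `(x, y)` in which the critical set is `x = 0`, and whose first coordinate is an
adapted defining function unless the chart avoids the critical set. The second coordinate is
positive, so that densities can be moved along it by scaling. -/
structure BChart (B : Critical S) (e : OpenPartialHomeomorph S (ℝ × ℝ)) : Prop
    extends SmoothChart e where
  mem_Z : ∀ q ∈ e.source, q ∈ B.Z ↔ (e q).1 = 0
  snd_pos : ∀ q ∈ e.source, 0 < (e q).2
  adapted : (∀ q ∈ e.source, |(e q).1| = B.dist q) ∨ ∀ q ∈ e.source, q ∉ B.Z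

theorem SmoothChart.contMDiffOn_fst (he : SmoothChart e) :
    ContMDiffOn (𝓡 2) 𝓘(ℝ, ℝ) ∞ (fun q => (e q).1) e.source :=
  contDiff_fst.contMDiff.comp_contMDiffOn he.smooth

theorem SmoothChart.dx_ne_zero (he : SmoothChart e) {q : S} (hq : q ∈ e.source) :
    dx e q ≠ 0 := by
  intro h
  have := (he.dualBases hq).aX
  simp [h] at this

theorem BChart.isDefining (he : BChart B e) {p : S} (hp : p ∈ e.source) (hpZ : p ∈ B.Z) :
    B.IsDefining e.source fun q => (e q).1 where
  isOpen := e.open_source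
  smooth := he.contMDiffOn_fst
  dFun_ne_zero _ hq := he.dx_ne_zero hq
  abs_eq := he.adapted.resolve_right fun h => h p hp hpZ

theorem Critical.IsDefining.mono {U V : Set S} {x : S → ℝ} (h : B.IsDefining U x) (hV : IsOpen V)
    (hVU : V ⊆ U) : B.IsDefining V x :=
  ⟨hV, h.smooth.mono hVU, fun q hq => h.dFun_ne_zero q (hVU hq), fun q hq => h.abs_eq q (hVU hq)⟩

theorem Critical.exists_isDefining (B : Critical S) {p : S} (hp : p ∈ B.Z) :
    ∃ U x, p ∈ U ∧ B.IsDefining U x := by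
  obtain ⟨U, x, hpU, hU, hx, hd, ha⟩ := B.exists_local p hp
  exact ⟨U, x, hpU, hU, hx, hd, ha⟩

/-- A map that is the identity off a closed part of a chart and moves the first coordinate by a
multiple of its `m`-th power is a `b^m`-map. -/
theorem BChart.isBmMap (he : BChart B e) {φ : S → S} {C : Set S} (hC : IsClosed C)
    (hCe : C ⊆ e.source) (hφC : ∀ q ∉ C, φ q = q) {H : ℝ × ℝ → ℝ} (hH : ContDiff ℝ ∞ H)
    (hφs : ∀ q ∈ e.source, φ q ∈ e.source)
    (hφ : ∀ q ∈ e.source, (e (φ q)).1 = (e q).1 + H (e q) * (e q).1 ^ m)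
    (hφ0 : ∀ q ∈ e.source, (e (φ q)).1 = 0 ↔ (e q).1 = 0) : IsBmMap m B φ := by
  refine ⟨fun p => ?_, fun p hp => ?_⟩
  · by_cases hps : p ∈ e.source
    · rw [he.mem_Z p hps, he.mem_Z _ (hφs p hps), hφ0 p hps]
    · rw [hφC p fun h => hps (hCe h)]
  · by_cases hps : p ∈ e.source
    · exact ⟨e.source, e.source, fun q => (e q).1, fun q => (e q).1, H ∘ e, hps,
        he.isDefining hps hp, hφs p hps, he.isDefining hps hp, fun q hq => hφs q hq,
        hH.contMDiff.comp_contMDiffOn he.smooth, hφ⟩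
    · obtain ⟨U, x, hpU, hx⟩ := B.exists_isDefining hp
      have hpC : p ∉ C := fun h => hps (hCe h)
      have hx' := hx.mono (hx.isOpen.sdiff hC) sdiff_subset
      refine ⟨U \ C, U \ C, x, x, 0, ⟨hpU, hpC⟩, hx', ?_, hx', fun q hq => ?_, contMDiffOn_const,
        fun q hq => ?_⟩
      · rw [hφC p hpC]; exact ⟨hpU, hpC⟩
      · rw [hφC q hq.2]; exact hq
      · simp [hφC q hq.2]

end BChart

/-! ### Moving densities inside one chart -/

section Step

variable {S : Type*} [TopologicalSpace S] [ChartedSpace Plane S]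
  {e : OpenPartialHomeomorph S (ℝ × ℝ)} {m : ℕ} {B : Critical S}

theorem exists_forall_abs_mul_lt {Q : ℝ × ℝ → ℝ} (hQ : Continuous Q) (hQc : HasCompactSupport Q)
    {δ : ℝ} (hδ : 0 < δ) : ∃ ε₀ > 0, ∀ ε, |ε| ≤ ε₀ → ∀ z, |ε * Q z| < δ := by
  obtain ⟨C, hC⟩ := hQ.bounded_above_of_compact_support hQc
  have hC0 : 0 ≤ C := (norm_nonneg _).trans (hC 0)
  refine ⟨δ / (C + 1), by positivity, fun ε hε z => ?_⟩
  rw [abs_mul]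
  calc |ε| * |Q z| ≤ δ / (C + 1) * C :=
        mul_le_mul hε (hC z) (abs_nonneg _) (by positivity)
    _ < δ := by
        rw [div_mul_eq_mul_div, div_lt_iff₀ (by positivity)]
        nlinarith

theorem exists_fst_bound {Q : ℝ × ℝ → ℝ} (hQc : HasCompactSupport Q) :
    ∃ R, ∀ z : ℝ × ℝ, R < |z.1| → Q z = 0 := by
  obtain ⟨R, hR⟩ := hQc.isCompact.isBounded.exists_norm_le
  refine ⟨R, fun z hz => by_contra fun h => ?_⟩
  have h1 := hR z (subset_tsupport _ h)
  have h2 : |z.1| ≤ ‖z‖ := norm_fst_le z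
  linarith

theorem fderiv_eq_zero_of_notMem_tsupport {Q : ℝ × ℝ → ℝ} {z : ℝ × ℝ} (hz : z ∉ tsupport Q) :
    fderiv ℝ Q z = 0 :=
  image_eq_zero_of_notMem_tsupport fun h => hz (tsupport_fderiv_subset ℝ h)

theorem fderiv_const_mul_apply {Q : ℝ × ℝ → ℝ} (hQ : ContDiff ℝ ∞ Q) (ε : ℝ) (z v : ℝ × ℝ) :
    fderiv ℝ (fun z => ε * Q z) z v = ε * fderiv ℝ Q z v := by
  rw [fderiv_const_mul (hQ.differentiable (by simp) z)]
  rfl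

/-- The data for moving the density of an area form inside an adapted chart: outside the critical
set `η = c x^{-m} dx ∧ dy` with `c` smooth and positive. -/
structure IsDensity (m : ℕ) (B : Critical S) (e : OpenPartialHomeomorph S (ℝ × ℝ))
    (η : FormField S 2) (c : ℝ × ℝ → ℝ) : Prop where
  smooth : ∀ z ∈ e.target, ContDiffAt ℝ ∞ c z
  pos : ∀ z ∈ e.target, 0 < c z
  eq : ∀ q ∈ e.source, q ∉ B.Z → η q = (c (e q) * ((e q).1 ^ m)⁻¹) • area e q

variable {η : FormField S 2} {c : ℝ × ℝ → ℝ}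

open Classical in
/-- The quotient `d(Q dy) / η`. -/
def ratioX (m : ℕ) (e : OpenPartialHomeomorph S (ℝ × ℝ)) (c Q : ℝ × ℝ → ℝ) (q : S) : ℝ :=
  if q ∈ e.source then (e q).1 ^ m * fderiv ℝ Q (e q) (1, 0) / c (e q) else 0

open Classical in
/-- The quotient `d(P x^{-m} dx) / η`. -/
def ratioY (e : OpenPartialHomeomorph S (ℝ × ℝ)) (c P : ℝ × ℝ → ℝ) (q : S) : ℝ :=
  if q ∈ e.source then - fderiv ℝ P (e q) (0, 1) / c (e q) else 0

/-- Adding a small multiple of `d(Q dy)` to the area form `F η` does not change it up to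
`b^m`-diffeomorphism. -/
theorem BChart.exists_step_x [T2Space S] (hm : 1 ≤ m) (he : BChart B e) (hc : IsDensity m B e η c)
    {Q : ℝ × ℝ → ℝ} (hQ : ContDiff ℝ ∞ Q) (hQc : HasCompactSupport Q)
    (hQe : tsupport Q ⊆ e.target) {κ : ℝ} (hκ : 0 < κ) :
    ∃ ε₀ > 0, ∀ F : S → ℝ, ContMDiff (𝓡 2) 𝓘(ℝ, ℝ) ∞ F → (∀ q, κ ≤ F q) → ∀ ε, |ε| ≤ ε₀ →
      (∀ q, 0 < F q + ε * ratioX m e c Q q) →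
      ∃ φ : S ≃ₘ^∞⟮𝓡 2, 𝓡 2⟯ S, IsBmMap m B φ ∧ ∀ q ∉ B.Z,
        pullback φ (fun q => F q • η q) q = (F q + ε * ratioX m e c Q q) • η q := by
  obtain ⟨k, rfl⟩ : ∃ k, m = k + 1 := ⟨m - 1, by omega⟩
  set K := tsupport Q with hK
  have hKc : IsCompact K := hQc.isCompact
  -- Only the density on the support `K` of `Q` matters; off `K` it is changed to one that is smooth
  -- and bounded below on the whole of `ℝ × ℝ`, as the rearrangement on full lines requires.
  obtain ⟨κ', hκ', hext⟩ := exists_extension e.open_target hKc hQe (c := fun z => κ * c z)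
    (fun z hz => (continuousAt_const.mul (hc.smooth z hz).continuousAt).continuousWithinAt)
    (fun z hz => mul_pos hκ (hc.pos z hz))
  obtain ⟨R, hR⟩ := exists_fst_bound hQc
  obtain ⟨ε₀, hε₀, hsmall⟩ := exists_forall_abs_mul_lt hQ.continuous hQc
    (δ := κ' * Real.exp (-(k * R ^ k))) (by positivity)
  refine ⟨ε₀, hε₀, fun F hF hFκ ε hε hpos => ?_⟩
  obtain ⟨a, ha, haκ, haK⟩ := hext (fun z => F (e.symm z) * c z)
    (fun z hz => (he.contDiffAt_comp_symm (fun q _ => hF q) z hz).mul (hc.smooth z hz))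
    (fun z hz => mul_le_mul_of_nonneg_right (hFκ _) (hc.pos z hz).le)
  obtain ⟨h, hh, hh0, hh1, hh2⟩ := exists_rearrangement k (Q := fun z => ε * Q z) ha
    (contDiff_const.mul hQ) hκ' haκ (fun z hz => by simp [hR z hz]) (hsmall ε hε) (by
      intro z
      rw [fderiv_const_mul_apply hQ]
      by_cases hz : z ∈ K
      · have h1 := hpos (e.symm z)
        rw [ratioX, if_pos (e.map_target (hQe hz)), e.right_inv (hQe hz)] at h1
        have hcz := hc.pos z (hQe hz)
        rw [haK z hz]
        have := mul_pos h1 hcz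
        field_simp at this
        linarith
      · rw [fderiv_eq_zero_of_notMem_tsupport hz]
        simpa using hκ'.trans_le (haκ z))
  have hQ0 : ∀ z ∉ K, h z = 0 := fun z hz => hh0 z (by simp [image_eq_zero_of_notMem_tsupport hz])
  obtain ⟨Φ, hΦ, hΦ', hΦu⟩ := exists_equiv_of_increasing_fst
    (u := fun z => z.1 + h z * z.1 ^ (k + 1)) (by fun_prop) (fun z => (hh2 z).1) hKc
    (fun z hz => by simp [hQ0 z hz])
  have hΦK : ∀ z ∉ K, Φ z = z := fun z hz => by rw [hΦu]; simp [hQ0 z hz]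
  obtain ⟨φ, hφe, hφK⟩ := he.exists_diffeomorph hΦ hΦ' hKc hQe hΦK
  have hclosed := isClosed_symm_image hKc hQe
  refine ⟨φ, ?_, ?_⟩
  · refine he.isBmMap hclosed ?_ hφK hh (fun q hq => (hφe q hq).1)
      (fun q hq => by rw [(hφe q hq).2, hΦu]) (fun q hq => ?_)
    · rintro _ ⟨z, hz, rfl⟩
      exact e.map_target (hQe hz)
    · rw [(hφe q hq).2, hΦu]
      have : (e q).1 + h (e q) * (e q).1 ^ (k + 1) = (e q).1 * (1 + (e q).1 ^ k * h (e q)) := by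
        ring
      simp only [this, mul_eq_zero, (hh1 (e q)).ne', or_false]
  · intro q hqZ
    by_cases hq : q ∈ e.symm '' K
    · obtain ⟨z, hz, rfl⟩ := hq
      have hzt := hQe hz
      have hq := e.map_target hzt
      have hez := e.right_inv hzt
      obtain ⟨hφ1, hφ2⟩ := hφe _ hq
      have hx : z.1 ≠ 0 := by
        rw [← hez]
        exact fun h0 => hqZ ((he.mem_Z _ hq).2 h0)
      rw [hez] at hφ2
      have hΦz : Φ z ∈ K := by
        by_contra hn
        have := Φ.injective (hΦK _ hn)
        rw [this] at hn
        exact hn hz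
      have hw := hh1 z
      have hu : (Φ z).1 = z.1 * (1 + z.1 ^ k * h z) := by
        rw [hΦu]
        ring
      have hφZ : φ (e.symm z) ∉ B.Z := by
        rw [he.mem_Z _ hφ1, hφ2, hu]
        exact mul_ne_zero hx hw.ne'
      have hη : (fun q => F q • η q) (φ (e.symm z)) =
          (a (Φ z) * ((Φ z).1 ^ (k + 1))⁻¹) • area e (φ (e.symm z)) := by
        simp only
        rw [hc.eq _ hφ1 hφZ, smul_smul, haK _ hΦz, ← hφ2, e.left_inv hφ1, hφ2, mul_assoc]
      rw [he.pullback_area hΦ (φ.contMDiff.contMDiffAt.mdifferentiableAt (by simp)) hφe hq hη, hez,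
        hc.eq _ hq hqZ, smul_smul, ratioX, if_pos hq, hez]
      congr 1
      have h1 : (fun z => (Φ z).1) = fun z : ℝ × ℝ => z.1 + h z * z.1 ^ (k + 1) := by
        funext z; rw [hΦu]
      have h2 : (fun z => (Φ z).2) = Prod.snd := by
        funext z; rw [hΦu]
      rw [h1, h2, hu, fderiv_snd]
      have key := (hh2 z).2
      rw [fderiv_const_mul_apply hQ, haK z hz] at key
      have hΦz' : Φ z = (z.1 + h z * z.1 ^ (k + 1), z.2) := hΦu z
      rw [← hΦz'] at key
      simp only [ContinuousLinearMap.coe_snd', mul_one, mul_zero, sub_zero]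
      generalize fderiv ℝ (fun z : ℝ × ℝ => z.1 + h z * z.1 ^ (k + 1)) z (1, 0) = D at *
      have hcz := (hc.pos z hzt).ne'
      rw [mul_right_comm, key, mul_pow]
      generalize 1 + z.1 ^ k * h z = w at *
      have := hw.ne'
      field_simp
    · have hid : φ =ᶠ[𝓝 q] id := by
        filter_upwards [hclosed.isOpen_compl.mem_nhds hq] with w hw using hφK w hw
      rw [pullback_of_eventuallyEq_id _ hid]
      have : ratioX (k + 1) e c Q q = 0 := by
        unfold ratioX
        split_ifs with hqs
        · have : e q ∉ K := fun h => hq ⟨_, h, e.left_inv hqs⟩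
          rw [fderiv_eq_zero_of_notMem_tsupport this]
          simp
        · rfl
      rw [this]
      simp

end Step

section Step

variable {S : Type*} [TopologicalSpace S] [ChartedSpace Plane S]
  {e : OpenPartialHomeomorph S (ℝ × ℝ)} {m : ℕ} {B : Critical S}
  {η : FormField S 2} {c : ℝ × ℝ → ℝ}

/-- Adding a small multiple of `d(P x^{-m} dx)` to the area form `F η` does not change it up to
`b^m`-diffeomorphism. -/
theorem BChart.exists_step_y [T2Space S] (he : BChart B e) (hc : IsDensity m B e η c)
    {P : ℝ × ℝ → ℝ} (hP : ContDiff ℝ ∞ P) (hPc : HasCompactSupport P)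
    (hPe : tsupport P ⊆ e.target) {κ : ℝ} (hκ : 0 < κ) :
    ∃ ε₀ > 0, ∀ F : S → ℝ, ContMDiff (𝓡 2) 𝓘(ℝ, ℝ) ∞ F → (∀ q, κ ≤ F q) → ∀ ε, |ε| ≤ ε₀ →
      (∀ q, 0 < F q + ε * ratioY e c P q) →
      ∃ φ : S ≃ₘ^∞⟮𝓡 2, 𝓡 2⟯ S, IsBmMap m B φ ∧ ∀ q ∉ B.Z,
        pullback φ (fun q => F q • η q) q = (F q + ε * ratioY e c P q) • η q := by
  set K := tsupport P with hK
  have hKc : IsCompact K := hPc.isCompact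
  have hy0 : ∀ z ∈ e.target, 0 < z.2 := fun z hz => by
    have := he.snd_pos _ (e.map_target hz)
    rwa [e.right_inv hz] at this
  -- As `y > 0` in the chart, the density can be written as `(y c) / y`, and the rearrangement of
  -- densities with a simple pole applies, with the two coordinates exchanged.
  obtain ⟨κ', hκ', hext⟩ := exists_extension e.open_target hKc hPe
    (c := fun z => z.2 * (κ * c z))
    (fun z hz => (continuousAt_snd.mul
      (continuousAt_const.mul (hc.smooth z hz).continuousAt)).continuousWithinAt)
    (fun z hz => mul_pos (hy0 z hz) (mul_pos hκ (hc.pos z hz)))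
  have hsw : ContDiff ℝ ∞ (Prod.swap : ℝ × ℝ → ℝ × ℝ) := contDiff_snd.prodMk contDiff_fst
  have hPs : ContDiff ℝ ∞ fun z : ℝ × ℝ => P z.swap := hP.comp hsw
  have hPsc : HasCompactSupport fun z : ℝ × ℝ => P z.swap :=
    hPc.comp_homeomorph (Homeomorph.prodComm ℝ ℝ)
  obtain ⟨R, hR⟩ := exists_fst_bound hPsc
  obtain ⟨ε₀, hε₀, hsmall⟩ := exists_forall_abs_mul_lt hPs.continuous hPsc
    (δ := κ' * Real.exp (-((0 : ℕ) * R ^ 0))) (by positivity)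
  refine ⟨ε₀, hε₀, fun F hF hFκ ε hε hpos => ?_⟩
  obtain ⟨b, hb, hbκ, hbK⟩ := hext (fun z => z.2 * (F (e.symm z) * c z))
    (fun z hz => contDiffAt_snd.mul
      ((he.contDiffAt_comp_symm (fun q _ => hF q) z hz).mul (hc.smooth z hz)))
    (fun z hz => mul_le_mul_of_nonneg_left
      (mul_le_mul_of_nonneg_right (hFκ _) (hc.pos z hz).le) (hy0 z hz).le)
  obtain ⟨h, hh, hh0, hh1, hh2⟩ := exists_rearrangement 0 (a := fun z => b z.swap)
    (Q := fun z => -ε * P z.swap) (hb.comp hsw)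
    (contDiff_const.mul hPs) hκ' (fun z => hbκ _) (fun z hz => by simp [hR z hz])
    (hsmall (-ε) (by rwa [abs_neg])) (by
      intro z
      rw [fderiv_const_mul_apply hPs, fderiv_comp_swap hP]
      by_cases hz : z.swap ∈ K
      · have h1 := hpos (e.symm z.swap)
        rw [ratioY, if_pos (e.map_target (hPe hz)), e.right_inv (hPe hz)] at h1
        have hcz := hc.pos _ (hPe hz)
        rw [hbK _ hz]
        have := mul_pos (mul_pos h1 hcz) (hy0 _ (hPe hz))
        have h3 : (F (e.symm z.swap) + ε * (-fderiv ℝ P z.swap (0, 1) / c z.swap)) * c z.swap =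
            F (e.symm z.swap) * c z.swap - ε * fderiv ℝ P z.swap (0, 1) := by
          field_simp
          ring
        rw [h3] at this
        simp only [Prod.snd_swap, Prod.swap_prod_mk, zero_add, pow_one] at this ⊢
        linarith
      · rw [fderiv_eq_zero_of_notMem_tsupport hz]
        simpa using hκ'.trans_le (hbκ _))
  have hP0 : ∀ z ∉ K, h z.swap = 0 := fun z hz =>
    hh0 z.swap (by simp [image_eq_zero_of_notMem_tsupport hz])
  have hus : ContDiff ℝ ∞ fun z : ℝ × ℝ => z.1 + h z * z.1 ^ (0 + 1) := by fun_prop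
  have hfd : ∀ z : ℝ × ℝ, fderiv ℝ (fun z : ℝ × ℝ => z.2 + h z.swap * z.2 ^ (0 + 1)) z (0, 1) =
      fderiv ℝ (fun z : ℝ × ℝ => z.1 + h z * z.1 ^ (0 + 1)) z.swap (1, 0) := fun z =>
    fderiv_comp_swap hus z (0, 1)
  obtain ⟨Φ, hΦ, hΦ', hΦu⟩ := exists_equiv_of_increasing_snd
    (u := fun z => z.2 + h z.swap * z.2 ^ (0 + 1)) (hus.comp hsw)
    (fun z => by rw [hfd]; exact (hh2 _).1) hKc
    (fun z hz => by simp [hP0 z hz])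
  have hΦK : ∀ z ∉ K, Φ z = z := fun z hz => by rw [hΦu]; simp [hP0 z hz]
  obtain ⟨φ, hφe, hφK⟩ := he.exists_diffeomorph hΦ hΦ' hKc hPe hΦK
  have hclosed := isClosed_symm_image hKc hPe
  have hφx : ∀ q ∈ e.source, (e (φ q)).1 = (e q).1 := fun q hq => by rw [(hφe q hq).2, hΦu]
  refine ⟨φ, ?_, ?_⟩
  · refine he.isBmMap hclosed ?_ hφK (H := 0) contDiff_const (fun q hq => (hφe q hq).1)
      (fun q hq => by simp [hφx q hq]) (fun q hq => by rw [hφx q hq])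
    rintro _ ⟨z, hz, rfl⟩
    exact e.map_target (hPe hz)
  · intro q hqZ
    by_cases hq : q ∈ e.symm '' K
    · obtain ⟨z, hz, rfl⟩ := hq
      have hzt := hPe hz
      have hq := e.map_target hzt
      have hez := e.right_inv hzt
      obtain ⟨hφ1, hφ2⟩ := hφe _ hq
      have hx : z.1 ≠ 0 := by
        rw [← hez]
        exact fun h0 => hqZ ((he.mem_Z _ hq).2 h0)
      rw [hez] at hφ2
      have hΦz : Φ z ∈ K := by
        by_contra hn
        have := Φ.injective (hΦK _ hn)
        rw [this] at hn
        exact hn hz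
      have hw := hh1 z.swap
      have hu1 : (Φ z).1 = z.1 := by rw [hΦu]
      have hu2 : (Φ z).2 = z.2 * (1 + z.swap.1 ^ 0 * h z.swap) := by
        rw [hΦu]
        ring
      have hφZ : φ (e.symm z) ∉ B.Z := by
        rw [he.mem_Z _ hφ1, hφ2, hu1]
        exact hx
      have hη : (fun q => F q • η q) (φ (e.symm z)) =
          (b (Φ z) / (Φ z).2 * (z.1 ^ m)⁻¹) • area e (φ (e.symm z)) := by
        have hy := (hy0 _ (hPe hΦz)).ne'
        simp only
        rw [hc.eq _ hφ1 hφZ, smul_smul, hbK _ hΦz, ← hφ2, e.left_inv hφ1, hφ2, hu1]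
        congr 1
        field_simp
      rw [he.pullback_area hΦ (φ.contMDiff.contMDiffAt.mdifferentiableAt (by simp)) hφe hq hη, hez,
        hc.eq _ hq hqZ, smul_smul, ratioY, if_pos hq, hez]
      congr 1
      have h1 : (fun z => (Φ z).1) = Prod.fst := by
        funext z; rw [hΦu]
      have h2 : (fun z => (Φ z).2) = fun z : ℝ × ℝ => z.2 + h z.swap * z.2 ^ (0 + 1) := by
        funext z; rw [hΦu]
      rw [h1, h2, hfd, hu2, fderiv_fst]
      have key := (hh2 z.swap).2
      rw [fderiv_const_mul_apply hPs, fderiv_comp_swap hP, Prod.swap_swap, hbK z hz] at key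
      have hΦz' : (z.swap.1 + h z.swap * z.swap.1 ^ (0 + 1), z.swap.2).swap = Φ z := (hΦu z).symm
      rw [hΦz'] at key
      simp only [ContinuousLinearMap.coe_fst', one_mul, zero_mul, sub_zero]
      generalize fderiv ℝ (fun z : ℝ × ℝ => z.1 + h z * z.1 ^ (0 + 1)) z.swap (1, 0) = D at *
      have hcz := (hc.pos z hzt).ne'
      have hyz := (hy0 z hzt).ne'
      simp only [Prod.fst_swap, Prod.swap_prod_mk] at key hw ⊢
      generalize 1 + z.2 ^ 0 * h z.swap = w at *
      have hw' := hw.ne'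
      have key' : b (Φ z) / (z.2 * w) * D =
          F (e.symm z) * c z - ε * fderiv ℝ P z (0, 1) := by
        rw [div_mul_eq_mul_div, key]
        field_simp
        ring
      rw [mul_right_comm, key']
      field_simp
      ring
    · have hid : φ =ᶠ[𝓝 q] id := by
        filter_upwards [hclosed.isOpen_compl.mem_nhds hq] with w hw using hφK w hw
      rw [pullback_of_eventuallyEq_id _ hid]
      have : ratioY e c P q = 0 := by
        unfold ratioY
        split_ifs with hqs
        · have : e q ∉ K := fun h => hq ⟨_, h, e.left_inv hqs⟩
          rw [fderiv_eq_zero_of_notMem_tsupport this]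
          simp
        · rfl
      rw [this]
      simp

end Step

/-! ### Existence of charts -/

section ExistsChart

theorem exists_openPartialHomeomorph {f : Plane → ℝ × ℝ} {O : Set Plane} (hO : IsOpen O)
    (hf : ∀ w ∈ O, ContDiffAt ℝ ∞ f w) {w₀ : Plane} (hw₀ : w₀ ∈ O)
    (hinj : Function.Injective (fderiv ℝ f w₀)) :
    ∃ h : OpenPartialHomeomorph Plane (ℝ × ℝ), w₀ ∈ h.source ∧ h.source ⊆ O ∧ (∀ w, h w = f w) ∧
      ∀ z ∈ h.target, ContDiffAt ℝ ∞ h.symm z := by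
  have hfin : Module.finrank ℝ Plane = Module.finrank ℝ (ℝ × ℝ) := by simp
  set A : Plane ≃L[ℝ] ℝ × ℝ :=
    (LinearMap.linearEquivOfInjective (fderiv ℝ f w₀).toLinearMap hinj hfin).toContinuousLinearEquiv
  have hA : (A : Plane →L[ℝ] ℝ × ℝ) = fderiv ℝ f w₀ := by
    ext1 v
    rfl
  have hd : HasFDerivAt f (A : Plane →L[ℝ] ℝ × ℝ) w₀ := by
    rw [hA]
    exact ((hf w₀ hw₀).differentiableAt (by simp)).hasFDerivAt
  have hcont : ContinuousAt (fderiv ℝ f) w₀ :=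
    ((hf w₀ hw₀).fderiv_right (m := ∞) (by simp)).continuousAt
  have hev : ∀ᶠ w in 𝓝 w₀, fderiv ℝ f w ∈
      range ((↑) : (Plane ≃L[ℝ] ℝ × ℝ) → (Plane →L[ℝ] ℝ × ℝ)) := by
    refine hcont.eventually ?_
    rw [← hA]
    exact ContinuousLinearEquiv.nhds A
  obtain ⟨V, hV, hVo, hwV⟩ := mem_nhds_iff.1 (hev.and (hO.mem_nhds hw₀))
  set h := ((hf w₀ hw₀).toOpenPartialHomeomorph f hd (by simp)).restrOpen V hVo
  have hcoe : ∀ w, h w = f w := fun w => rfl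
  refine ⟨h, ⟨(hf w₀ hw₀).mem_toOpenPartialHomeomorph_source hd (by simp), hwV⟩,
    fun w hw => (hV hw.2).2, hcoe, fun z hz => ?_⟩
  have hs := h.map_target hz
  obtain ⟨⟨A', hA'⟩, hmO⟩ := hV hs.2
  refine h.contDiffAt_symm (f₀' := A') hz ?_ (hf _ hmO)
  rw [hA']
  exact ((hf _ hmO).differentiableAt (by simp)).hasFDerivAt

theorem plane_eq_add (v : Plane) :
    v = v 0 • EuclideanSpace.single (0 : Fin 2) (1 : ℝ) +
      v 1 • EuclideanSpace.single (1 : Fin 2) (1 : ℝ) := by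
  ext i
  fin_cases i <;> simp

theorem dualBases_standard : DualBases (EuclideanSpace.proj (0 : Fin 2) : Plane →L[ℝ] ℝ)
    (EuclideanSpace.proj (1 : Fin 2) : Plane →L[ℝ] ℝ) (EuclideanSpace.single (0 : Fin 2) (1 : ℝ))
    (EuclideanSpace.single (1 : Fin 2) (1 : ℝ)) where
  aX := by simp
  aY := by simp
  bX := by simp
  bY := by simp
  span v := plane_eq_add v

/-- A nonzero covector divides every two-form of the plane. -/
theorem exists_wedge₁_eq {a : Plane →L[ℝ] ℝ} (ha : a ≠ 0) (θ : Plane [⋀^Fin 2]→L[ℝ] ℝ) :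
    ∃ b, wedge₁ a b = θ := by
  set X : Plane := EuclideanSpace.single (0 : Fin 2) (1 : ℝ)
  set Y : Plane := EuclideanSpace.single (1 : Fin 2) (1 : ℝ)
  have hN : a X * a X + a Y * a Y ≠ 0 := by
    intro h
    have h0 : a X = 0 := by nlinarith [mul_self_nonneg (a X), mul_self_nonneg (a Y)]
    have h1 : a Y = 0 := by nlinarith [mul_self_nonneg (a X), mul_self_nonneg (a Y)]
    apply ha
    ext1 v
    rw [plane_eq_add v, map_add, map_smul, map_smul, h0, h1]
    simp
  refine ⟨(θ ![X, Y] / (a X * a X + a Y * a Y)) • (a X • EuclideanSpace.proj (1 : Fin 2) -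
    a Y • EuclideanSpace.proj (0 : Fin 2)), ?_⟩
  refine (dualBases_standard.eq_wedge₁ _).trans
    (Eq.trans ?_ (dualBases_standard.eq_wedge₁ θ).symm)
  congr 1
  have h00 : (EuclideanSpace.proj (0 : Fin 2) : Plane →L[ℝ] ℝ) X = 1 := dualBases_standard.aX
  have h01 : (EuclideanSpace.proj (0 : Fin 2) : Plane →L[ℝ] ℝ) Y = 0 := dualBases_standard.aY
  have h10 : (EuclideanSpace.proj (1 : Fin 2) : Plane →L[ℝ] ℝ) X = 0 := dualBases_standard.bX
  have h11 : (EuclideanSpace.proj (1 : Fin 2) : Plane →L[ℝ] ℝ) Y = 1 := dualBases_standard.bY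
  simp only [wedge₁_apply, Matrix.cons_val_zero, Matrix.cons_val_one, smul_apply, sub_apply,
    smul_eq_mul]
  change a X * (θ ![X, Y] / _ * (a X * _ - a Y * _)) - a Y * (θ ![X, Y] / _ * (a X * _ - a Y * _)) =
    θ ![X, Y]
  have hN' : a X ^ 2 + a Y ^ 2 ≠ 0 := by simpa [sq] using hN
  rw [h00, h01, h10, h11]
  field_simp
  ring

theorem injective_prod_of_wedge₁_ne_zero {a b : Plane →L[ℝ] ℝ} (h : wedge₁ a b ≠ 0) :
    Function.Injective (a.prod b) := by
  rw [injective_iff_map_eq_zero]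
  intro v hv
  have ha : a v = 0 := congrArg Prod.fst hv
  have hb : b v = 0 := congrArg Prod.snd hv
  set X : Plane := EuclideanSpace.single (0 : Fin 2) (1 : ℝ)
  set Y : Plane := EuclideanSpace.single (1 : Fin 2) (1 : ℝ)
  have ht : a X * b Y - a Y * b X ≠ 0 := by
    intro h0
    apply h
    rw [dualBases_standard.eq_wedge₁ (wedge₁ a b)]
    have : wedge₁ a b ![X, Y] = 0 := by simpa using h0
    rw [this, zero_smul]
  rw [plane_eq_add v, map_add, map_smul, map_smul, smul_eq_mul, smul_eq_mul] at ha hb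
  have h0 : v 0 = 0 := by
    have : v 0 * (a X * b Y - a Y * b X) = 0 := by linear_combination b Y * ha - a Y * hb
    exact (mul_eq_zero.1 this).resolve_right ht
  have h1 : v 1 = 0 := by
    have : v 1 * (a X * b Y - a Y * b X) = 0 := by linear_combination a X * hb - b X * ha
    exact (mul_eq_zero.1 this).resolve_right ht
  rw [plane_eq_add v, h0, h1]
  simp

variable {S : Type*} [TopologicalSpace S] [ChartedSpace Plane S]

theorem SmoothChart.restrOpen {e : OpenPartialHomeomorph S (ℝ × ℝ)} (he : SmoothChart e)
    {V : Set S} (hV : IsOpen V) : SmoothChart (e.restrOpen V hV) where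
  smooth := he.smooth.mono inter_subset_left
  smooth_symm := he.smooth_symm.mono inter_subset_left

/-- At the base point of a preferred chart, differentials are computed in that chart. -/
theorem dFun_comp_chartAt [IsManifold (𝓡 2) ∞ S] {p : S} {F : Plane → ℝ}
    (hF : DifferentiableAt ℝ F (chartAt Plane p p)) :
    dFun (fun q => F (chartAt Plane p q)) p = fderiv ℝ F (chartAt Plane p p) := by
  have : IsManifold (𝓡 2) 1 S := .of_le (n := ∞) (by simp)
  have hcd : MDifferentiableAt (𝓡 2) 𝓘(ℝ, Plane) (chartAt Plane p) p :=
    mdifferentiableAt_extChartAt (I := 𝓡 2) (mem_chart_source _ p)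
  have hcid : (mfderiv (𝓡 2) 𝓘(ℝ, Plane) (chartAt Plane p) p : Plane →L[ℝ] Plane) =
      ContinuousLinearMap.id ℝ Plane := mfderiv_extChartAt_self (I := 𝓡 2) (x := p)
  have h1 := mfderiv_comp p hF.mdifferentiableAt hcd
  rw [mfderiv_eq_fderiv] at h1
  have h2 : dFun (fun q => F (chartAt Plane p q)) p = (fderiv ℝ F (chartAt Plane p p)).comp
    (mfderiv (𝓡 2) 𝓘(ℝ, Plane) (chartAt Plane p) p : Plane →L[ℝ] Plane) := h1
  rw [h2, hcid]
  rfl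

/-- Every function `x` with nonzero differential at `p` is the first coordinate of a chart at `p`
whose area form at `p` is a given nonzero form. -/
theorem exists_smoothChart [IsManifold (𝓡 2) ∞ S] {p : S} {U : Set S} (hU : IsOpen U) (hp : p ∈ U)
    {x : S → ℝ} (hx : ContMDiffOn (𝓡 2) 𝓘(ℝ, ℝ) ∞ x U) (hxp : dFun x p ≠ 0)
    {θ : Plane [⋀^Fin 2]→L[ℝ] ℝ} (hθ : θ ≠ 0) :
    ∃ e : OpenPartialHomeomorph S (ℝ × ℝ), SmoothChart e ∧ p ∈ e.source ∧ e.source ⊆ U ∧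
      (∀ q ∈ e.source, (e q).1 = x q) ∧ (∀ q ∈ e.source, 0 < (e q).2) ∧ area e p = θ := by
  obtain ⟨b, hb⟩ := exists_wedge₁_eq hxp θ
  set c := chartAt Plane p
  have hpc : p ∈ c.source := mem_chart_source _ p
  have hcs : ContMDiffOn (𝓡 2) (𝓡 2) ∞ c c.source := contMDiffOn_chart
  have hcs' : ContMDiffOn (𝓡 2) (𝓡 2) ∞ c.symm c.target := contMDiffOn_chart_symm
  set O := c.target ∩ c.symm ⁻¹' U
  have hO : IsOpen O := c.symm.isOpen_inter_preimage hU
  have hpO : c p ∈ O := ⟨c.map_source hpc, by simpa [c.left_inv hpc] using hp⟩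
  set g : Plane → ℝ := fun w => 1 + b (w - c p)
  have hg : ContDiff ℝ ∞ g := by fun_prop
  have hxO : ∀ w ∈ O, ContDiffAt ℝ ∞ (fun w => x (c.symm w)) w := by
    intro w hw
    rw [← contMDiffAt_iff_contDiffAt]
    exact (hx.contMDiffAt (hU.mem_nhds hw.2)).comp w
      (hcs'.contMDiffAt (c.open_target.mem_nhds hw.1))
  have hchain : ∀ F : Plane → ℝ, DifferentiableAt ℝ F (c p) →
      dFun (fun q => F (c q)) p = fderiv ℝ F (c p) := fun F hF => dFun_comp_chartAt hF
  have hd1 : fderiv ℝ (fun w => x (c.symm w)) (c p) = dFun x p := by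
    rw [← hchain _ ((hxO _ hpO).differentiableAt (by simp))]
    refine dFun_congr ?_
    filter_upwards [c.open_source.mem_nhds hpc] with q hq
    rw [c.left_inv hq]
  have hd2 : fderiv ℝ g (c p) = b := by
    have : HasFDerivAt g b (c p) := by
      have := HasFDerivAt.comp (g := b) (f := fun w => w - c p) (c p) b.hasFDerivAt
        ((hasFDerivAt_id (c p)).sub_const (c p))
      exact (this.const_add 1)
    exact this.fderiv
  obtain ⟨h, hh1, hh2, hh3, hh4⟩ := exists_openPartialHomeomorph
    (f := fun w => (x (c.symm w), g w)) hO (fun w hw => (hxO w hw).prodMk hg.contDiffAt) hpO (by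
      rw [((((hxO _ hpO).differentiableAt (by simp)).hasFDerivAt).prodMk
        ((hg.differentiable (by simp)) (c p)).hasFDerivAt).fderiv, hd1, hd2]
      exact injective_prod_of_wedge₁_ne_zero (by rwa [hb]))
  have hgp : 0 < g (c p) := by simp [g]
  set e₀ : OpenPartialHomeomorph S (ℝ × ℝ) := c.trans h
  have he₀ : SmoothChart e₀ := by
    refine ⟨fun q hq => ?_, fun z hz => ?_⟩
    · have h1 : q ∈ c.source := hq.1
      have h2 : c q ∈ h.source := hq.2
      refine ContMDiffAt.contMDiffWithinAt ?_
      have h3 : ContDiffAt ℝ ∞ h (c q) :=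
        ((hxO _ (hh2 h2)).prodMk hg.contDiffAt).congr_of_eventuallyEq (.of_forall hh3)
      exact h3.contMDiffAt.comp q (hcs.contMDiffAt (c.open_source.mem_nhds h1))
    · have h1 : z ∈ h.target := hz.1
      have h2 : h.symm z ∈ c.target := hz.2
      refine ContMDiffAt.contMDiffWithinAt ?_
      exact (hcs'.contMDiffAt (c.open_target.mem_nhds h2)).comp z (hh4 z h1).contMDiffAt
  have hcg : ContinuousOn (fun q => g (c q)) c.source :=
    hg.continuous.comp_continuousOn c.continuousOn
  have hVo : IsOpen (c.source ∩ (fun q => g (c q)) ⁻¹' Ioi 0) :=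
    hcg.isOpen_inter_preimage c.open_source isOpen_Ioi
  have hcoe : ∀ q, e₀ q = (x (c.symm (c q)), g (c q)) := fun q => hh3 (c q)
  have hpe : p ∈ e₀.source := ⟨hpc, hh1⟩
  refine ⟨e₀.restrOpen _ hVo, he₀.restrOpen hVo, ⟨hpe, hpc, hgp⟩, fun q hq => ?_, fun q hq => ?_,
    fun q hq => ?_, ?_⟩
  · have h1 : c.symm (c q) ∈ U := (hh2 hq.1.2).2
    rwa [c.left_inv hq.1.1] at h1
  · change (e₀ q).1 = _
    rw [hcoe, c.left_inv hq.1.1]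
  · change 0 < (e₀ q).2
    rw [hcoe]
    exact hq.2.2
  · have h1 : dx (e₀.restrOpen _ hVo) p = dFun x p := by
      refine dFun_congr ?_
      filter_upwards [c.open_source.mem_nhds hpc] with q hq
      change (e₀ q).1 = _
      rw [hcoe, c.left_inv hq]
    have h2 : dy (e₀.restrOpen _ hVo) p = b := by
      rw [← hd2, ← hchain _ ((hg.differentiable (by simp)) (c p))]
      refine dFun_congr (.of_forall fun q => ?_)
      change (e₀ q).2 = _
      rw [hcoe]
    rw [area, h1, h2, hb]

end ExistsChart

/-! ### Adapted defining functions and composition of `b^m`-maps -/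

section Sign

variable {S : Type*} [TopologicalSpace S] [ChartedSpace Plane S] {B : Critical S} {m : ℕ}

theorem dFun_const_mul {x : S → ℝ} {q : S} (hx : MDifferentiableAt (𝓡 2) 𝓘(ℝ, ℝ) x q) (r : ℝ) :
    dFun (fun q => r * x q) q = r • dFun x q := by
  have hF : HasFDerivAt (fun t : ℝ => r * t) (r • ContinuousLinearMap.id ℝ ℝ) (x q) :=
    (hasFDerivAt_id (x q)).const_mul r
  exact (hF.hasMFDerivAt.comp q hx.hasMFDerivAt).mfderiv

theorem Critical.IsDefining.mdifferentiableAt {U : Set S} {x : S → ℝ} (h : B.IsDefining U x)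
    {q : S} (hq : q ∈ U) : MDifferentiableAt (𝓡 2) 𝓘(ℝ, ℝ) x q :=
  (h.smooth.contMDiffAt (h.isOpen.mem_nhds hq)).mdifferentiableAt (by simp)

theorem Critical.IsDefining.eq_zero_iff {U : Set S} {x : S → ℝ} (h : B.IsDefining U x)
    {q : S} (hq : q ∈ U) : x q = 0 ↔ q ∈ B.Z := by
  rw [← B.dist_eq_zero_iff, ← h.abs_eq q hq, abs_eq_zero]

theorem Critical.IsDefining.const_mul {U : Set S} {x : S → ℝ} (h : B.IsDefining U x) {σ : ℝ}
    (hσ : σ = 1 ∨ σ = -1) : B.IsDefining U fun q => σ * x q where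
  isOpen := h.isOpen
  smooth := contMDiffOn_const.mul h.smooth
  dFun_ne_zero q hq := by
    rw [dFun_const_mul (h.mdifferentiableAt hq)]
    refine smul_ne_zero ?_ (h.dFun_ne_zero q hq)
    rcases hσ with rfl | rfl <;> norm_num
  abs_eq q hq := by
    rw [abs_mul, h.abs_eq q hq]
    rcases hσ with rfl | rfl <;> simp

theorem exists_form_ne_zero : ∃ θ : Plane [⋀^Fin 2]→L[ℝ] ℝ, θ ≠ 0 :=
  ⟨_, dualBases_standard.wedge₁_ne_zero⟩

/-- Two adapted defining functions agree up to a sign near each point of the critical set: in a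
chart with first coordinate `x`, the quotient `x' / x` takes only the values `± 1` and is close to
the derivative `∂x' / ∂x`. -/
theorem Critical.IsDefining.eventually_eq [IsManifold (𝓡 2) ∞ S] {U U' : Set S} {x x' : S → ℝ}
    (h : B.IsDefining U x) (h' : B.IsDefining U' x') {p : S} (hp : p ∈ U) (hp' : p ∈ U')
    (hpZ : p ∈ B.Z) : ∃ σ : ℝ, (σ = 1 ∨ σ = -1) ∧ ∀ᶠ q in 𝓝 p, x' q = σ * x q := by
  obtain ⟨θ, hθ⟩ := exists_form_ne_zero
  obtain ⟨e, he, hpe, heU, hex, -, -⟩ := exists_smoothChart h.isOpen hp h.smooth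
    (h.dFun_ne_zero p hp) hθ
  have hz := e.map_source hpe
  have hz0 : (e p).1 = 0 := by rw [hex p hpe, h.eq_zero_iff hp]; exact hpZ
  have hX : ContDiffAt ℝ ∞ (x' ∘ e.symm) (e p) :=
    (he.contMDiffAt_comp_iff hpe).2 (h'.smooth.contMDiffAt (h'.isOpen.mem_nhds hp'))
  have hstrict := hX.hasStrictFDerivAt (by simp)
  set D := fderiv ℝ (x' ∘ e.symm) (e p)
  have hO : IsOpen (e.target ∩ e.symm ⁻¹' U') := e.symm.isOpen_inter_preimage h'.isOpen
  have hzO : e p ∈ e.target ∩ e.symm ⁻¹' U' := ⟨hz, by simpa [e.left_inv hpe] using hp'⟩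
  have htend : Filter.Tendsto (fun z : ℝ × ℝ => (z, ((0 : ℝ), z.2))) (𝓝 (e p))
      (𝓝 (e p, e p)) := by
    have hc : Continuous fun z : ℝ × ℝ => (z, ((0 : ℝ), z.2)) := by fun_prop
    have := hc.tendsto (e p)
    rwa [show (((0 : ℝ), (e p).2) : ℝ × ℝ) = e p from Prod.ext hz0.symm rfl] at this
  have habs : ∀ z ∈ e.target ∩ e.symm ⁻¹' U', |x' (e.symm z)| = |z.1| := by
    intro z hz
    have hs := e.map_target hz.1
    rw [h'.abs_eq _ hz.2, ← h.abs_eq _ (heU hs), ← hex _ hs, e.right_inv hz.1]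
  have key : ∀ᶠ z in 𝓝 (e p), |x' (e.symm z) - z.1 * D (1, 0)| ≤ 1 / 4 * |z.1| ∧
      |x' (e.symm z)| = |z.1| := by
    have h1 := htend.eventually (hstrict.isLittleO.def (c := 1 / 4) (by norm_num))
    have h2 : ∀ᶠ z : ℝ × ℝ in 𝓝 (e p), ((0 : ℝ), z.2) ∈ e.target ∩ e.symm ⁻¹' U' := by
      have := htend.snd_nhds
      exact this.eventually (hO.mem_nhds hzO)
    filter_upwards [h1, h2, hO.mem_nhds hzO] with z h1 h2 h3
    refine ⟨?_, habs z h3⟩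
    have h4 : x' (e.symm ((0 : ℝ), z.2)) = 0 := by
      rw [← abs_eq_zero, habs _ h2]
      simp
    have h5 : z - ((0 : ℝ), z.2) = z.1 • ((1 : ℝ), (0 : ℝ)) := by ext <;> simp
    have h6 : ‖z.1 • ((1 : ℝ), (0 : ℝ))‖ = |z.1| := by
      rw [norm_smul]
      simp [Prod.norm_def]
    simp only [Function.comp] at h1
    rw [h4, h5, h6, map_smul, sub_zero, smul_eq_mul] at h1
    exact h1
  have hback : ∀ᶠ q in 𝓝 p, |x' q - x q * D (1, 0)| ≤ 1 / 4 * |x q| ∧ |x' q| = |x q| := by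
    have := (e.continuousAt hpe).eventually key
    filter_upwards [this, e.open_source.mem_nhds hpe] with q h1 h2
    rwa [e.left_inv h2, hex q h2] at h1
  by_cases hD : 0 ≤ D (1, 0)
  · refine ⟨1, Or.inl rfl, ?_⟩
    filter_upwards [hback] with q hq
    obtain ⟨h1, h2⟩ := hq
    rcases abs_eq_abs.1 h2 with h3 | h3
    · rw [h3, one_mul]
    · have h4 : |x q| * (1 + D (1, 0)) ≤ 1 / 4 * |x q| := by
        rw [h3, show -x q - x q * D (1, 0) = -(x q * (1 + D (1, 0))) by ring, abs_neg, abs_mul,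
          abs_of_nonneg (by linarith : 0 ≤ 1 + D (1, 0))] at h1
        exact h1
      have h5 : |x q| = 0 := by
        nlinarith [abs_nonneg (x q), mul_nonneg (abs_nonneg (x q)) hD]
      rw [h3, abs_eq_zero.1 h5]
      simp
  · refine ⟨-1, Or.inr rfl, ?_⟩
    push Not at hD
    filter_upwards [hback] with q hq
    obtain ⟨h1, h2⟩ := hq
    rcases abs_eq_abs.1 h2 with h3 | h3
    · have h4 : |x q| * (1 - D (1, 0)) ≤ 1 / 4 * |x q| := by
        rw [h3, show x q - x q * D (1, 0) = x q * (1 - D (1, 0)) by ring, abs_mul,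
          abs_of_nonneg (by linarith : 0 ≤ 1 - D (1, 0))] at h1
        exact h1
      have h5 : |x q| = 0 := by
        nlinarith [abs_nonneg (x q), mul_nonneg (abs_nonneg (x q)) (neg_nonneg.2 hD.le)]
      rw [h3, abs_eq_zero.1 h5]
      simp
    · rw [h3]
      ring

/-- The defining functions that belong to the two maps near `φ p` agree up to a sign. -/
theorem IsBmMap.comp [IsManifold (𝓡 2) ∞ S] (hm : 1 ≤ m) {φ ψ : S → S}
    (hφs : ContMDiff (𝓡 2) (𝓡 2) ∞ φ) (hφ : IsBmMap m B φ) (hψ : IsBmMap m B ψ) :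
    IsBmMap m B (ψ ∘ φ) := by
  refine ⟨fun p => (hψ.1 (φ p)).trans (hφ.1 p), fun p hp => ?_⟩
  obtain ⟨U, V, x, y, h, hpU, hx, hpV, hy, hUV, hh, hxy⟩ := hφ.2 p hp
  have hpZ : φ p ∈ B.Z := (hφ.1 p).2 hp
  obtain ⟨U', V', x', y', h', hpU', hx', hpV', hy', hUV', hh', hxy'⟩ := hψ.2 (φ p) hpZ
  obtain ⟨σ, hσ, hev⟩ := hy.eventually_eq hx' hpV hpU' hpZ
  obtain ⟨W, hW, hWo, hpW⟩ := mem_nhds_iff.1 (hev.and (hx'.isOpen.mem_nhds hpU'))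
  have hO : IsOpen (U ∩ φ ⁻¹' W) := hx.isOpen.inter (hWo.preimage hφs.continuous)
  refine ⟨U ∩ φ ⁻¹' W, V', x, fun q => σ * y' q,
    fun q => h q + σ ^ (m + 1) * h' (φ q) * (1 + h q * x q ^ (m - 1)) ^ m, ⟨hpU, hpW⟩,
    hx.mono hO inter_subset_left, hpV', hy'.const_mul hσ, fun q hq => hUV' (hW hq.2).2, ?_, ?_⟩
  · have h1 := hh.mono (inter_subset_left (t := φ ⁻¹' W))
    have h2 := hx.smooth.mono (inter_subset_left (t := φ ⁻¹' W))
    have h3 : ContMDiffOn (𝓡 2) 𝓘(ℝ, ℝ) ∞ (fun q => h' (φ q)) (U ∩ φ ⁻¹' W) :=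
      hh'.comp hφs.contMDiffOn fun q hq => (hW hq.2).2
    have h4 : ContDiff ℝ ∞ fun w : ℝ × ℝ × ℝ =>
        w.1 + σ ^ (m + 1) * w.2.1 * (1 + w.1 * w.2.2 ^ (m - 1)) ^ m := by fun_prop
    exact h4.contMDiff.comp_contMDiffOn (h1.prodMk_space (h3.prodMk_space h2))
  · rintro q ⟨hqU, hqW⟩
    have h1 : y' (ψ (φ q)) = x' (φ q) + h' (φ q) * x' (φ q) ^ m := hxy' _ (hW hqW).2
    have h2 : x' (φ q) = σ * y (φ q) := (hW hqW).1
    have h3 : y (φ q) = x q + h q * x q ^ m := hxy q hqU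
    have h4 : y (φ q) = x q * (1 + h q * x q ^ (m - 1)) := by
      obtain ⟨k, rfl⟩ : ∃ k, m = k + 1 := ⟨m - 1, by omega⟩
      rw [h3, Nat.add_sub_cancel]
      ring
    have hσ2 : σ * σ = 1 := by rcases hσ with rfl | rfl <;> norm_num
    simp only [Function.comp]
    rw [h1, h2, mul_pow]
    have h5 : σ * (σ * y (φ q)) = x q + h q * x q ^ m := by
      rw [← mul_assoc, hσ2, one_mul, h3]
    rw [mul_add, h5, h4, mul_pow]
    ring

theorem isBmMap_id : IsBmMap m B id := by
  refine ⟨fun p => Iff.rfl, fun p hp => ?_⟩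
  obtain ⟨U, x, hpU, hx⟩ := B.exists_isDefining hp
  exact ⟨U, U, x, x, 0, hpU, hx, hpU, hx, fun q hq => hq, contMDiffOn_const, fun q _ => by simp⟩

end Sign

/-! ### Coefficients of `b^m`-forms in adapted charts -/

section Coeff

theorem wedge_eq_smul_of_dualBases {a b : Plane →L[ℝ] ℝ} {X Y : Plane} (h : DualBases a b X Y)
    (α : Plane [⋀^Fin 1]→L[ℝ] ℝ) : wedge a α = α ![Y] • wedge₁ a b := by
  rw [h.eq_wedge₁ (wedge a α), wedge_one_apply]
  simp [h.aX, h.aY]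

theorem wedge_zero_eq (a : Plane →L[ℝ] ℝ) (g : Plane [⋀^Fin 0]→L[ℝ] ℝ) :
    wedge a g = g ![] • cov a := by
  ext v
  rw [wedge_zero_apply]
  simp [mul_comm]

theorem wedge_smul_left {k : ℕ} (r : ℝ) (a : Plane →L[ℝ] ℝ) (g : Plane [⋀^Fin k]→L[ℝ] ℝ) :
    wedge (r • a) g = r • wedge a g := by
  ext v
  unfold wedge
  simp only [ContinuousAlternatingMap.alternatizeUncurryFin_apply,
    ContinuousAlternatingMap.smul_apply, ContinuousLinearMap.smulRight_apply, smul_apply,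
    Finset.smul_sum]
  refine Finset.sum_congr rfl fun i _ => ?_
  simp only [smul_eq_mul, zsmul_eq_mul]
  ring

theorem wedge_smul_right {k : ℕ} (r : ℝ) (a : Plane →L[ℝ] ℝ) (g : Plane [⋀^Fin k]→L[ℝ] ℝ) :
    wedge a (r • g) = r • wedge a g := by
  ext v
  unfold wedge
  simp only [ContinuousAlternatingMap.alternatizeUncurryFin_apply,
    ContinuousAlternatingMap.smul_apply, ContinuousLinearMap.smulRight_apply,
    Finset.smul_sum]
  refine Finset.sum_congr rfl fun i _ => ?_
  simp only [smul_eq_mul, zsmul_eq_mul]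
  ring

variable {S : Type*} [TopologicalSpace S] [ChartedSpace Plane S]

theorem SmoothFormOn.mono {k : ℕ} {η : FormField S k} {U V : Set S} (h : SmoothFormOn η U)
    (hVU : V ⊆ U) : SmoothFormOn η V := fun p =>
  (h p).mono (inter_subset_inter_right _ (preimage_mono hVU))

theorem smoothFormOn_zero (k : ℕ) (U : Set S) : SmoothFormOn (0 : FormField S k) U := by
  intro p
  have : inChart (0 : FormField S k) p = fun _ => 0 := by
    funext y
    ext v
    rfl
  rw [this]
  exact contDiffOn_const

theorem SmoothFormOn.const_smul {k : ℕ} {η : FormField S k} {U : Set S} (h : SmoothFormOn η U)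
    (r : ℝ) : SmoothFormOn (fun q => r • η q) U := by
  intro p
  have : inChart (fun q => r • η q) p = fun y => r • inChart η p y := by
    funext y
    ext v
    rfl
  rw [this]
  exact ContDiffOn.const_smul r (h p)

/-- In the chart `e`, the one-form `α` is `P x^{-m} dx + Q dy` outside the critical set, with `P`
and `Q` smooth. -/
structure IsCoeff (m : ℕ) (B : Critical S) (e : OpenPartialHomeomorph S (ℝ × ℝ))
    (α : FormField S 1) (P Q : ℝ × ℝ → ℝ) : Prop where
  smooth_left : ∀ z ∈ e.target, ContDiffAt ℝ ∞ P z
  smooth_right : ∀ z ∈ e.target, ContDiffAt ℝ ∞ Q z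
  eq : ∀ q ∈ e.source, q ∉ B.Z →
    α q = (P (e q) * ((e q).1 ^ m)⁻¹) • cov (dx e q) + Q (e q) • cov (dy e q)

/-- Around a point where the two-form `dx ∧ A + x^m β₂` does not vanish, there is a chart with first
coordinate `x` in which this form is a positive multiple of the area form. -/
theorem exists_chart_coeff [IsManifold (𝓡 2) ∞ S] (m : ℕ) {p : S} {U : Set S} (hU : IsOpen U)
    (hp : p ∈ U) {x : S → ℝ} (hx : ContMDiffOn (𝓡 2) 𝓘(ℝ, ℝ) ∞ x U) (hxp : dFun x p ≠ 0)
    {A β₁ : FormField S 1} {β₂ : FormField S 2} {g : FormField S 0} (hA : SmoothFormOn A U)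
    (hβ₁ : SmoothFormOn β₁ U) (hβ₂ : SmoothFormOn β₂ U) (hg : SmoothFormOn g U)
    (hnd : wedge (dFun x p) (A p) + x p ^ m • β₂ p ≠ 0) :
    ∃ (e : OpenPartialHomeomorph S (ℝ × ℝ)) (c P Q : ℝ × ℝ → ℝ), SmoothChart e ∧ p ∈ e.source ∧
      e.source ⊆ U ∧ (∀ q ∈ e.source, (e q).1 = x q) ∧ (∀ q ∈ e.source, 0 < (e q).2) ∧
      (∀ z ∈ e.target, ContDiffAt ℝ ∞ c z) ∧ (∀ z ∈ e.target, 0 < c z) ∧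
      (∀ z ∈ e.target, ContDiffAt ℝ ∞ P z) ∧ (∀ z ∈ e.target, ContDiffAt ℝ ∞ Q z) ∧
      (∀ q ∈ e.source, wedge (dFun x q) (A q) + x q ^ m • β₂ q = c (e q) • area e q) ∧
      ∀ q ∈ e.source, wedge (dFun x q) (g q) + x q ^ m • β₁ q =
        P (e q) • cov (dx e q) + (x q ^ m * Q (e q)) • cov (dy e q) := by
  obtain ⟨e, he, hpe, heU, hex, hey, harea⟩ := exists_smoothChart hU hp hx hxp hnd
  have hxs : ∀ q ∈ e.source, ContMDiffAt (𝓡 2) 𝓘(ℝ, ℝ) ∞ x q := fun q hq =>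
    hx.contMDiffAt (hU.mem_nhds (heU hq))
  have hdx : ∀ q ∈ e.source, dFun x q = dx e q := by
    intro q hq
    refine dFun_congr ?_
    filter_upwards [e.open_source.mem_nhds hq] with w hw using (hex w hw).symm
  have hcoef : ∀ {k : ℕ} {ξ : FormField S k}, SmoothFormOn ξ U → ∀ v : Fin k → ℝ × ℝ,
      ∀ q ∈ e.source, ContMDiffAt (𝓡 2) 𝓘(ℝ, ℝ) ∞ (fun q => ξ q fun i => coordVec e q (v i)) q :=
    fun hξ v q hq => he.contMDiffAt_apply_coordVec hU hξ hq (heU hq) v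
  have h1 : ∀ (q : S) (w : ℝ × ℝ), (fun i => coordVec e q (![w] i)) = ![coordVec e q w] := by
    intro q w
    funext i
    fin_cases i
    rfl
  have h2 : ∀ (q : S) (w w' : ℝ × ℝ), (fun i => coordVec e q (![w, w'] i)) =
      ![coordVec e q w, coordVec e q w'] := by
    intro q w w'
    funext i
    fin_cases i <;> rfl
  have h0 : ∀ q : S, (fun i => coordVec e q ((![] : Fin 0 → ℝ × ℝ) i)) = ![] := fun q =>
    Subsingleton.elim _ _
  have hAY := hcoef hA ![(0, 1)]
  have hβ₂XY := hcoef hβ₂ ![(1, 0), (0, 1)]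
  have hβ₁X := hcoef hβ₁ ![(1, 0)]
  have hβ₁Y := hcoef hβ₁ ![(0, 1)]
  have hg0 := hcoef hg ![]
  simp only [h0, h1, h2] at hAY hβ₂XY hβ₁X hβ₁Y hg0
  set c' : S → ℝ := fun q => A q ![coordVec e q (0, 1)] +
    x q ^ m * β₂ q ![coordVec e q (1, 0), coordVec e q (0, 1)]
  set P' : S → ℝ := fun q => g q ![] + x q ^ m * β₁ q ![coordVec e q (1, 0)]
  set Q' : S → ℝ := fun q => β₁ q ![coordVec e q (0, 1)]
  have hc' : ∀ q ∈ e.source, ContMDiffAt (𝓡 2) 𝓘(ℝ, ℝ) ∞ c' q := fun q hq =>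
    (hAY q hq).add (((hxs q hq).pow m).mul (hβ₂XY q hq))
  have hP' : ∀ q ∈ e.source, ContMDiffAt (𝓡 2) 𝓘(ℝ, ℝ) ∞ P' q := fun q hq =>
    (hg0 q hq).add (((hxs q hq).pow m).mul (hβ₁X q hq))
  have hceq : ∀ q ∈ e.source, wedge (dFun x q) (A q) + x q ^ m • β₂ q = c' q • area e q := by
    intro q hq
    have hD := he.dualBases hq
    rw [hdx q hq, wedge_eq_smul_of_dualBases hD, hD.eq_wedge₁ (β₂ q), smul_smul, ← add_smul]
    rfl
  have hcp : c' p = 1 := by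
    have := hceq p hpe
    rw [← harea] at this
    have h3 := congrArg (fun θ : Plane [⋀^Fin 2]→L[ℝ] ℝ =>
      θ ![coordVec e p (1, 0), coordVec e p (0, 1)]) this
    have h4 : area e p ![coordVec e p (1, 0), coordVec e p (0, 1)] = 1 :=
      (he.dualBases hpe).wedge₁_apply_eq_one
    simp only [ContinuousAlternatingMap.smul_apply, h4, smul_eq_mul, mul_one] at h3
    exact h3.symm
  have hV : IsOpen (e.source ∩ c' ⁻¹' Ioi 0) :=
    ContinuousOn.isOpen_inter_preimage
      (fun q hq => (hc' q hq).continuousAt.continuousWithinAt) e.open_source isOpen_Ioi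
  have he' := he.restrOpen hV
  set e' := e.restrOpen _ hV
  have hsub : ∀ q ∈ e'.source, q ∈ e.source := fun q hq => hq.1
  have hl : ∀ q ∈ e'.source, e.symm (e q) = q := fun q hq => e.left_inv hq.1
  refine ⟨e', c' ∘ e.symm, P' ∘ e.symm, Q' ∘ e.symm, he', ⟨hpe, hpe, ?_⟩,
    fun q hq => heU hq.1, fun q hq => hex q hq.1, fun q hq => hey q hq.1,
    he'.contDiffAt_comp_symm fun q hq => hc' q hq.1, fun z hz => ?_,
    he'.contDiffAt_comp_symm fun q hq => hP' q hq.1,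
    he'.contDiffAt_comp_symm fun q hq => hβ₁Y q hq.1, fun q hq => ?_, fun q hq => ?_⟩
  · change 0 < c' p
    rw [hcp]
    exact one_pos
  · exact (e'.map_target hz).2.2
  · change _ = c' (e.symm (e q)) • area e q
    rw [hl q hq]
    exact hceq q hq.1
  · change _ = P' (e.symm (e q)) • cov (dx e q) + (x q ^ m * Q' (e.symm (e q))) • cov (dy e q)
    rw [hl q hq, hdx q hq.1, wedge_zero_eq, (he.dualBases hq.1).eq_cov (β₁ q), smul_add, smul_smul,
      smul_smul, ← add_assoc, ← add_smul]

theorem Critical.isClosed_Z (B : Critical S) : IsClosed B.Z := by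
  have : B.Z = B.dist ⁻¹' {0} := by
    ext p
    simp [B.dist_eq_zero_iff]
  rw [this]
  exact isClosed_singleton.preimage B.continuous_dist

/-- Around every point there is an adapted chart in which a given `b^m`-symplectic form and a given
`b^m`-form of degree one have smooth coefficients. -/
theorem exists_adapted_chart [IsManifold (𝓡 2) ∞ S] {m : ℕ} (hm : 1 ≤ m) {B : Critical S}
    {η : FormField S 2} (hη : IsBmSymplectic m B η) {α : FormField S 1} (hα : IsBmForm m B α)
    (p : S) : ∃ (e : OpenPartialHomeomorph S (ℝ × ℝ)) (c P Q : ℝ × ℝ → ℝ), p ∈ e.source ∧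
      BChart B e ∧ IsDensity m B e η c ∧ IsCoeff m B e α P Q := by
  by_cases hp : p ∈ B.Z
  · obtain ⟨U, x, A, β₂, hpU, hdec, hnd⟩ := hη.nondegenerate_on p hp
    obtain ⟨U', x', g, β₁, hpU', hdec'⟩ := hα.2 p hp
    have hx := hdec.isDefining
    have hx' := hdec'.isDefining
    obtain ⟨σ, hσ, hev⟩ := hx.eventually_eq hx' hpU hpU' hp
    obtain ⟨W, hW, hWo, hpW⟩ := mem_nhds_iff.1
      (hev.and (Filter.inter_mem (hx.isOpen.mem_nhds hpU) (hx'.isOpen.mem_nhds hpU')))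
    have hWU : W ⊆ U := fun q hq => (hW hq).2.1
    have hWU' : W ⊆ U' := fun q hq => (hW hq).2.2
    have hxW := hx.mono hWo hWU
    have hxp : x p = 0 := (hx.eq_zero_iff hpU).2 hp
    obtain ⟨e, c, P, Q, he, hpe, heW, hex, hey, hc, hc0, hP, hQ, hceq, hαeq⟩ :=
      exists_chart_coeff m (g := fun q => σ ^ (m + 1) • g q) hWo hpW hxW.smooth
        (hxW.dFun_ne_zero p hpW) (hdec.smooth_left.mono hWU) (hdec'.smooth_right.mono hWU')
        (hdec.smooth_right.mono hWU) ((hdec'.smooth_left.mono hWU').const_smul _)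
        (by rwa [hxp, zero_pow (by omega), zero_smul, add_zero])
    have hx0 : ∀ q ∈ e.source, q ∉ B.Z → x q ≠ 0 := fun q hq hqZ h =>
      hqZ ((hx.eq_zero_iff (hWU (heW hq))).1 h)
    refine ⟨e, c, P, Q, hpe, ⟨he, fun q hq => ?_, hey, Or.inl fun q hq => ?_⟩, ⟨hc, hc0, ?_⟩,
      ⟨hP, hQ, ?_⟩⟩
    · rw [hex q hq, hx.eq_zero_iff (hWU (heW hq))]
    · rw [hex q hq, hx.abs_eq q (hWU (heW hq))]
    · intro q hq hqZ
      have := hx0 q hq hqZ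
      rw [hdec.eq q (hWU (heW hq)) hqZ, hex q hq, mul_comm, mul_smul, ← hceq q hq, smul_add,
        smul_smul, inv_mul_cancel₀ (pow_ne_zero m this), one_smul]
    · intro q hq hqZ
      have := hx0 q hq hqZ
      have hxm := pow_ne_zero m this
      have hdx' : dFun x' q = σ • dFun x q := by
        rw [← dFun_const_mul (hx.mdifferentiableAt (hWU (heW hq)))]
        refine dFun_congr ?_
        filter_upwards [hWo.mem_nhds (heW hq)] with w hw using (hW hw).1
      have hxq : x' q = σ * x q := (hW (heW hq)).1
      have hσm : (σ ^ m)⁻¹ = σ ^ m := by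
        rcases hσ with rfl | rfl
        · simp
        · rw [← inv_pow]
          norm_num
      have h1 : α q = (x q ^ m)⁻¹ • (wedge (dFun x q) (σ ^ (m + 1) • g q) + x q ^ m • β₁ q) := by
        rw [hdec'.eq q (hWU' (heW hq)) hqZ, hdx', wedge_smul_left, hxq, wedge_smul_right, smul_add,
          smul_smul, smul_smul, smul_smul, inv_mul_cancel₀ hxm, one_smul, mul_pow, mul_inv, hσm]
        congr 2
        ring
      rw [h1, hαeq q hq, hex q hq, smul_add, smul_smul, smul_smul, ← mul_assoc,
        inv_mul_cancel₀ hxm, one_mul, mul_comm]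
  -- Off the critical set, any positive function with nonzero differential serves as `x`.
  · set ℓ : Plane → ℝ := fun w => 1 + EuclideanSpace.proj (0 : Fin 2) (w - chartAt Plane p p)
    have hℓ : ContDiff ℝ ∞ ℓ := by fun_prop
    set x : S → ℝ := fun q => ℓ (chartAt Plane p q)
    set V := (chartAt Plane p).source
    have hVx : ContMDiffOn (𝓡 2) 𝓘(ℝ, ℝ) ∞ x V := hℓ.contMDiff.comp_contMDiffOn contMDiffOn_chart
    have hV : IsOpen (V ∩ x ⁻¹' Ioi 0) :=
      hVx.continuousOn.isOpen_inter_preimage (chartAt Plane p).open_source isOpen_Ioi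
    set W := (V ∩ x ⁻¹' Ioi 0) ∩ B.Zᶜ
    have hWo : IsOpen W := hV.inter B.isClosed_Z.isOpen_compl
    have hxp : x p = 1 := by simp [x, ℓ]
    have hpW : p ∈ W := ⟨⟨mem_chart_source _ p, by simp [hxp]⟩, hp⟩
    have hdxp : dFun x p ≠ 0 := by
      have h1 : dFun x p = EuclideanSpace.proj (0 : Fin 2) := by
        refine (dFun_comp_chartAt (hℓ.differentiable (by simp) _)).trans ?_
        have h2 := HasFDerivAt.comp (g := (EuclideanSpace.proj (0 : Fin 2) : Plane →L[ℝ] ℝ))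
          (f := fun w => w - chartAt Plane p p) (chartAt Plane p p)
          (ContinuousLinearMap.hasFDerivAt _)
          ((hasFDerivAt_id (chartAt Plane p p)).sub_const (chartAt Plane p p))
        exact (h2.const_add 1).fderiv
      intro h0
      have := dualBases_standard.aX
      rw [← h1, h0] at this
      simp at this
    obtain ⟨e, c, P, Q, he, hpe, heW, hex, hey, hc, hc0, hP, hQ, hceq, hαeq⟩ :=
      exists_chart_coeff m (A := 0) (g := 0) hWo hpW (hVx.mono fun q hq => hq.1.1) hdxp
        (smoothFormOn_zero _ _) (hα.1.mono fun q hq => hq.2)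
        (hη.isBmForm.1.mono fun q hq => hq.2) (smoothFormOn_zero _ _) (by
          rw [hxp, one_pow, one_smul, Pi.zero_apply, ← zero_smul ℝ (0 : Plane [⋀^Fin 1]→L[ℝ] ℝ),
            wedge_smul_right, zero_smul, zero_add]
          exact hη.nondegenerate_off p hp)
    have hx0 : ∀ q ∈ e.source, x q ≠ 0 := fun q hq => (heW hq).1.2.ne'
    have hw0 : ∀ {k : ℕ} (a : Plane →L[ℝ] ℝ), wedge a (0 : Plane [⋀^Fin k]→L[ℝ] ℝ) = 0 := by
      intro k a
      have := wedge_smul_right 0 a (0 : Plane [⋀^Fin k]→L[ℝ] ℝ)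
      simpa using this
    refine ⟨e, c, P, Q, hpe, ⟨he, fun q hq => ?_, hey, Or.inr fun q hq => (heW hq).2⟩,
      ⟨hc, hc0, ?_⟩, ⟨hP, hQ, ?_⟩⟩
    · rw [hex q hq]
      exact iff_of_false (heW hq).2 (hx0 q hq)
    · intro q hq _
      have h1 := hceq q hq
      rw [Pi.zero_apply, hw0, zero_add (x q ^ m • η q)] at h1
      rw [hex q hq, mul_comm, mul_smul, ← h1, smul_smul,
        inv_mul_cancel₀ (pow_ne_zero m (hx0 q hq)), one_smul]
    · intro q hq _
      have h1 := hαeq q hq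
      have hxm := pow_ne_zero m (hx0 q hq)
      rw [Pi.zero_apply, hw0, zero_add (x q ^ m • α q)] at h1
      have h2 : α q = (x q ^ m)⁻¹ • (x q ^ m • α q) := by
        rw [smul_smul, inv_mul_cancel₀ hxm, one_smul]
      rw [h2, h1, hex q hq, smul_add, smul_smul, smul_smul, ← mul_assoc,
        inv_mul_cancel₀ hxm, one_mul, mul_comm]

end Coeff

/-! ### The exterior derivative of a `b^m`-one-form as a multiple of a `b^m`-symplectic form -/

section Decomposition

variable {S : Type*} [TopologicalSpace S] [ChartedSpace Plane S]
  {e : OpenPartialHomeomorph S (ℝ × ℝ)} {m : ℕ} {B : Critical S}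
  {η : FormField S 2} {c : ℝ × ℝ → ℝ}

theorem BChart.fst_ne_zero (he : BChart B e) {q : S} (hq : q ∈ e.source) (hqZ : q ∉ B.Z) :
    (e q).1 ≠ 0 := fun h => hqZ ((he.mem_Z q hq).2 h)

theorem wedge₁_dFun_dy (he : BChart B e) (hc : IsDensity m B e η c) {q : S} (hq : q ∈ e.source)
    (hqZ : q ∉ B.Z) {Q : ℝ × ℝ → ℝ} (hQ : DifferentiableAt ℝ Q (e q)) :
    wedge₁ (dFun (fun q => Q (e q)) q) (dy e q) = ratioX m e c Q q • η q := by
  have hx := pow_ne_zero m (he.fst_ne_zero hq hqZ)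
  have hcq := (hc.pos _ (e.map_source hq)).ne'
  rw [hc.eq q hq hqZ, smul_smul, ratioX, if_pos hq, he.dFun_comp hq hQ]
  ext v
  simp only [wedge₁_apply, area, add_apply, smul_apply, ContinuousAlternatingMap.smul_apply,
    smul_eq_mul]
  field_simp
  ring

theorem wedge₁_dFun_dx (he : BChart B e) (hc : IsDensity m B e η c) {q : S} (hq : q ∈ e.source)
    (hqZ : q ∉ B.Z) {P : ℝ × ℝ → ℝ} (hP : DifferentiableAt ℝ P (e q)) :
    wedge₁ (dFun (fun q => P (e q) * ((e q).1 ^ m)⁻¹) q) (dx e q) = ratioY e c P q • η q := by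
  have hx0 := he.fst_ne_zero hq hqZ
  have hx := pow_ne_zero m hx0
  have hcq := (hc.pos _ (e.map_source hq)).ne'
  have hinv : HasFDerivAt (fun z : ℝ × ℝ => (z.1 ^ m)⁻¹)
      (deriv (fun t : ℝ => (t ^ m)⁻¹) (e q).1 • ContinuousLinearMap.fst ℝ ℝ ℝ) (e q) := by
    have h1 : DifferentiableAt ℝ (fun t : ℝ => (t ^ m)⁻¹) (e q).1 :=
      (differentiableAt_pow m).inv hx
    exact h1.hasDerivAt.comp_hasFDerivAt (e q) hasFDerivAt_fst
  have hF := hP.hasFDerivAt.fun_mul hinv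
  rw [hc.eq q hq hqZ, smul_smul, ratioY, if_pos hq,
    he.dFun_comp (F := fun z => P z * (z.1 ^ m)⁻¹) hq hF.differentiableAt, hF.fderiv]
  ext v
  simp only [wedge₁_apply, area, add_apply, smul_apply, ContinuousAlternatingMap.smul_apply,
    smul_eq_mul, ContinuousLinearMap.coe_fst']
  field_simp
  ring

theorem contMDiff_of_chart {K : Set (ℝ × ℝ)} {f : S → ℝ}
    (hK : IsClosed (e.symm '' K)) (hKe : K ⊆ e.target) (hf : ∀ q ∉ e.symm '' K, f q = 0)
    (hfe : ∀ q ∈ e.source, ContMDiffAt (𝓡 2) 𝓘(ℝ, ℝ) ∞ f q) : ContMDiff (𝓡 2) 𝓘(ℝ, ℝ) ∞ f := by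
  intro q
  by_cases hq : q ∈ e.source
  · exact hfe q hq
  · have hqK : q ∉ e.symm '' K := by
      rintro ⟨z, hz, rfl⟩
      exact hq (e.map_target (hKe hz))
    refine (contMDiffAt_const (c := (0 : ℝ))).congr_of_eventuallyEq ?_
    filter_upwards [hK.isOpen_compl.mem_nhds hqK] with w hw using hf w hw

theorem SmoothChart.contMDiffAt_comp (he : SmoothChart e) {q : S} (hq : q ∈ e.source)
    {F : ℝ × ℝ → ℝ} (hF : ContDiffAt ℝ ∞ F (e q)) :
    ContMDiffAt (𝓡 2) 𝓘(ℝ, ℝ) ∞ (fun q => F (e q)) q :=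
  hF.contMDiffAt.comp q (he.smooth.contMDiffAt (e.open_source.mem_nhds hq))

theorem notMem_tsupport_of_notMem_image {M : Type*} [TopologicalSpace M]
    {e : OpenPartialHomeomorph M (ℝ × ℝ)} {Q : ℝ × ℝ → ℝ} {q : M}
    (hq : q ∈ e.source) (h : q ∉ e.symm '' tsupport Q) : e q ∉ tsupport Q :=
  fun h' => h ⟨_, h', e.left_inv hq⟩

theorem contMDiff_ratioX [T2Space S] (he : SmoothChart e) (hc : IsDensity m B e η c)
    {Q : ℝ × ℝ → ℝ} (hQ : ContDiff ℝ ∞ Q) (hQc : HasCompactSupport Q)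
    (hQe : tsupport Q ⊆ e.target) : ContMDiff (𝓡 2) 𝓘(ℝ, ℝ) ∞ (ratioX m e c Q) := by
  refine contMDiff_of_chart (isClosed_symm_image hQc.isCompact hQe) hQe (fun q hq => ?_)
    fun q hq => ?_
  · unfold ratioX
    split_ifs with h
    · rw [fderiv_eq_zero_of_notMem_tsupport (notMem_tsupport_of_notMem_image h hq)]
      simp
    · rfl
  · have hz := e.map_source hq
    have h1 : ContDiffAt ℝ ∞ (fun z : ℝ × ℝ => z.1 ^ m * fderiv ℝ Q z (1, 0) / c z) (e q) :=
      ((contDiffAt_fst.pow m).mul ((hQ.fderiv_right (m := ∞) (by simp)).contDiffAt.clm_apply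
        contDiffAt_const)).div (hc.smooth _ hz) (hc.pos _ hz).ne'
    refine (he.contMDiffAt_comp hq h1).congr_of_eventuallyEq ?_
    filter_upwards [e.open_source.mem_nhds hq] with w hw
    rw [ratioX, if_pos hw]

theorem contMDiff_ratioY [T2Space S] (he : SmoothChart e) (hc : IsDensity m B e η c)
    {P : ℝ × ℝ → ℝ} (hP : ContDiff ℝ ∞ P) (hPc : HasCompactSupport P)
    (hPe : tsupport P ⊆ e.target) : ContMDiff (𝓡 2) 𝓘(ℝ, ℝ) ∞ (ratioY e c P) := by
  refine contMDiff_of_chart (isClosed_symm_image hPc.isCompact hPe) hPe (fun q hq => ?_)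
    fun q hq => ?_
  · unfold ratioY
    split_ifs with h
    · rw [fderiv_eq_zero_of_notMem_tsupport (notMem_tsupport_of_notMem_image h hq)]
      simp
    · rfl
  · have hz := e.map_source hq
    have h1 : ContDiffAt ℝ ∞ (fun z : ℝ × ℝ => - fderiv ℝ P z (0, 1) / c z) (e q) :=
      (((hP.fderiv_right (m := ∞) (by simp)).contDiffAt.clm_apply
        contDiffAt_const)).neg.div (hc.smooth _ hz) (hc.pos _ hz).ne'
    refine (he.contMDiffAt_comp hq h1).congr_of_eventuallyEq ?_
    filter_upwards [e.open_source.mem_nhds hq] with w hw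
    rw [ratioY, if_pos hw]

/-- The product of a function on the chart domain with a smooth function on the surface that is
supported there, as a function on `ℝ × ℝ`. -/
theorem exists_localized [T2Space S] [CompactSpace S] (he : SmoothChart e) {ρ : S → ℝ}
    (hρ : ContMDiff (𝓡 2) 𝓘(ℝ, ℝ) ∞ ρ) (hρe : tsupport ρ ⊆ e.source) {P : ℝ × ℝ → ℝ}
    (hP : ∀ z ∈ e.target, ContDiffAt ℝ ∞ P z) :
    ∃ P' : ℝ × ℝ → ℝ, ContDiff ℝ ∞ P' ∧ HasCompactSupport P' ∧ tsupport P' ⊆ e.target ∧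
      ∀ q ∈ e.source, P' (e q) = ρ q * P (e q) := by
  classical
  set P' : ℝ × ℝ → ℝ := fun z => if z ∈ e.target then ρ (e.symm z) * P z else 0
  set C := e '' tsupport ρ
  have hC : IsCompact C :=
    (isClosed_tsupport ρ).isCompact.image_of_continuousOn (e.continuousOn.mono hρe)
  have hCe : C ⊆ e.target := by
    rintro _ ⟨q, hq, rfl⟩
    exact e.map_source (hρe hq)
  have h0 : ∀ z ∉ C, P' z = 0 := by
    intro z hz
    simp only [P']
    split_ifs with h
    · have : e.symm z ∉ tsupport ρ := fun h' => hz ⟨_, h', e.right_inv h⟩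
      rw [image_eq_zero_of_notMem_tsupport this, zero_mul]
    · rfl
  have hts : tsupport P' ⊆ C := closure_minimal (fun z hz => by_contra fun h => hz (h0 z h))
    hC.isClosed
  refine ⟨P', ?_, HasCompactSupport.of_support_subset_isCompact hC
    (fun z hz => by_contra fun h => hz (h0 z h)), hts.trans hCe, fun q hq => ?_⟩
  · rw [contDiff_iff_contDiffAt]
    intro z
    by_cases hz : z ∈ e.target
    · have h1 := he.contDiffAt_comp_symm (fun q _ => hρ.contMDiffAt (x := q)) z hz
      refine (h1.mul (hP z hz)).congr_of_eventuallyEq ?_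
      filter_upwards [e.open_target.mem_nhds hz] with w hw
      simp only [P', if_pos hw]
      rfl
    · refine (contDiffAt_const (c := (0 : ℝ))).congr_of_eventuallyEq ?_
      filter_upwards [hC.isClosed.isOpen_compl.mem_nhds fun h => hz (hCe h)] with w hw
      exact h0 w hw
  · simp only [P', if_pos (e.map_source hq), e.left_inv hq]

/-- Finitely many adapted charts covering the surface, a subordinate partition of unity `ρ`, and
the coefficients `P`, `Q` of the pieces `ρ_i α` of a `b^m`-one-form. -/
structure Atlas (m : ℕ) (B : Critical S) (η : FormField S 2) (α : FormField S 1)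
    (ι : Type*) [Fintype ι] where
  /-- the charts -/
  e : ι → OpenPartialHomeomorph S (ℝ × ℝ)
  /-- the densities of `η` -/
  c : ι → ℝ × ℝ → ℝ
  /-- the partition of unity -/
  ρ : ι → S → ℝ
  /-- the coefficients of `x^{-m} dx` -/
  P : ι → ℝ × ℝ → ℝ
  /-- the coefficients of `dy` -/
  Q : ι → ℝ × ℝ → ℝ
  chart : ∀ i, BChart B (e i)
  density : ∀ i, IsDensity m B (e i) η (c i)
  continuous_ρ : ∀ i, Continuous (ρ i)
  ρ_nonneg : ∀ i q, 0 ≤ ρ i q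
  sum_ρ : ∀ q, ∑ i, ρ i q = 1
  tsupport_ρ : ∀ i, tsupport (ρ i) ⊆ (e i).source
  contDiff_P : ∀ i, ContDiff ℝ ∞ (P i)
  compact_P : ∀ i, HasCompactSupport (P i)
  tsupport_P : ∀ i, tsupport (P i) ⊆ (e i).target
  contDiff_Q : ∀ i, ContDiff ℝ ∞ (Q i)
  compact_Q : ∀ i, HasCompactSupport (Q i)
  tsupport_Q : ∀ i, tsupport (Q i) ⊆ (e i).target
  sum_eq : ∀ i, ∀ q ∈ (e i).source, q ∉ B.Z → ρ i q • α q =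
    (P i (e i q) * ((e i q).1 ^ m)⁻¹) • cov (dx (e i) q) + Q i (e i q) • cov (dy (e i) q)

theorem exists_atlas [T2Space S] [CompactSpace S] [IsManifold (𝓡 2) ∞ S] (hm : 1 ≤ m)
    (hη : IsBmSymplectic m B η) {α : FormField S 1} (hα : IsBmForm m B α) :
    ∃ t : Finset S, Nonempty (Atlas m B η α t) := by
  choose e c P Q hpe he hc hPQ using fun p => exists_adapted_chart hm hη hα p
  obtain ⟨t, ht⟩ := isCompact_univ.elim_nhds_subcover (fun p => (e p).source)
    (fun p _ => (e p).open_source.mem_nhds (hpe p))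
  obtain ⟨ρ, hρ⟩ := SmoothPartitionOfUnity.exists_isSubordinate (𝓡 2) (isClosed_univ (X := S))
    (fun i : t => (e i).source) (fun i => (e i).open_source) (by
      intro q hq
      obtain ⟨p, hp, hqp⟩ := mem_iUnion₂.1 (ht.2 hq)
      exact mem_iUnion.2 ⟨⟨p, hp⟩, hqp⟩)
  choose P' hP' hPc hPe hPρ using fun i : t =>
    exists_localized (he i).toSmoothChart (ρ i).contMDiff (hρ i) (hPQ i).smooth_left
  choose Q' hQ' hQc hQe hQρ using fun i : t =>
    exists_localized (he i).toSmoothChart (ρ i).contMDiff (hρ i) (hPQ i).smooth_right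
  refine ⟨t, ⟨⟨fun i => e i, fun i => c i, fun i => ρ i, P', Q', fun i => he i, fun i => hc i,
    fun i => (ρ i).contMDiff.continuous, fun i q => ρ.nonneg i q, fun q => ?_, hρ, hP', hPc, hPe,
    hQ', hQc, hQe, fun i q hq hqZ => ?_⟩⟩⟩
  · rw [← finsum_eq_sum_of_fintype]
    exact ρ.sum_eq_one (mem_univ q)
  · rw [(hPQ i).eq q hq hqZ, hPρ i q hq, hQρ i q hq, smul_add, smul_smul, smul_smul, mul_assoc]

namespace Atlas

variable {α : FormField S 1} {ι : Type*} [Fintype ι] (A : Atlas m B η α ι)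

/-- The quotient of `d(ρ_i α)` by `η`. -/
def ratio (i : ι) (q : S) : ℝ :=
  ratioX m (A.e i) (A.c i) (A.Q i) q + ratioY (A.e i) (A.c i) (A.P i) q

theorem ρ_eq_zero (i : ι) {q : S} (hq : q ∉ (A.e i).source) : A.ρ i q = 0 :=
  image_eq_zero_of_notMem_tsupport fun h => hq (A.tsupport_ρ i h)

/-- The exterior derivative of the whole form is the sum of those of its pieces `ρ_i α`. -/
theorem extD_eq [IsManifold (𝓡 2) ∞ S] {q : S} (hqZ : q ∉ B.Z) :
    extD α q = (∑ i, A.ratio i q) • η q := by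
  classical
  set s := Finset.univ.filter fun i => q ∈ (A.e i).source
  have hs : ∀ i ∈ s, q ∈ (A.e i).source := fun i hi => (Finset.mem_filter.1 hi).2
  have hs' : ∀ i ∉ s, q ∉ (A.e i).source := fun i hi h =>
    hi (Finset.mem_filter.2 ⟨Finset.mem_univ i, h⟩)
  have hd : ∀ i ∈ s, DifferentiableAt ℝ (fun z : ℝ × ℝ => A.P i z * (z.1 ^ m)⁻¹) (A.e i q) := by
    intro i hi
    refine ((A.contDiff_P i).differentiable (by simp) _).mul (DifferentiableAt.inv (by fun_prop) ?_)
    exact pow_ne_zero m ((A.chart i).fst_ne_zero (hs i hi) hqZ)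
  have hmd : ∀ i ∈ s, ∀ {F : ℝ × ℝ → ℝ}, DifferentiableAt ℝ F (A.e i q) →
      MDifferentiableAt (𝓡 2) 𝓘(ℝ, ℝ) (fun q => F (A.e i q)) q := fun i hi F hF =>
    MDifferentiableAt.comp q hF.mdifferentiableAt ((A.chart i).mdifferentiableAt (hs i hi))
  have hsm : ∀ i ∈ s, ∀ {F : ℝ × ℝ → ℝ}, ContDiff ℝ ∞ F →
      ∀ᶠ q' in 𝓝 q, ContMDiffAt (𝓡 2) 𝓘(ℝ, ℝ) ∞ (fun q => F (A.e i q)) q' := by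
    intro i hi F hF
    filter_upwards [(A.e i).open_source.mem_nhds (hs i hi)] with w hw
    exact (A.chart i).contMDiffAt_comp hw hF.contDiffAt
  rw [extD_eq_sum (s.disjSum s)
    (a := Sum.elim (fun i q => A.P i (A.e i q) * ((A.e i q).1 ^ m)⁻¹) fun i q => A.Q i (A.e i q))
    (b := Sum.elim (fun i q => (A.e i q).1) fun i q => (A.e i q).2)]
  · rw [Finset.sum_disjSum, Finset.sum_smul]
    simp only [Sum.elim_inl, Sum.elim_inr]
    rw [← Finset.sum_add_distrib]
    refine Finset.sum_subset_zero_on_sdiff (Finset.subset_univ _) (fun i hi => ?_) fun i hi => ?_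
    · have hi := hs' i (Finset.mem_sdiff.1 hi).2
      rw [ratio, ratioX, ratioY, if_neg hi, if_neg hi, add_zero, zero_smul]
    · rw [ratio, add_smul]
      exact (add_comm _ _).trans (congrArg₂ (· + ·)
        (wedge₁_dFun_dy (A.chart i) (A.density i) (hs i hi) hqZ
          ((A.contDiff_Q i).differentiable (by simp) _))
        (wedge₁_dFun_dx (A.chart i) (A.density i) (hs i hi) hqZ
          ((A.contDiff_P i).differentiable (by simp) _)))
  · rintro (i | i) hi
    · have hi := Finset.inl_mem_disjSum.1 hi
      exact hmd i hi (hd i hi)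
    · have hi := Finset.inr_mem_disjSum.1 hi
      exact hmd i hi ((A.contDiff_Q i).differentiable (by simp) _)
  · rintro (i | i) hi
    · exact hsm i (Finset.inl_mem_disjSum.1 hi) contDiff_fst
    · exact hsm i (Finset.inr_mem_disjSum.1 hi) contDiff_snd
  · have h1 : ∀ᶠ q' in 𝓝 q, ∀ i ∈ s, q' ∈ (A.e i).source :=
      (Filter.eventually_all_finset s).2 fun i hi => (A.e i).open_source.mem_nhds (hs i hi)
    have h2 : ∀ᶠ q' in 𝓝 q, ∀ i ∈ sᶜ, A.ρ i q' = 0 := by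
      refine (Filter.eventually_all_finset sᶜ).2 fun i hi => ?_
      have : q ∉ tsupport (A.ρ i) := fun h => hs' i (Finset.mem_compl.1 hi) (A.tsupport_ρ i h)
      filter_upwards [(isClosed_tsupport _).isOpen_compl.mem_nhds this] with w hw
      exact image_eq_zero_of_notMem_tsupport hw
    filter_upwards [h1, h2, B.isClosed_Z.isOpen_compl.mem_nhds hqZ] with w hw1 hw2 hwZ
    rw [Finset.sum_disjSum]
    simp only [Sum.elim_inl, Sum.elim_inr]
    rw [← Finset.sum_add_distrib, ← one_smul ℝ (α w), ← A.sum_ρ w, Finset.sum_smul]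
    symm
    refine Finset.sum_subset_zero_on_sdiff (Finset.subset_univ _) (fun i hi => ?_) fun i hi => ?_
    · rw [hw2 i (Finset.mem_compl.2 (Finset.mem_sdiff.1 hi).2), zero_smul]
    · exact (A.sum_eq i w (hw1 i hi) hwZ).symm

theorem contMDiff_ratio [T2Space S] (i : ι) : ContMDiff (𝓡 2) 𝓘(ℝ, ℝ) ∞ (A.ratio i) :=
  (contMDiff_ratioX (A.chart i).toSmoothChart (A.density i) (A.contDiff_Q i) (A.compact_Q i)
    (A.tsupport_Q i)).add (contMDiff_ratioY (A.chart i).toSmoothChart (A.density i)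
    (A.contDiff_P i) (A.compact_P i) (A.tsupport_P i))

end Atlas

end Decomposition

/-! ### Comparison of two densities -/

section Compare

theorem det_prod (L : ℝ × ℝ →L[ℝ] ℝ × ℝ) :
    L.det = (L (1, 0)).1 * (L (0, 1)).2 - (L (0, 1)).1 * (L (1, 0)).2 := by
  rw [ContinuousLinearMap.det, ← LinearMap.det_toMatrix (Module.Basis.finTwoProd ℝ),
    Matrix.det_fin_two]
  simp [LinearMap.toMatrix_apply]

variable {S : Type*} [TopologicalSpace S] [ChartedSpace Plane S]
  {e e' : OpenPartialHomeomorph S (ℝ × ℝ)} {m : ℕ} {B : Critical S}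
  {η η' : FormField S 2} {c c' : ℝ × ℝ → ℝ}

theorem SmoothChart.contDiffAt_transition (he : SmoothChart e) (he' : SmoothChart e') {z : ℝ × ℝ}
    (hz : z ∈ e.target) (hz' : e.symm z ∈ e'.source) : ContDiffAt ℝ ∞ (e' ∘ e.symm) z :=
  ((he'.smooth.contMDiffAt (e'.open_source.mem_nhds hz')).comp z
    (he.smooth_symm.contMDiffAt (e.open_target.mem_nhds hz))).contDiffAt

theorem SmoothChart.area_eq_det (he : SmoothChart e) (he' : SmoothChart e') {q : S}
    (hq : q ∈ e.source) (hq' : q ∈ e'.source) :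
    area e' q = (fderiv ℝ (e' ∘ e.symm) (e q)).det • area e q := by
  have hz := e.map_source hq
  have hz' : e.symm (e q) ∈ e'.source := by rwa [e.left_inv hq]
  have hτ : DifferentiableAt ℝ (e' ∘ e.symm) (e q) :=
    (he.contDiffAt_transition he' hz hz').differentiableAt (by simp)
  have h1 : dx e' q = dFun (fun q => ((e' ∘ e.symm) (e q)).1) q := by
    refine dFun_congr ?_
    filter_upwards [e.open_source.mem_nhds hq] with w hw
    simp [e.left_inv hw]
  have h2 : dy e' q = dFun (fun q => ((e' ∘ e.symm) (e q)).2) q := by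
    refine dFun_congr ?_
    filter_upwards [e.open_source.mem_nhds hq] with w hw
    simp [e.left_inv hw]
  have h3 := he.dFun_comp hq (F := fun z => ((e' ∘ e.symm) z).1) hτ.fst
  have h4 := he.dFun_comp hq (F := fun z => ((e' ∘ e.symm) z).2) hτ.snd
  rw [area, h1, h2, h3, h4, fderiv.fst hτ, fderiv.snd hτ, det_prod]
  ext v
  simp only [wedge₁_apply, area, add_apply, smul_apply, ContinuousAlternatingMap.smul_apply,
    smul_eq_mul, ContinuousLinearMap.comp_apply, ContinuousLinearMap.coe_fst',
    ContinuousLinearMap.coe_snd']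
  ring

/-- The transformation law of densities: in two charts, they differ by the Jacobian determinant of
the transition map. -/
theorem IsDensity.det_mul (he : SmoothChart e) (he' : SmoothChart e') (hc : IsDensity m B e η c)
    (hc' : IsDensity m B e' η' c') {q : S} (hq : q ∈ e.source) (hq' : q ∈ e'.source)
    (hqZ : q ∉ B.Z) {r : ℝ} (hr : η' q = r • η q) :
    (fderiv ℝ (e' ∘ e.symm) (e q)).det * (c' (e' q) * ((e' q).1 ^ m)⁻¹) =
      r * (c (e q) * ((e q).1 ^ m)⁻¹) := by
  rw [hc.eq q hq hqZ, hc'.eq q hq' hqZ, he.area_eq_det he' hq hq', smul_smul, smul_smul] at hr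
  rw [mul_comm]
  exact smul_left_injective ℝ (he.area_ne_zero hq) hr

/-- The critical set has no interior points. -/
theorem BChart.neBot_nhdsWithin (he : BChart B e) {p : S} (hp : p ∈ e.source) :
    (𝓝[B.Zᶜ] p).NeBot := by
  rw [← mem_closure_iff_nhdsWithin_neBot]
  by_cases hpZ : p ∈ B.Z
  swap
  · exact subset_closure hpZ
  have h0 := (he.mem_Z p hp).1 hpZ
  have hz := e.map_source hp
  have hcont : Filter.Tendsto (fun t : ℝ => e.symm (t, (e p).2)) (𝓝[≠] 0) (𝓝 p) := by
    have h1 : ContinuousAt e.symm (e p) := e.continuousAt_symm hz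
    have h2 : ContinuousAt (fun t : ℝ => (t, (e p).2)) 0 := by fun_prop
    have h3 : ((0 : ℝ), (e p).2) = e p := Prod.ext h0.symm rfl
    have h4 : ContinuousAt (fun t : ℝ => e.symm (t, (e p).2)) 0 :=
      ContinuousAt.comp (g := e.symm) (by rwa [h3]) h2
    have h5 := h4.tendsto
    rw [h3, e.left_inv hp] at h5
    exact h5.mono_left nhdsWithin_le_nhds
  refine mem_closure_of_tendsto hcont ?_
  have h6 : ∀ᶠ t in 𝓝 (0 : ℝ), (t, (e p).2) ∈ e.target := by
    refine (show Continuous fun t : ℝ => (t, (e p).2) by fun_prop).continuousAt.eventually_mem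
      (e.open_target.mem_nhds ?_)
    rwa [show ((0 : ℝ), (e p).2) = e p from Prod.ext h0.symm rfl]
  filter_upwards [h6.filter_mono nhdsWithin_le_nhds, self_mem_nhdsWithin] with t ht ht0 htZ
  have := (he.mem_Z _ (e.map_target ht)).1 htZ
  rw [e.right_inv ht] at this
  exact ht0 this

/-- Continuous functions that agree near a point outside the critical set agree at the point. -/
theorem BChart.eq_of_eventually (he : BChart B e) {p : S} (hp : p ∈ e.source) {f g : S → ℝ}
    (hf : ContinuousAt f p) (hg : ContinuousAt g p) (h : ∀ᶠ q in 𝓝 p, q ∉ B.Z → f q = g q) :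
    f p = g p := by
  have := he.neBot_nhdsWithin hp
  refine tendsto_nhds_unique_of_eventuallyEq (hf.tendsto.mono_left nhdsWithin_le_nhds)
    (hg.tendsto.mono_left nhdsWithin_le_nhds) (l := 𝓝[B.Zᶜ] p) ?_
  filter_upwards [h.filter_mono nhdsWithin_le_nhds, self_mem_nhdsWithin] with q hq hqZ
  exact hq hqZ

/-- The quotient of two `b^m`-symplectic forms has no zeros on the critical set. -/
theorem IsBmSymplectic.ratio_ne_zero [IsManifold (𝓡 2) ∞ S] (hm : 1 ≤ m)
    (hη : IsBmSymplectic m B η) (hη' : IsBmSymplectic m B η') {α : FormField S 1}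
    (hα : IsBmForm m B α) {f : S → ℝ} (hf : Continuous f) (hff : ∀ q ∉ B.Z, η' q = f q • η q)
    {p : S} (hp : p ∈ B.Z) : f p ≠ 0 := by
  obtain ⟨e, c, -, -, hpe, he, hc, -⟩ := exists_adapted_chart hm hη hα p
  obtain ⟨e', c', -, -, hpe', he', hc', -⟩ := exists_adapted_chart hm hη' hα p
  have hx := he.isDefining hpe hp
  have hx' := he'.isDefining hpe' hp
  set J : S → ℝ := fun q => (fderiv ℝ (e' ∘ e.symm) (e q)).det
  have hz := e.map_source hpe
  have hz' : e.symm (e p) ∈ e'.source := by rwa [e.left_inv hpe]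
  have hJ : ContinuousAt J p := by
    have h1 := (he.contDiffAt_transition he'.toSmoothChart hz hz').fderiv_right (m := 0)
      (by norm_num)
    exact ContinuousLinearMap.continuous_det.continuousAt.comp
      (h1.continuousAt.comp (e.continuousAt hpe))
  have hJ0 : J p ≠ 0 := by
    intro h
    have := he.area_eq_det he'.toSmoothChart hpe hpe'
    rw [show (fderiv ℝ (e' ∘ e.symm) (e p)).det = 0 from h, zero_smul] at this
    exact he'.area_ne_zero hpe' this
  have hcc : ContinuousAt (fun q => c (e q)) p :=
    (hc.smooth _ hz).continuousAt.comp (e.continuousAt hpe)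
  have hcc' : ContinuousAt (fun q => c' (e' q)) p :=
    (hc'.smooth _ (e'.map_source hpe')).continuousAt.comp (e'.continuousAt hpe')
  have key : |J p| * c' (e' p) = |f p| * c (e p) := by
    refine he.eq_of_eventually hpe (f := fun q => |J q| * c' (e' q))
      (g := fun q => |f q| * c (e q)) (hJ.abs.mul hcc') (hf.continuousAt.abs.mul hcc) ?_
    filter_upwards [e.open_source.mem_nhds hpe, e'.open_source.mem_nhds hpe'] with q hq hq' hqZ
    -- The two defining functions may differ by a sign, so that only absolute values are compared.
    have h1 := congrArg abs (hc.det_mul he.toSmoothChart he'.toSmoothChart hc' hq hq' hqZ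
      (hff q hqZ))
    rw [abs_mul, abs_mul, abs_mul, abs_mul, abs_inv, abs_inv, abs_pow, abs_pow, hx.abs_eq q hq,
      hx'.abs_eq q hq', abs_of_pos (hc.pos _ (e.map_source hq)),
      abs_of_pos (hc'.pos _ (e'.map_source hq')), ← mul_assoc, ← mul_assoc] at h1
    have hd : B.dist q ≠ 0 := fun h => hqZ ((B.dist_eq_zero_iff q).1 h)
    exact mul_right_cancel₀ (inv_ne_zero (pow_ne_zero m hd)) h1
  intro h0
  rw [h0, abs_zero, zero_mul] at key
  exact mul_ne_zero (abs_ne_zero.2 hJ0) (hc'.pos _ (e'.map_source hpe')).ne' key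

end Compare

/-! ### Positivity of the quotient along the critical set -/

section Residue

variable {S : Type*} [TopologicalSpace S] [ChartedSpace Plane S]
  {e e' : OpenPartialHomeomorph S (ℝ × ℝ)} {m : ℕ} {B : Critical S}
  {η : FormField S 2} {c P Q P' Q' : ℝ × ℝ → ℝ} {α : FormField S 1}

theorem IsCoeff.extD_eq [IsManifold (𝓡 2) ∞ S] (he : BChart B e) (hc : IsDensity m B e η c)
    (hα : IsCoeff m B e α P Q) {q : S} (hq : q ∈ e.source) (hqZ : q ∉ B.Z) :
    extD α q = (ratioX m e c Q q + ratioY e c P q) • η q := by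
  have hz := e.map_source hq
  have hP := (hα.smooth_left _ hz).differentiableAt (by simp)
  have hQ := (hα.smooth_right _ hz).differentiableAt (by simp)
  have hd : DifferentiableAt ℝ (fun z : ℝ × ℝ => P z * (z.1 ^ m)⁻¹) (e q) :=
    hP.mul (DifferentiableAt.inv (by fun_prop) (pow_ne_zero m (he.fst_ne_zero hq hqZ)))
  have hmd : ∀ {F : ℝ × ℝ → ℝ}, DifferentiableAt ℝ F (e q) →
      MDifferentiableAt (𝓡 2) 𝓘(ℝ, ℝ) (fun q => F (e q)) q := fun hF =>
    MDifferentiableAt.comp q hF.mdifferentiableAt (he.mdifferentiableAt hq)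
  have hsm : ∀ {F : ℝ × ℝ → ℝ}, ContDiff ℝ ∞ F →
      ∀ᶠ q' in 𝓝 q, ContMDiffAt (𝓡 2) 𝓘(ℝ, ℝ) ∞ (fun q => F (e q)) q' := by
    intro F hF
    filter_upwards [e.open_source.mem_nhds hq] with w hw
    exact he.contMDiffAt_comp hw hF.contDiffAt
  rw [extD_eq_sum (Finset.univ : Finset Bool)
    (a := fun b => bif b then fun q => P (e q) * ((e q).1 ^ m)⁻¹ else fun q => Q (e q))
    (b := fun b => bif b then fun q => (e q).1 else fun q => (e q).2)]
  · rw [Fintype.sum_bool, add_smul]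
    exact (add_comm _ _).trans (congrArg₂ (· + ·) (wedge₁_dFun_dy he hc hq hqZ hQ)
      (wedge₁_dFun_dx he hc hq hqZ hP))
  · rintro (_ | _) -
    · exact hmd hQ
    · exact hmd hd
  · rintro (_ | _) -
    · exact hsm contDiff_snd
    · exact hsm contDiff_fst
  · filter_upwards [e.open_source.mem_nhds hq, B.isClosed_Z.isOpen_compl.mem_nhds hqZ]
      with w hw hwZ
    rw [Fintype.sum_bool]
    exact hα.eq w hw hwZ

/-- Along the critical set, the coefficient of `x^{-m} dx` in a `b^m`-form of degree one does not
depend on the adapted chart, up to sign. -/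
theorem IsCoeff.sq_eq [IsManifold (𝓡 2) ∞ S] (hm : 1 ≤ m) (he : BChart B e) (he' : BChart B e')
    (hα : IsCoeff m B e α P Q) (hα' : IsCoeff m B e' α P' Q') {p : S} (hp : p ∈ e.source)
    (hp' : p ∈ e'.source) (hpZ : p ∈ B.Z) : P (e p) ^ 2 = P' (e' p) ^ 2 := by
  have hx := he.isDefining hp hpZ
  have hx' := he'.isDefining hp' hpZ
  obtain ⟨σ, hσ, hev⟩ := hx.eventually_eq hx' hp hp' hpZ
  set τ := e' ∘ e.symm
  have hz := e.map_source hp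
  have hz' : e.symm (e p) ∈ e'.source := by rwa [e.left_inv hp]
  have hτ := he.contDiffAt_transition he'.toSmoothChart hz hz'
  set D : S → ℝ := fun q => (fderiv ℝ τ (e q) (1, 0)).2
  have hD : ContinuousAt D p := by
    have h1 := (hτ.fderiv_right (m := 0) (by norm_num)).clm_apply
      (contDiffAt_const (c := ((1 : ℝ), (0 : ℝ))))
    exact (h1.continuousAt.comp (e.continuousAt hp)).snd
  have hcP : ContinuousAt (fun q => P (e q)) p :=
    (hα.smooth_left _ hz).continuousAt.comp (e.continuousAt hp)
  have hcP' : ContinuousAt (fun q => P' (e' q)) p :=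
    (hα'.smooth_left _ (e'.map_source hp')).continuousAt.comp (e'.continuousAt hp')
  have hcQ' : ContinuousAt (fun q => Q' (e' q)) p :=
    (hα'.smooth_right _ (e'.map_source hp')).continuousAt.comp (e'.continuousAt hp')
  have key := he.eq_of_eventually hp (f := fun q => P (e q))
    (g := fun q => σ ^ (m + 1) * P' (e' q) + (e q).1 ^ m * (Q' (e' q) * D q)) hcP
    ((hcP'.const_mul _).add (((e.continuousAt hp).fst.pow m).mul (hcQ'.mul hD))) (by
      filter_upwards [hev.eventually_nhds, e.open_source.mem_nhds hp, e'.open_source.mem_nhds hp']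
        with q hσq hq hq' hqZ
      have hDB := he.dualBases hq
      have h1 : dx e' q = σ • dx e q := by
        rw [dx, dx, ← dFun_const_mul (hx.mdifferentiableAt hq)]
        exact dFun_congr hσq
      have h2 : dy e' q (coordVec e q (1, 0)) = D q := by
        have hzq := e.map_source hq
        have hτq : DifferentiableAt ℝ τ (e q) := (he.contDiffAt_transition he'.toSmoothChart hzq
          (by rwa [e.left_inv hq])).differentiableAt (by simp)
        have h2 : dy e' q = dFun (fun q => (τ (e q)).2) q := by
          refine dFun_congr ?_
          filter_upwards [e.open_source.mem_nhds hq] with w hw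
          simp [τ, e.left_inv hw]
        rw [h2, he.dFun_comp_apply hq (F := fun z => (τ z).2) hτq.snd, fderiv.snd hτq,
          he.chartDeriv_coordVec hq]
        rfl
      have h3 := hα.eq q hq hqZ
      rw [hα'.eq q hq' hqZ, h1] at h3
      have h4 := congrArg (fun θ : Plane [⋀^Fin 1]→L[ℝ] ℝ => θ ![coordVec e q (1, 0)]) h3
      have hx0 := he.fst_ne_zero hq hqZ
      have hxσ : (e' q).1 = σ * (e q).1 := hσq.self_of_nhds
      simp only [ContinuousAlternatingMap.add_apply, ContinuousAlternatingMap.smul_apply, cov_apply,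
        Matrix.cons_val_zero, smul_apply, hDB.aX, hDB.bX, h2, smul_eq_mul, mul_one, mul_zero,
        add_zero, hxσ] at h4
      have hσm : (σ ^ m)⁻¹ = σ ^ m := by
        rcases hσ with rfl | rfl
        · simp
        · rw [← inv_pow]
          norm_num
      have hxm := pow_ne_zero m hx0
      rw [mul_pow, mul_inv, hσm] at h4
      field_simp at h4
      linear_combination -h4)
  simp only [hx.eq_zero_iff hp |>.2 hpZ, zero_pow (show m ≠ 0 by omega), zero_mul, add_zero] at key
  rw [key, mul_pow]
  rcases hσ with rfl | rfl
  · simp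
  · rw [← pow_mul, mul_comm (m + 1), pow_mul]
    norm_num

/-- If `dα = (f - 1) η`, then `f` takes the value one on each open and closed part of the surface
that meets the critical set: restricted to the critical set, the square of the coefficient `P` of
`x^{-m} dx` in `α` has a maximum there, where `∂P / ∂y = 0`, and `f - 1` is a multiple of
`∂P / ∂y` on the critical set. -/
theorem IsBmSymplectic.exists_eq_one [IsManifold (𝓡 2) ∞ S] [CompactSpace S] (hm : 1 ≤ m)
    (hη : IsBmSymplectic m B η) (hα : IsBmForm m B α) {f : S → ℝ} (hf : Continuous f)
    (hff : ∀ q ∉ B.Z, extD α q = (f q - 1) • η q) {K : Set S} (hK : IsClopen K)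
    (hne : (K ∩ B.Z).Nonempty) : ∃ p ∈ K, f p = 1 := by
  choose e c P Q hpe he hc hPQ using fun p => exists_adapted_chart hm hη hα p
  set G : S → ℝ := fun p => P p (e p p) ^ 2
  have hGloc : ∀ p, ∀ q ∈ (e p).source, q ∈ B.Z → G q = P p (e p q) ^ 2 := fun p q hq hqZ =>
    (hPQ q).sq_eq hm (he q) (he p) (hPQ p) (hpe q) hq hqZ
  have hG : ContinuousOn G (K ∩ B.Z) := by
    intro p hp
    have h1 : ContinuousAt (fun q => P p (e p q) ^ 2) p :=
      (((hPQ p).smooth_left _ ((e p).map_source (hpe p))).continuousAt.comp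
        ((e p).continuousAt (hpe p))).pow 2
    refine h1.continuousWithinAt.congr_of_eventuallyEq ?_ rfl
    filter_upwards [nhdsWithin_le_nhds ((e p).open_source.mem_nhds (hpe p)), self_mem_nhdsWithin]
      with q hq hqK using hGloc p q hq hqK.2
  obtain ⟨p, ⟨hpK, hpZ⟩, hmax⟩ :=
    (hK.isClosed.inter B.isClosed_Z).isCompact.exists_isMaxOn hne hG
  refine ⟨p, hpK, ?_⟩
  have hp := hpe p
  have hz := (e p).map_source hp
  have hz0 : (e p p).1 = 0 := ((he p).mem_Z p hp).1 hpZ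
  have hzz : ((0 : ℝ), (e p p).2) = e p p := Prod.ext hz0.symm rfl
  have hPd := ((hPQ p).smooth_left _ hz).differentiableAt (by simp)
  have hloc : ∀ᶠ s in 𝓝 (e p p).2, P p (0, s) ^ 2 ≤ P p (e p p) ^ 2 := by
    have h1 : ∀ᶠ z in 𝓝 (e p p), z ∈ (e p).target ∧ (e p).symm z ∈ K := by
      have h2 : K ∈ 𝓝 ((e p).symm (e p p)) := by
        rw [(e p).left_inv hp]
        exact hK.isOpen.mem_nhds hpK
      exact ((e p).open_target.eventually_mem hz).and
        (((e p).continuousAt_symm hz).eventually_mem h2)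
    rw [← hzz] at h1
    have h2 : ContinuousAt (fun s : ℝ => ((0 : ℝ), s)) (e p p).2 := by fun_prop
    filter_upwards [h2.eventually h1] with s hs
    have hsS := (e p).map_target hs.1
    have hsZ : (e p).symm (0, s) ∈ B.Z := by
      rw [(he p).mem_Z _ hsS, (e p).right_inv hs.1]
    have h3 : G ((e p).symm (0, s)) ≤ G p := hmax ⟨hs.2, hsZ⟩
    rwa [hGloc p _ hsS hsZ, (e p).right_inv hs.1] at h3
  have hder : fderiv ℝ (P p) (e p p) (0, 1) = 0 := by
    have h1 : HasDerivAt (fun s : ℝ => ((0 : ℝ), s)) ((0 : ℝ), (1 : ℝ)) (e p p).2 :=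
      (hasDerivAt_const _ _).prodMk (hasDerivAt_id _)
    have h2 : HasDerivAt (fun s : ℝ => P p (0, s)) (fderiv ℝ (P p) (e p p) (0, 1)) (e p p).2 := by
      refine HasFDerivAt.comp_hasDerivAt (f := fun s : ℝ => ((0 : ℝ), s)) (e p p).2 ?_ h1
      rw [hzz]
      exact hPd.hasFDerivAt
    by_cases h0 : P p (e p p) = 0
    · have h3 : (fun s : ℝ => P p (0, s)) =ᶠ[𝓝 (e p p).2] fun _ => 0 := by
        filter_upwards [hloc] with s hs
        rw [h0] at hs
        nlinarith
      exact h2.unique ((hasDerivAt_const _ _).congr_of_eventuallyEq h3)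
    · have h3 : IsLocalMax (fun s : ℝ => P p (0, s) ^ 2) (e p p).2 := by
        filter_upwards [hloc] with s hs
        rwa [hzz]
      have h4 := h3.hasDerivAt_eq_zero (h2.pow 2)
      rw [hzz] at h4
      simpa [h0] using h4
  have key := (he p).eq_of_eventually hp (f := fun q => f q - 1)
    (g := fun q => (e p q).1 ^ m * fderiv ℝ (Q p) (e p q) (1, 0) / c p (e p q) +
      -fderiv ℝ (P p) (e p q) (0, 1) / c p (e p q)) (hf.continuousAt.sub continuousAt_const) (by
      have h1 := (e p).continuousAt hp
      have h2 := (((hPQ p).smooth_left _ hz).fderiv_right (m := 0) (by norm_num)).clm_apply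
        (contDiffAt_const (c := ((0 : ℝ), (1 : ℝ))))
      have h3 := (((hPQ p).smooth_right _ hz).fderiv_right (m := 0) (by norm_num)).clm_apply
        (contDiffAt_const (c := ((1 : ℝ), (0 : ℝ))))
      have h4 := ((hc p).smooth _ hz).continuousAt
      have h5 := ((hc p).pos _ hz).ne'
      exact ((((continuousAt_fst (p := e p p)).pow m).mul h3.continuousAt).div h4 h5 |>.add
        (h2.continuousAt.neg.div h4 h5)).comp h1) (by
      filter_upwards [(e p).open_source.mem_nhds hp] with q hq hqZ
      have h1 := hff q hqZ
      rw [(hPQ p).extD_eq (he p) (hc p) hq hqZ] at h1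
      have h2 := smul_left_injective ℝ (hη.nondegenerate_off q hqZ) h1
      rw [← h2, ratioX, ratioY, if_pos hq, if_pos hq])
  simp only [hder, hz0, zero_pow (show m ≠ 0 by omega), zero_mul, zero_div, neg_zero, add_zero]
    at key
  linarith

end Residue

/-! ### Stokes' theorem on a closed piece of the surface off the critical set -/

section Stokes

open MeasureTheory

/-- Extension by zero of a function that vanishes off a closed subset of the open set `V`. -/
theorem contDiff_indicator {n : WithTop ℕ∞} {V C : Set (ℝ × ℝ)} (hV : IsOpen V) (hC : IsClosed C)
    (hCV : C ⊆ V) {F : ℝ × ℝ → ℝ} (hF : ∀ z ∈ V, ContDiffAt ℝ n F z)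
    (h0 : ∀ z ∈ V, z ∉ C → F z = 0) : ContDiff ℝ n (V.indicator F) := by
  rw [contDiff_iff_contDiffAt]
  intro z
  by_cases hz : z ∈ V
  · refine (hF z hz).congr_of_eventuallyEq ?_
    filter_upwards [hV.mem_nhds hz] with w hw using indicator_of_mem hw F
  · refine (contDiffAt_const (c := (0 : ℝ))).congr_of_eventuallyEq ?_
    filter_upwards [hC.isOpen_compl.mem_nhds fun h => hz (hCV h)] with w hw
    by_cases hwV : w ∈ V
    · rw [indicator_of_mem hwV, h0 w hwV hw]
    · exact indicator_of_notMem hwV F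

theorem hasCompactSupport_indicator {V C : Set (ℝ × ℝ)} (hC : IsCompact C) {F : ℝ × ℝ → ℝ}
    (h0 : ∀ z ∈ V, z ∉ C → F z = 0) : HasCompactSupport (V.indicator F) := by
  refine HasCompactSupport.intro hC fun z hz => ?_
  by_cases hzV : z ∈ V
  · rw [indicator_of_mem hzV, h0 z hzV hz]
  · exact indicator_of_notMem hzV F

theorem integral_fderiv_eq_zero {F : ℝ × ℝ → ℝ} (hF : ContDiff ℝ 1 F) (hFc : HasCompactSupport F)
    (v : ℝ × ℝ) : ∫ z, fderiv ℝ F z v = 0 := by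
  have hF' : Continuous fun z => fderiv ℝ F z v :=
    (hF.continuous_fderiv (by simp)).clm_apply continuous_const
  have hFc' : HasCompactSupport fun z => fderiv ℝ F z v := hFc.fderiv_apply (𝕜 := ℝ) v
  have h := integral_mul_fderiv_eq_neg_fderiv_mul_of_integrable (μ := volume)
    (f := fun _ : ℝ × ℝ => (1 : ℝ)) (g := F) (v := v) (by simp)
    (by simpa using hF'.integrable_of_hasCompactSupport hFc')
    (by simpa using hF.continuous.integrable_of_hasCompactSupport hFc)
    (fun _ _ => differentiableAt_const _) fun z _ => hF.differentiable (by simp) z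
  simpa using h

variable {S : Type*} [TopologicalSpace S]

/-- The density `G |η|` on the set `K`, in the chart `e` where `η = c x^{-m} dx ∧ dy`; it is
extended by zero to `ℝ × ℝ`. -/
def localDensity (m : ℕ) (e : OpenPartialHomeomorph S (ℝ × ℝ)) (c : ℝ × ℝ → ℝ) (K : Set S)
    (G : S → ℝ) : ℝ × ℝ → ℝ :=
  (e.target ∩ e.symm ⁻¹' K).indicator fun z => G (e.symm z) * (c z * |(z.1 ^ m)⁻¹|)

variable {m : ℕ} {e e' : OpenPartialHomeomorph S (ℝ × ℝ)} {c c' : ℝ × ℝ → ℝ} {K : Set S}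

theorem isCompact_image_inter [CompactSpace S] {C : Set S} (hC : IsClosed C) (hCe : C ⊆ e.source)
    (hK : IsClosed K) : IsCompact (e '' (C ∩ K)) :=
  (hC.inter hK).isCompact.image_of_continuousOn
    (e.continuousOn.mono (inter_subset_left.trans hCe))

theorem image_inter_subset {C : Set S} (hCe : C ⊆ e.source) :
    e '' (C ∩ K) ⊆ e.target ∩ e.symm ⁻¹' K := by
  rintro _ ⟨q, ⟨hq, hqK⟩, rfl⟩
  refine ⟨e.map_source (hCe hq), ?_⟩
  rwa [mem_preimage, e.left_inv (hCe hq)]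

theorem localDensity_eq_zero {C : Set S} {G : S → ℝ}
    (hG : ∀ q ∉ C, G q = 0) :
    ∀ z ∈ e.target ∩ e.symm ⁻¹' K, z ∉ e '' (C ∩ K) →
      G (e.symm z) * (c z * |(z.1 ^ m)⁻¹|) = 0 := by
  intro z hz hzC
  rw [hG, zero_mul]
  exact fun h => hzC ⟨_, ⟨h, hz.2⟩, e.right_inv hz.1⟩

theorem hasCompactSupport_localDensity [CompactSpace S] (hK : IsClopen K) {G : S → ℝ} {C : Set S}
    (hC : IsClosed C) (hCe : C ⊆ e.source) (hGC : ∀ q ∉ C, G q = 0) :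
    HasCompactSupport (localDensity m e c K G) :=
  hasCompactSupport_indicator (isCompact_image_inter hC hCe hK.isClosed) (localDensity_eq_zero hGC)

theorem localDensity_sum {ι : Type*} (s : Finset ι) (G : ι → S → ℝ) (z : ℝ × ℝ) :
    localDensity m e c K (fun q => ∑ i ∈ s, G i q) z = ∑ i ∈ s, localDensity m e c K (G i) z := by
  by_cases hz : z ∈ e.target ∩ e.symm ⁻¹' K
  · simp only [localDensity, indicator_of_mem hz, Finset.sum_mul]
  · simp only [localDensity, indicator_of_notMem hz, Finset.sum_const_zero]

variable [ChartedSpace Plane S] {B : Critical S} {η : FormField S 2}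

theorem BChart.fst_ne_zero_of_mem (he : BChart B e) (hKZ : ∀ q ∈ K, q ∉ B.Z) {z : ℝ × ℝ}
    (hz : z ∈ e.target ∩ e.symm ⁻¹' K) : z.1 ≠ 0 := by
  have := he.fst_ne_zero (e.map_target hz.1) (hKZ _ hz.2)
  rwa [e.right_inv hz.1] at this

theorem continuous_localDensity [CompactSpace S] (he : BChart B e) (hc : IsDensity m B e η c)
    (hK : IsClopen K) (hKZ : ∀ q ∈ K, q ∉ B.Z) {G : S → ℝ} (hG : Continuous G) {C : Set S}
    (hC : IsClosed C) (hCe : C ⊆ e.source) (hGC : ∀ q ∉ C, G q = 0) :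
    Continuous (localDensity m e c K G) := by
  rw [← contDiff_zero (𝕜 := ℝ)]
  refine contDiff_indicator (e.isOpen_inter_preimage_symm hK.isOpen)
    (isCompact_image_inter hC hCe hK.isClosed).isClosed (image_inter_subset hCe) (fun z hz => ?_)
    (localDensity_eq_zero hGC)
  refine ContDiffAt.of_le (n := 0) ?_ le_rfl
  have hcz := (hc.smooth z hz.1).of_le (m := 0) (by simp)
  have hV := e.isOpen_inter_preimage_symm hK.isOpen
  refine contDiffAt_zero.2 ⟨_, hV.mem_nhds hz, fun w hw => ContinuousAt.continuousWithinAt ?_⟩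
  have hw0 : (w.1 ^ m) ≠ 0 := pow_ne_zero m (he.fst_ne_zero_of_mem hKZ hw)
  exact (hG.continuousAt.comp (e.continuousAt_symm hw.1)).mul
    ((hc.smooth w hw.1).continuousAt.mul ((continuousAt_fst.pow m).inv₀ hw0).abs)

/-- The integral of a density does not depend on the chart. -/
theorem integral_localDensity_eq (he : BChart B e) (he' : BChart B e') (hc : IsDensity m B e η c)
    (hc' : IsDensity m B e' η c') (hK : IsClopen K) (hKZ : ∀ q ∈ K, q ∉ B.Z) {G : S → ℝ}
    (hG : ∀ q, q ∉ e.source ∩ e'.source → G q = 0) :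
    ∫ z, localDensity m e c K G z = ∫ z, localDensity m e' c' K G z := by
  set τ := (e.symm ≫ₕ e').restrOpen (e.target ∩ e.symm ⁻¹' K)
    (e.isOpen_inter_preimage_symm hK.isOpen)
  have hτs : ∀ z ∈ τ.source, z ∈ e.target ∧ e.symm z ∈ e'.source ∧ e.symm z ∈ K :=
    fun z hz => ⟨hz.2.1, hz.1.2, hz.2.2⟩
  have hτ : ∀ z ∈ τ.source, HasFDerivAt τ (fderiv ℝ (e' ∘ e.symm) z) z := fun z hz =>
    ((he.contDiffAt_transition he'.toSmoothChart (hτs z hz).1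
      (hτs z hz).2.1).differentiableAt (by simp)).hasFDerivAt
  have h1 : ∫ z, localDensity m e c K G z = ∫ z in τ.source, localDensity m e c K G z := by
    refine (setIntegral_eq_integral_of_forall_compl_eq_zero fun z hz => ?_).symm
    refine indicator_apply_eq_zero.2 fun hzV => ?_
    rw [hG, zero_mul]
    exact fun h => hz ⟨⟨hzV.1, h.2⟩, hzV⟩
  have h2 : ∫ z, localDensity m e' c' K G z = ∫ z in τ.target, localDensity m e' c' K G z := by
    refine (setIntegral_eq_integral_of_forall_compl_eq_zero fun z hz => ?_).symm
    refine indicator_apply_eq_zero.2 fun hzV => ?_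
    rw [hG, zero_mul]
    intro h
    have h3 : e (e'.symm z) ∈ τ.source := by
      refine ⟨⟨e.map_source h.1, ?_⟩, e.map_source h.1, ?_⟩
      · change e.symm (e (e'.symm z)) ∈ e'.source
        rw [e.left_inv h.1]
        exact h.2
      · rw [mem_preimage, e.left_inv h.1]
        exact hzV.2
    have h4 := τ.map_source h3
    have h5 : τ (e (e'.symm z)) = z := by
      change e' (e.symm (e (e'.symm z))) = z
      rw [e.left_inv h.1, e'.right_inv hzV.1]
    exact hz (h5 ▸ h4)
  rw [h1, h2, integral_target_eq_integral_abs_det_fderiv_smul volume hτ]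
  refine setIntegral_congr_fun τ.open_source.measurableSet fun z hz => ?_
  obtain ⟨hzt, hzs, hzK⟩ := hτs z hz
  have hzZ := hKZ _ hzK
  have h3 := hc.det_mul he.toSmoothChart he'.toSmoothChart hc' (e.map_target hzt) hzs hzZ
    (one_smul ℝ (η (e.symm z))).symm
  have h4 : τ z = e' (e.symm z) := rfl
  have h5 : τ z ∈ e'.target ∩ e'.symm ⁻¹' K := by
    rw [h4]
    refine ⟨e'.map_source hzs, ?_⟩
    rwa [mem_preimage, e'.left_inv hzs]
  have h6 := congrArg abs h3
  rw [e.right_inv hzt, abs_mul, abs_mul, one_mul, abs_mul, abs_of_pos (hc.pos z hzt),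
    abs_of_pos (hc'.pos _ (e'.map_source hzs))] at h6
  rw [localDensity, localDensity, indicator_of_mem (show z ∈ e.target ∩ e.symm ⁻¹' K from
    ⟨hzt, hzK⟩), indicator_of_mem h5, h4, e'.left_inv hzs, ← h6, smul_eq_mul]
  ring

/-- Stokes' theorem for a one-form that is supported in a chart. -/
theorem integral_localDensity_ratio [CompactSpace S] [T2Space S] (he : BChart B e)
    (hc : IsDensity m B e η c)
    (hK : IsClopen K) (hKZ : ∀ q ∈ K, q ∉ B.Z) {P Q : ℝ × ℝ → ℝ} (hP : ContDiff ℝ ∞ P)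
    (hPc : HasCompactSupport P) (hPe : tsupport P ⊆ e.target) (hQ : ContDiff ℝ ∞ Q)
    (hQc : HasCompactSupport Q) (hQe : tsupport Q ⊆ e.target) :
    ∫ z, localDensity m e c K (fun q => ratioX m e c Q q + ratioY e c P q) z = 0 := by
  set V := e.target ∩ e.symm ⁻¹' K
  have hV : IsOpen V := e.isOpen_inter_preimage_symm hK.isOpen
  have hV0 : ∀ z ∈ V, z.1 ≠ 0 := fun z hz => he.fst_ne_zero_of_mem hKZ hz
  have habs : ∀ z ∈ V, ContDiffAt ℝ ∞ (fun z : ℝ × ℝ => |(z.1 ^ m)⁻¹|) z := fun z hz =>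
    (contDiffAt_abs (inv_ne_zero (pow_ne_zero m (hV0 z hz)))).comp z
      ((contDiffAt_fst.pow m).inv (pow_ne_zero m (hV0 z hz)))
  have hcpt : ∀ {R : ℝ × ℝ → ℝ}, HasCompactSupport R → tsupport R ⊆ e.target →
      IsCompact (tsupport R ∩ V) ∧ ∀ z ∈ V, z ∉ tsupport R ∩ V → R z = 0 := by
    intro R hR hRe
    have h1 : tsupport R ∩ V = e '' (e.symm '' tsupport R ∩ K) := by
      ext z
      constructor
      · rintro ⟨hz, hzV⟩
        exact ⟨e.symm z, ⟨⟨z, hz, rfl⟩, hzV.2⟩, e.right_inv hzV.1⟩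
      · rintro ⟨_, ⟨⟨w, hw, rfl⟩, hwK⟩, rfl⟩
        rw [e.right_inv (hRe hw)]
        exact ⟨hw, hRe hw, hwK⟩
    rw [h1]
    refine ⟨isCompact_image_inter (isClosed_symm_image hR.isCompact hRe) ?_ hK.isClosed,
      fun z hz hz' => ?_⟩
    · rintro _ ⟨w, hw, rfl⟩
      exact e.map_target (hRe hw)
    · rw [← h1] at hz'
      exact image_eq_zero_of_notMem_tsupport fun h => hz' ⟨h, hz⟩
  obtain ⟨hCP, h0P⟩ := hcpt hPc hPe
  obtain ⟨hCQ, h0Q⟩ := hcpt hQc hQe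
  set FQ : ℝ × ℝ → ℝ := fun z => z.1 ^ m * |(z.1 ^ m)⁻¹| * Q z
  set FP : ℝ × ℝ → ℝ := fun z => |(z.1 ^ m)⁻¹| * P z
  have h0P' : ∀ z ∈ V, z ∉ tsupport P ∩ V → FP z = 0 := fun z hz hz' => by
    simp only [FP, h0P z hz hz', mul_zero]
  have h0Q' : ∀ z ∈ V, z ∉ tsupport Q ∩ V → FQ z = 0 := fun z hz hz' => by
    simp only [FQ, h0Q z hz hz', mul_zero]
  have hsQ : ContDiff ℝ 1 (V.indicator FQ) := contDiff_indicator hV hCQ.isClosed inter_subset_right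
    (fun z hz => (((contDiffAt_fst.pow m).mul (habs z hz)).mul hQ.contDiffAt).of_le (by simp)) h0Q'
  have hsP : ContDiff ℝ 1 (V.indicator FP) := contDiff_indicator hV hCP.isClosed inter_subset_right
    (fun z hz => ((habs z hz).mul hP.contDiffAt).of_le (by simp)) h0P'
  have hcQ : HasCompactSupport (V.indicator FQ) := hasCompactSupport_indicator hCQ h0Q'
  have hcP : HasCompactSupport (V.indicator FP) := hasCompactSupport_indicator hCP h0P'
  have hint : ∀ {F : ℝ × ℝ → ℝ}, ContDiff ℝ 1 F → HasCompactSupport F → ∀ v,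
      Integrable fun z => fderiv ℝ F z v := fun hF hFc v =>
    ((hF.continuous_fderiv (by simp)).clm_apply continuous_const).integrable_of_hasCompactSupport
      (hFc.fderiv_apply (𝕜 := ℝ) v)
  have key : localDensity m e c K (fun q => ratioX m e c Q q + ratioY e c P q) = fun z =>
      fderiv ℝ (V.indicator FQ) z (1, 0) - fderiv ℝ (V.indicator FP) z (0, 1) := by
    funext z
    by_cases hz : z ∈ V
    · have hzs := e.map_target hz.1
      have hx := pow_ne_zero m (hV0 z hz)
      have hcz := (hc.pos z hz.1).ne'
      have hVQ : V.indicator FQ =ᶠ[𝓝 z] FQ := by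
        filter_upwards [hV.mem_nhds hz] with w hw using indicator_of_mem hw FQ
      have hVP : V.indicator FP =ᶠ[𝓝 z] FP := by
        filter_upwards [hV.mem_nhds hz] with w hw using indicator_of_mem hw FP
      -- the factor `x^m |x^{-m}|` is a sign, hence locally constant
      have hsign : (fun w : ℝ × ℝ => w.1 ^ m * |(w.1 ^ m)⁻¹|) =ᶠ[𝓝 z]
          fun _ => z.1 ^ m * |(z.1 ^ m)⁻¹| := by
        have hcont : ContinuousAt (fun w : ℝ × ℝ => w.1 ^ m) z := continuousAt_fst.pow m
        rcases hx.lt_or_gt with h | h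
        · filter_upwards [hcont.eventually (gt_mem_nhds h)] with w hw
          rw [abs_of_neg (inv_lt_zero.2 hw), abs_of_neg (inv_lt_zero.2 h), mul_neg, mul_neg,
            mul_inv_cancel₀ hw.ne, mul_inv_cancel₀ h.ne]
        · filter_upwards [hcont.eventually (lt_mem_nhds h)] with w hw
          rw [abs_of_pos (inv_pos.2 hw), abs_of_pos (inv_pos.2 h), mul_inv_cancel₀ hw.ne',
            mul_inv_cancel₀ h.ne']
      have hFQ : fderiv ℝ FQ z (1, 0) = z.1 ^ m * |(z.1 ^ m)⁻¹| * fderiv ℝ Q z (1, 0) := by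
        have h1 : FQ =ᶠ[𝓝 z] fun w => z.1 ^ m * |(z.1 ^ m)⁻¹| * Q w := by
          filter_upwards [hsign] with w hw
          simp only [FQ, hw]
        rw [h1.fderiv_eq, fderiv_const_mul_apply hQ]
      have hFP : fderiv ℝ FP z (0, 1) = |(z.1 ^ m)⁻¹| * fderiv ℝ P z (0, 1) := by
        have h1 : DifferentiableAt ℝ (fun t : ℝ => |(t ^ m)⁻¹|) z.1 :=
          DifferentiableAt.comp (g := fun t : ℝ => |t|) z.1
            ((hasDerivAt_abs (inv_ne_zero hx)).differentiableAt) ((differentiableAt_pow m).inv hx)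
        have h2 : HasFDerivAt (fun w : ℝ × ℝ => |(w.1 ^ m)⁻¹|)
            (deriv (fun t : ℝ => |(t ^ m)⁻¹|) z.1 • ContinuousLinearMap.fst ℝ ℝ ℝ) z :=
          h1.hasDerivAt.comp_hasFDerivAt z hasFDerivAt_fst
        rw [(h2.fun_mul (hP.differentiable (by simp) z).hasFDerivAt).fderiv]
        simp
      rw [localDensity, indicator_of_mem hz, hVQ.fderiv_eq, hVP.fderiv_eq, hFQ, hFP, ratioX, ratioY,
        if_pos hzs, if_pos hzs, e.right_inv hz.1]
      field_simp
      ring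
    · have hQ0 : fderiv ℝ (V.indicator FQ) z = 0 := by
        refine fderiv_eq_zero_of_notMem_tsupport fun h => hz ?_
        refine (closure_minimal (fun w hw => ?_) hCQ.isClosed h : z ∈ tsupport Q ∩ V).2
        by_contra hw'
        have hwV : w ∈ V := by_contra fun h => hw (indicator_of_notMem h FQ)
        exact hw ((indicator_of_mem hwV FQ).trans (h0Q' w hwV hw'))
      have hP0 : fderiv ℝ (V.indicator FP) z = 0 := by
        refine fderiv_eq_zero_of_notMem_tsupport fun h => hz ?_
        refine (closure_minimal (fun w hw => ?_) hCP.isClosed h : z ∈ tsupport P ∩ V).2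
        by_contra hw'
        have hwV : w ∈ V := by_contra fun h => hw (indicator_of_notMem h FP)
        exact hw ((indicator_of_mem hwV FP).trans (h0P' w hwV hw'))
      rw [localDensity, indicator_of_notMem hz, hQ0, hP0]
      simp
  rw [key, integral_sub (hint hsQ hcQ _) (hint hsP hcP _), integral_fderiv_eq_zero hsQ hcQ,
    integral_fderiv_eq_zero hsP hcP, sub_zero]

namespace Atlas

variable {α : FormField S 1} {ι : Type*} [Fintype ι] (A : Atlas m B η α ι)

theorem ratio_eq_zero (i : ι) {q : S} (hq : q ∉ (A.e i).source) : A.ratio i q = 0 := by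
  rw [ratio, ratioX, ratioY, if_neg hq, if_neg hq, add_zero]

theorem ratio_eq_zero_of_notMem (i : ι) {q : S}
    (hq : q ∉ (A.e i).symm '' (tsupport (A.P i) ∪ tsupport (A.Q i))) : A.ratio i q = 0 := by
  rw [image_union, mem_union, not_or] at hq
  by_cases h : q ∈ (A.e i).source
  · rw [ratio, ratioX, ratioY,
      fderiv_eq_zero_of_notMem_tsupport (notMem_tsupport_of_notMem_image h hq.1),
      fderiv_eq_zero_of_notMem_tsupport (notMem_tsupport_of_notMem_image h hq.2)]
    simp
  · exact A.ratio_eq_zero i h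

/-- By Stokes' theorem, there is no nonempty open and closed set `K` off the critical set on which
`dα` is everywhere a negative multiple of `η`. The pieces `ρ_i α` are integrated one by one, and the
integrals against the positive density `|η|` do not require an orientation. -/
theorem eq_empty_of_ratio_neg [CompactSpace S] [T2Space S] (hK : IsClopen K)
    (hKZ : ∀ q ∈ K, q ∉ B.Z) (hneg : ∀ q ∈ K, ∑ i, A.ratio i q < 0) : K = ∅ := by
  classical
  by_contra hne
  obtain ⟨q₀, hq₀⟩ := nonempty_iff_ne_empty.2 hne
  obtain ⟨k₀, hk₀⟩ : ∃ k, A.ρ k q₀ ≠ 0 := by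
    by_contra! h
    have := A.sum_ρ q₀
    simp [h] at this
  have hrc : ∀ i, Continuous (A.ratio i) := fun i => (A.contMDiff_ratio i).continuous
  set J : ι → (S → ℝ) → ℝ := fun k G => ∫ z, localDensity m (A.e k) (A.c k) K G z
  have hJ1 : ∀ j, J j (A.ratio j) = 0 := fun j =>
    integral_localDensity_ratio (A.chart j) (A.density j) hK hKZ (A.contDiff_P j) (A.compact_P j)
      (A.tsupport_P j) (A.contDiff_Q j) (A.compact_Q j) (A.tsupport_Q j)
  have hJ2 : ∀ j k, J j (fun q => A.ρ k q * A.ratio j q) = J k fun q => A.ρ k q * A.ratio j q := by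
    intro j k
    refine integral_localDensity_eq (A.chart j) (A.chart k) (A.density j) (A.density k) hK hKZ
      fun q hq => ?_
    rcases not_and_or.1 hq with h | h
    · rw [A.ratio_eq_zero j h, mul_zero]
    · rw [A.ρ_eq_zero k h, zero_mul]
  have hJ3 : ∀ j, J j (A.ratio j) = ∑ k, J j fun q => A.ρ k q * A.ratio j q := by
    intro j
    have h1 : A.ratio j = fun q => ∑ k, A.ρ k q * A.ratio j q := by
      funext q
      rw [← Finset.sum_mul, A.sum_ρ, one_mul]
    set C := (A.e j).symm '' (tsupport (A.P j) ∪ tsupport (A.Q j))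
    have hC : IsClosed C := isClosed_symm_image
      ((A.compact_P j).isCompact.union (A.compact_Q j).isCompact)
      (union_subset (A.tsupport_P j) (A.tsupport_Q j))
    have hCe : C ⊆ (A.e j).source := by
      rintro _ ⟨z, hz, rfl⟩
      exact (A.e j).map_target (union_subset (A.tsupport_P j) (A.tsupport_Q j) hz)
    have hC0 : ∀ k, ∀ q ∉ C, A.ρ k q * A.ratio j q = 0 := fun k q hq => by
      rw [A.ratio_eq_zero_of_notMem j hq, mul_zero]
    have h2 : J j (A.ratio j) = J j fun q => ∑ k, A.ρ k q * A.ratio j q := by rw [← h1]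
    rw [h2]
    simp only [J, localDensity_sum]
    exact integral_finsetSum _ fun k _ =>
      (continuous_localDensity (A.chart j) (A.density j) hK hKZ ((A.continuous_ρ k).mul (hrc j)) hC
        hCe (hC0 k)).integrable_of_hasCompactSupport (hasCompactSupport_localDensity hK hC hCe
          (hC0 k))
  have hJ4 : ∀ k, ∑ j, J k (fun q => A.ρ k q * A.ratio j q) =
      J k fun q => A.ρ k q * ∑ j, A.ratio j q := by
    intro k
    have hC0 : ∀ j, ∀ q ∉ tsupport (A.ρ k), A.ρ k q * A.ratio j q = 0 := fun j q hq => by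
      rw [image_eq_zero_of_notMem_tsupport hq, zero_mul]
    simp only [J, Finset.mul_sum, localDensity_sum]
    exact (integral_finsetSum _ fun j _ =>
      (continuous_localDensity (A.chart k) (A.density k) hK hKZ ((A.continuous_ρ k).mul (hrc j))
        (isClosed_tsupport _) (A.tsupport_ρ k) (hC0 j)).integrable_of_hasCompactSupport
          (hasCompactSupport_localDensity hK (isClosed_tsupport _) (A.tsupport_ρ k) (hC0 j))).symm
  have htot : ∑ k, J k (fun q => A.ρ k q * ∑ j, A.ratio j q) = 0 := by
    calc ∑ k, J k (fun q => A.ρ k q * ∑ j, A.ratio j q)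
        = ∑ k, ∑ j, J k fun q => A.ρ k q * A.ratio j q :=
          Finset.sum_congr rfl fun k _ => (hJ4 k).symm
      _ = ∑ j, ∑ k, J j fun q => A.ρ k q * A.ratio j q := by
          rw [Finset.sum_comm]
          exact Finset.sum_congr rfl fun j _ => Finset.sum_congr rfl fun k _ => (hJ2 j k).symm
      _ = 0 := Finset.sum_eq_zero fun j _ => by rw [← hJ3, hJ1]
  have hle : ∀ k z, localDensity m (A.e k) (A.c k) K (fun q => A.ρ k q * ∑ j, A.ratio j q) z ≤ 0 :=
    fun k => indicator_nonpos fun z hz => mul_nonpos_of_nonpos_of_nonneg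
      (mul_nonpos_of_nonneg_of_nonpos (A.ρ_nonneg k _) (hneg _ hz.2).le)
      (mul_nonneg ((A.density k).pos z hz.1).le (abs_nonneg _))
  have hlt : J k₀ (fun q => A.ρ k₀ q * ∑ j, A.ratio j q) < 0 := by
    have hq₀s : q₀ ∈ (A.e k₀).source := by_contra fun h => hk₀ (A.ρ_eq_zero k₀ h)
    have hC0 : ∀ q ∉ tsupport (A.ρ k₀), A.ρ k₀ q * ∑ j, A.ratio j q = 0 := fun q hq => by
      rw [image_eq_zero_of_notMem_tsupport hq, zero_mul]
    have h1 : Continuous (localDensity m (A.e k₀) (A.c k₀) K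
        fun q => A.ρ k₀ q * ∑ j, A.ratio j q) := continuous_localDensity (A.chart k₀) (A.density k₀)
      hK hKZ ((A.continuous_ρ k₀).mul (continuous_finsetSum Finset.univ fun j _ => hrc j))
      (isClosed_tsupport _) (A.tsupport_ρ k₀) hC0
    have h2 := hasCompactSupport_localDensity (m := m) (c := A.c k₀) hK (isClosed_tsupport _)
      (A.tsupport_ρ k₀) hC0
    have h3 := h1.neg.integral_pos_of_hasCompactSupport_nonneg_nonzero (μ := volume)
      (x := A.e k₀ q₀) h2.neg (fun z => neg_nonneg.2 (hle k₀ z)) (by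
        have hzV : A.e k₀ q₀ ∈ (A.e k₀).target ∩ (A.e k₀).symm ⁻¹' K := by
          refine ⟨(A.e k₀).map_source hq₀s, ?_⟩
          rwa [mem_preimage, (A.e k₀).left_inv hq₀s]
        rw [Pi.neg_apply, neg_ne_zero, localDensity, indicator_of_mem hzV, (A.e k₀).left_inv hq₀s]
        refine mul_ne_zero (mul_ne_zero hk₀ (hneg q₀ hq₀).ne) (mul_ne_zero
          ((A.density k₀).pos _ hzV.1).ne' (abs_ne_zero.2 (inv_ne_zero (pow_ne_zero m ?_))))
        exact (A.chart k₀).fst_ne_zero hq₀s (hKZ q₀ hq₀))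
    have h4 : ∫ z, (-localDensity m (A.e k₀) (A.c k₀) K
        (fun q => A.ρ k₀ q * ∑ j, A.ratio j q)) z =
        - J k₀ (fun q => A.ρ k₀ q * ∑ j, A.ratio j q) := integral_neg _
    rw [h4] at h3
    linarith
  have := Finset.sum_lt_sum (s := Finset.univ) (fun k _ => integral_nonpos (hle k))
    ⟨k₀, Finset.mem_univ k₀, hlt⟩
  rw [Finset.sum_const_zero] at this
  exact this.ne htot

end Atlas

end Stokes

/-! ### Joining cohomologous forms by small moves -/

section Moves

variable {S : Type*} [TopologicalSpace S] [ChartedSpace Plane S]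
  {m : ℕ} {B : Critical S} {η : FormField S 2}

/-- A diffeomorphism of the surface that is a `b^m`-map pulls the form `F η` back to `G η`. -/
def Moves (m : ℕ) (B : Critical S) (η : FormField S 2) (F G : S → ℝ) : Prop :=
  ∃ φ : S ≃ₘ^∞⟮𝓡 2, 𝓡 2⟯ S, IsBmMap m B φ ∧
    ∀ q ∉ B.Z, pullback φ (fun q => F q • η q) q = G q • η q

theorem Moves.refl (F : S → ℝ) : Moves m B η F F :=
  ⟨Diffeomorph.refl (𝓡 2) S ∞, isBmMap_id, fun _ _ =>
    pullback_of_eventuallyEq_id _ (Filter.Eventually.of_forall fun _ => rfl)⟩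

theorem Moves.trans [IsManifold (𝓡 2) ∞ S] (hm : 1 ≤ m) {F G H : S → ℝ} (h : Moves m B η F G)
    (h' : Moves m B η G H) : Moves m B η F H := by
  obtain ⟨φ, hφ, hφη⟩ := h
  obtain ⟨ψ, hψ, hψη⟩ := h'
  refine ⟨ψ.trans φ, IsBmMap.comp (φ := ψ) (ψ := φ) hm ψ.contMDiff hψ hφ, fun q hq => ?_⟩
  have h1 := pullback_comp (ψ.contMDiff.mdifferentiable (by simp) q)
    (φ.contMDiff.mdifferentiable (by simp) (ψ q)) fun q => F q • η q
  have h2 := pullback_congr (φ := ψ) (q := q) (η := pullback φ fun q => F q • η q)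
    (θ := fun q => G q • η q) (hφη (ψ q) fun h => hq ((hψ.1 q).1 h))
  exact (h1.trans h2).trans (hψη q hq)

/-- If small multiples of finitely many functions `E j` can be added to the density `F` of an area
form by `b^m`-diffeomorphisms, then so can their sum, provided that the result is positive: the
segment from `1` to `1 + ∑ E j` is followed in small steps, in each of which one `E j` after the
other is added. -/
theorem moves_one_add_sum [CompactSpace S] [IsManifold (𝓡 2) ∞ S] (hm : 1 ≤ m) {ι : Type*}
    [Fintype ι] {E : ι → S → ℝ} (hE : ∀ j, ContMDiff (𝓡 2) 𝓘(ℝ, ℝ) ∞ (E j))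
    (hstep : ∀ j, ∀ κ > 0, ∃ ε₀ > 0, ∀ F : S → ℝ, ContMDiff (𝓡 2) 𝓘(ℝ, ℝ) ∞ F → (∀ q, κ ≤ F q) →
      ∀ ε, |ε| ≤ ε₀ → (∀ q, 0 < F q + ε * E j q) → Moves m B η F fun q => F q + ε * E j q)
    (hpos : ∀ q, 0 < 1 + ∑ j, E j q) : Moves m B η (fun _ => 1) fun q => 1 + ∑ j, E j q := by
  classical
  have hEs : ∀ s : Finset ι, ContMDiff (𝓡 2) 𝓘(ℝ, ℝ) ∞ fun q => ∑ j ∈ s, E j q := fun s =>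
    contMDiff_finsetSum fun j _ => hE j
  obtain ⟨κ, hκ, hκ1, hκf⟩ : ∃ κ > 0, κ ≤ 1 ∧ ∀ q, κ ≤ 1 + ∑ j, E j q := by
    rcases isEmpty_or_nonempty S with hS | hS
    · exact ⟨1, one_pos, le_rfl, fun q => hS.elim q⟩
    · obtain ⟨p, -, hp⟩ := isCompact_univ.exists_isMinOn univ_nonempty
        (continuous_const.add (hEs Finset.univ).continuous :
          Continuous fun q => (1 : ℝ) + ∑ j, E j q).continuousOn
      exact ⟨min (1 + ∑ j, E j p) 1, lt_min (hpos p) one_pos, min_le_right _ _,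
        fun q => (min_le_left _ _).trans (hp (mem_univ q))⟩
  have hbd : ∃ M, ∀ (s : Finset ι) (q : S), |∑ j ∈ s, E j q| ≤ M := by
    have h1 : ∀ s : Finset ι, ∃ M, ∀ q, |∑ j ∈ s, E j q| ≤ M := fun s => by
      obtain ⟨M, hM⟩ := isCompact_univ.exists_bound_of_continuousOn (hEs s).continuous.continuousOn
      exact ⟨M, fun q => hM q (mem_univ q)⟩
    choose M hM using h1
    refine ⟨∑ s, |M s|, fun s q => (hM s q).trans ((le_abs_self _).trans ?_)⟩
    exact Finset.single_le_sum (f := fun s => |M s|) (fun _ _ => abs_nonneg _) (Finset.mem_univ s)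
  obtain ⟨M, hM⟩ := hbd
  choose ε₀ hε₀ hmove using fun j => hstep j (κ / 2) (half_pos hκ)
  have hsmall : ∀ᶠ N : ℕ in Filter.atTop, (∀ j, |(N : ℝ)⁻¹| ≤ ε₀ j) ∧ |(N : ℝ)⁻¹| * M ≤ κ / 2 ∧
      1 ≤ N := by
    have h1 : Filter.Tendsto (fun N : ℕ => |(N : ℝ)⁻¹|) Filter.atTop (𝓝 0) := by
      simpa using (tendsto_inv_atTop_nhds_zero_nat (𝕜 := ℝ)).abs
    have h2 := h1.mul_const M
    rw [zero_mul] at h2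
    refine (Filter.eventually_all.2 fun j => h1.eventually (ge_mem_nhds (hε₀ j))).and
      ((h2.eventually (ge_mem_nhds (half_pos hκ))).and (Filter.eventually_ge_atTop 1))
  obtain ⟨N, hNε, hNM, hN⟩ := hsmall.exists
  set ε : ℝ := (N : ℝ)⁻¹
  have hlow : ∀ (s : Finset ι) (q : S), -(κ / 2) ≤ ε * ∑ j ∈ s, E j q := fun s q => by
    have h1 : |ε * ∑ j ∈ s, E j q| ≤ κ / 2 := by
      rw [abs_mul]
      exact (mul_le_mul_of_nonneg_left (hM s q) (abs_nonneg _)).trans hNM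
    exact (abs_le.1 h1).1
  have hround : ∀ F : S → ℝ, ContMDiff (𝓡 2) 𝓘(ℝ, ℝ) ∞ F → (∀ q, κ ≤ F q) → ∀ s : Finset ι,
      Moves m B η F fun q => F q + ε * ∑ j ∈ s, E j q := by
    intro F hF hFκ s
    induction s using Finset.induction_on with
    | empty =>
      simp only [Finset.sum_empty, mul_zero, add_zero]
      exact Moves.refl F
    | insert j s hj ih =>
      have hsum : ∀ q, F q + ε * ∑ i ∈ insert j s, E i q =
          F q + ε * ∑ i ∈ s, E i q + ε * E j q := fun q => by
        rw [Finset.sum_insert hj]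
        ring
      have h1 := hmove j (fun q => F q + ε * ∑ j ∈ s, E j q)
        (hF.add (contMDiff_const.mul (hEs s)))
        (fun q => by linarith [hlow s q, hFκ q]) ε (hNε j)
        (fun q => by
          rw [← hsum]
          linarith [hlow (insert j s) q, hFκ q])
      simp only [hsum]
      exact ih.trans hm h1
  have hpath : ∀ k ≤ N, Moves m B η (fun _ => 1) fun q => 1 + k * ε * ∑ j, E j q := by
    intro k
    induction k with
    | zero =>
      intro _
      simp only [Nat.cast_zero, zero_mul, add_zero]
      exact Moves.refl _
    | succ k ih =>
      intro hk
      have hN0 : (0 : ℝ) < N := by exact_mod_cast hN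
      have hε0 : 0 ≤ k * ε := by positivity
      have hε1 : k * ε ≤ 1 := by
        rw [← div_eq_mul_inv, div_le_one hN0]
        exact_mod_cast (by omega : k ≤ N)
      have h1 := hround (fun q => 1 + k * ε * ∑ j, E j q)
        (contMDiff_const.add (contMDiff_const.mul (hEs Finset.univ)))
        (fun q => by nlinarith [hκf q]) Finset.univ
      have h2 : ∀ q, 1 + ((k + 1 : ℕ) : ℝ) * ε * ∑ j, E j q =
          1 + k * ε * ∑ j, E j q + ε * ∑ j, E j q := fun q => by
        push_cast
        ring
      simp only [h2]
      exact (ih (by omega)).trans hm h1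
  have h := hpath N le_rfl
  have hNε' : (N : ℝ) * ε = 1 := mul_inv_cancel₀ (by exact_mod_cast (by omega : N ≠ 0))
  simpa only [hNε', one_mul] using h

/-- Two `b^m`-symplectic forms that differ by the exterior derivative of `α` have a positive
quotient. -/
theorem Atlas.one_add_sum_ratio_pos [T2Space S] [CompactSpace S] [IsManifold (𝓡 2) ∞ S]
    (hm : 1 ≤ m) {η' : FormField S 2} (hη : IsBmSymplectic m B η) (hη' : IsBmSymplectic m B η')
    {α : FormField S 1} (hα : IsBmForm m B α) (h : ∀ q ∉ B.Z, η' q - η q = extD α q) {ι : Type*}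
    [Fintype ι] (A : Atlas m B η α ι) (q : S) : 0 < 1 + ∑ i, A.ratio i q := by
  set f : S → ℝ := fun q => 1 + ∑ i, A.ratio i q
  have hf : Continuous f :=
    continuous_const.add (continuous_finsetSum _ fun i _ => (A.contMDiff_ratio i).continuous)
  have hff : ∀ q ∉ B.Z, η' q = f q • η q := fun q hq => by
    rw [add_smul, one_smul, ← A.extD_eq hq, ← h q hq, add_sub_cancel]
  have hf0 : ∀ q, f q ≠ 0 := by
    intro q hq0
    by_cases hq : q ∈ B.Z
    · exact hη.ratio_ne_zero hm hη' hα hf hff hq hq0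
    · have := hff q hq
      rw [hq0, zero_smul] at this
      exact hη'.nondegenerate_off q hq this
  -- The set where `f < 0` is open and closed, hence empty.
  have hK : IsClopen {q | f q < 0} := by
    refine ⟨?_, isOpen_lt hf continuous_const⟩
    have : {q | f q < 0} = {q | f q ≤ 0} := by
      ext q
      exact ⟨fun h : f q < 0 => h.le, fun h : f q ≤ 0 => lt_of_le_of_ne h (hf0 q)⟩
    rw [this]
    exact isClosed_le hf continuous_const
  have hKZ : ∀ q ∈ {q | f q < 0}, q ∉ B.Z := by
    intro q hq hqZ
    obtain ⟨p, hp, hp1⟩ := hη.exists_eq_one hm hα hf (fun q hq => by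
      rw [A.extD_eq hq, add_sub_cancel_left]) hK ⟨q, hq, hqZ⟩
    have hp' : f p < 0 := hp
    linarith
  have hempty := A.eq_empty_of_ratio_neg hK hKZ fun q hq => by
    have hq' : 1 + ∑ i, A.ratio i q < 0 := hq
    linarith
  refine lt_of_le_of_ne (not_lt.1 fun h => ?_) (hf0 q).symm
  have : q ∈ {q | f q < 0} := h
  rw [hempty] at this
  exact this

end Moves

end BmSurface

end

theorem corollary4p2 {S : Type*} [TopologicalSpace S] [T2Space S] [CompactSpace S]
    [ChartedSpace (EuclideanSpace ℝ (Fin 2)) S] [IsManifold (𝓡 2) ∞ S]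
    (hS : ¬ BmSurface.Orientable S) (m : ℕ) (hm : 1 ≤ m) (B : BmSurface.Critical S)
    (η₁ η₂ : BmSurface.FormField S 2)
    (h₁ : BmSurface.IsBmSymplectic m B η₁) (h₂ : BmSurface.IsBmSymplectic m B η₂)
    (h : BmSurface.SameClass m B η₁ η₂) :
    ∃ φ : S ≃ₘ^∞⟮𝓡 2, 𝓡 2⟯ S, BmSurface.IsBmMap m B φ ∧
      ∀ q ∉ B.Z, BmSurface.pullback φ η₂ q = η₁ q := by
  obtain ⟨α, hα, hd⟩ := h
  obtain ⟨t, ⟨A⟩⟩ := BmSurface.exists_atlas hm h₂ hα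
  set E : t ⊕ t → S → ℝ :=
    Sum.elim (fun i => BmSurface.ratioX m (A.e i) (A.c i) (A.Q i))
      fun i => BmSurface.ratioY (A.e i) (A.c i) (A.P i)
  have hE : ∀ q, ∑ j, E j q = ∑ i, A.ratio i q := fun q => by
    rw [Fintype.sum_sum_type]
    exact Finset.sum_add_distrib.symm
  obtain ⟨φ, hφ, hφη⟩ := BmSurface.moves_one_add_sum (η := η₂) (B := B) hm (E := E) (by
      rintro (i | i)
      · exact BmSurface.contMDiff_ratioX (A.chart i).toSmoothChart (A.density i) (A.contDiff_Q i)
          (A.compact_Q i) (A.tsupport_Q i)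
      · exact BmSurface.contMDiff_ratioY (A.chart i).toSmoothChart (A.density i) (A.contDiff_P i)
          (A.compact_P i) (A.tsupport_P i)) (by
      rintro (i | i) κ hκ
      · exact (A.chart i).exists_step_x hm (A.density i) (A.contDiff_Q i) (A.compact_Q i)
          (A.tsupport_Q i) hκ
      · exact (A.chart i).exists_step_y (A.density i) (A.contDiff_P i) (A.compact_P i)
          (A.tsupport_P i) hκ) (fun q => by
      rw [hE]
      exact A.one_add_sum_ratio_pos hm h₂ h₁ hα hd q)
  refine ⟨φ, hφ, fun q hq => ?_⟩
  have h3 := hφη q hq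
  simp only [one_smul, hE] at h3
  rw [h3, add_smul, one_smul, ← A.extD_eq hq, ← hd q hq, add_sub_cancel]
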